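/- All abelian varieties are over $\mathbb C$ and all classes below are classes of abelian varieties. For an abelian variety $A$, the Hodge group $G(A)$ is the smallest algebraic subgroup of $GL(H^1(A,\mathbb Q))$, defined over $\mathbb Q$, whose group of complex points contains, for every $z\in\mathbb C$ with $|z|=1$, the operator acting on $H^{1,0}(A)$ as $z$ and on $H^{0,1}(A)$ as $\bar z$. It acts on $H^\star(A,\mathbb Q)=\bigwedge^\star H^1(A,\mathbb Q)$, and $G(A)_{\mathbb C}$ acts on $H^\star(A,\mathbb C)$. For abelian varieties $A$ and $B$, $G(A\times B)$ is a subgroup of $G(A)\times G(B)\subset GL(H^1(A,\mathbb Q))\times GL(H^1(B,\mathbb Q))\subset GL(H^1(A\times B,\mathbb Q))$. A Hodge structure in the cohomology of $A$ is a rational sub-Hodge structure $V$ of $H^n(A,\mathbb Q)$ for some $n\ge 0$; it is irreducible if $V\ne 0$ and its only sub-Hodge structures are $0$ and $V$. It is fully twisted if it is effective ($V^{p,q}=0$ whenever $p<0$ or $q<0$) and $V^{n,0}\neq 0$. We say that $A$ is *dominated* by a class $\mathcal A$ if for every irreducible Hodge structure $V$ in the cohomology of $A$ there are $X\in\mathcal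 A$ and a fully twisted Hodge structure $V'$ in the cohomology of $X$ that is isomorphic to a Tate twist $V(r)$, $r\in\mathbb Z$, of $V$. We say that $A$ is $\mathbb C$-*dominated* by a class $\mathcal A$ if for every irreducible $G(A)_{\mathbb C}$-submodule $U$ of $H^\star(A,\mathbb C)$ there are $X\in\mathcal A$, an integer $n\ge 0$ and a $G(X)_{\mathbb C}$-submodule $U'$ of $H^n(X,\mathbb C)$ such that $U$ and $U'$ are isomorphic as $G(A\times X)_{\mathbb C}$-modules and $U'$ contains a nonzero $(n,0)$-form. **Proposition.** Let $A$ and $B$ be abelian varieties with $G(A\times B)=G(A)\times G(B)$. If $A$ is $\mathbb C$-dominated by a class $\mathcal A$ and $B$ is dominated by a class $\mathcal B$, then $A\times B$ is dominated by $\{X\times Y : X\in\mathcal A,\ Y\in\mathcal B\}$. -/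

import Mathlib

open scoped TensorProduct ComplexConjugate

universe u

noncomputable section

/-- A complex abelian variety, given analytically as a polarizable complex torus `V / Λ`:
`V` is a finite-dimensional complex vector space (the tangent space at the origin), `Λ` is a
lattice in `V` (so `Λ = H₁(V / Λ, ℤ)`), and there is a Riemann form, i.e. an alternating
`ℝ`-bilinear form `E` on `V`, integral on `Λ`, with `E (i x, i y) = E (x, y)` and `E (i x, x) > 0`
for `x ≠ 0`. The dimension may be `0`. -/
structure ComplexAbelianVariety : Type (u + 1) where
  V : Type u
  [normedAddCommGroup : NormedAddCommGroup V]
  [normedSpace : NormedSpace ℂ V]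
  [finiteDimensional : FiniteDimensional ℂ V]
  Λ : Submodule ℤ V
  [discreteTopology : DiscreteTopology Λ]
  [isZLattice : IsZLattice ℝ Λ]
  exists_riemannForm : ∃ E : V →ₗ[ℝ] V →ₗ[ℝ] ℝ,
    (∀ x, E x x = 0) ∧
    (∀ x ∈ Λ, ∀ y ∈ Λ, ∃ m : ℤ, E x y = m) ∧
    (∀ x y, E (Complex.I • x) (Complex.I • y) = E x y) ∧
    (∀ x, x ≠ 0 → 0 < E (Complex.I • x) x)

namespace ComplexAbelianVariety

attribute [instance] normedAddCommGroup normedSpace finiteDimensional discreteTopology isZLattice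

/-! ### Products -/

theorem discreteTopology_prod (A B : ComplexAbelianVariety.{u}) :
    DiscreteTopology (A.Λ.prod B.Λ) := by
  refine DiscreteTopology.of_continuous_injective
    (f := fun x : A.Λ.prod B.Λ => ((⟨x.1.1, x.2.1⟩, ⟨x.1.2, x.2.2⟩) : A.Λ × B.Λ)) ?_ ?_
  · fun_prop
  · rintro ⟨⟨a, b⟩, h⟩ ⟨⟨c, d⟩, h'⟩ e
    simpa using e

theorem isZLattice_prod (A B : ComplexAbelianVariety.{u}) :
    haveI := discreteTopology_prod A B
    IsZLattice ℝ (A.Λ.prod B.Λ) := by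
  have := discreteTopology_prod A B
  constructor
  rw [eq_top_iff]
  rintro ⟨x, y⟩ -
  have hx : x ∈ Submodule.span ℝ (A.Λ : Set A.V) := by
    rw [IsZLattice.span_top]; trivial
  have hy : y ∈ Submodule.span ℝ (B.Λ : Set B.V) := by
    rw [IsZLattice.span_top]; trivial
  have h1 := Submodule.mem_map_of_mem (f := LinearMap.inl ℝ A.V B.V) hx
  have h2 := Submodule.mem_map_of_mem (f := LinearMap.inr ℝ A.V B.V) hy
  rw [Submodule.map_span] at h1 h2
  have h3 : (x, y) = LinearMap.inl ℝ A.V B.V x + LinearMap.inr ℝ A.V B.V y := by simp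
  rw [h3]
  refine add_mem (Submodule.span_mono ?_ h1) (Submodule.span_mono ?_ h2)
  · rintro _ ⟨a, ha, rfl⟩
    exact ⟨ha, zero_mem _⟩
  · rintro _ ⟨b, hb, rfl⟩
    exact ⟨zero_mem _, hb⟩

/-- The product abelian variety `A × B = (V_A × V_B) / (Λ_A × Λ_B)`. -/
def prod (A B : ComplexAbelianVariety.{u}) : ComplexAbelianVariety.{u} where
  V := A.V × B.V
  Λ := A.Λ.prod B.Λ
  discreteTopology := discreteTopology_prod A B
  isZLattice := isZLattice_prod A B
  exists_riemannForm := by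
    obtain ⟨E, h1, h2, h3, h4⟩ := A.exists_riemannForm
    obtain ⟨F, k1, k2, k3, k4⟩ := B.exists_riemannForm
    refine ⟨E.compl₁₂ (LinearMap.fst ℝ A.V B.V) (LinearMap.fst ℝ A.V B.V) +
      F.compl₁₂ (LinearMap.snd ℝ A.V B.V) (LinearMap.snd ℝ A.V B.V), ?_, ?_, ?_, ?_⟩
    · intro x
      simp [h1, k1]
    · rintro x ⟨hx, hx'⟩ y ⟨hy, hy'⟩
      obtain ⟨m, hm⟩ := h2 _ hx _ hy
      obtain ⟨n, hn⟩ := k2 _ hx' _ hy'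
      exact ⟨m + n, by simp [hm, hn]⟩
    · intro x y
      simp [h3, k3]
    · rintro ⟨x, y⟩ hxy
      have hE : ∀ x, 0 ≤ E (Complex.I • x) x := fun x => by
        by_cases hx : x = 0
        · simp [hx]
        · exact (h4 x hx).le
      have hF : ∀ x, 0 ≤ F (Complex.I • x) x := fun x => by
        by_cases hx : x = 0
        · simp [hx]
        · exact (k4 x hx).le
      simp only [LinearMap.add_apply, LinearMap.compl₁₂_apply, LinearMap.fst_apply,
        LinearMap.snd_apply, Prod.smul_fst, Prod.smul_snd]
      by_cases hx : x = 0
      · have hy : y ≠ 0 := fun hy => hxy (by simp [hx, hy])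
        exact add_pos_of_nonneg_of_pos (hE x) (k4 y hy)
      · exact add_pos_of_pos_of_nonneg (h4 x hx) (hF y)

/-- The identification `Λ_{A × B} = Λ_A × Λ_B`. -/
def latticeProd (A B : ComplexAbelianVariety.{u}) : (A.prod B).Λ ≃ₗ[ℤ] A.Λ × B.Λ where
  toFun x := (⟨x.1.1, x.2.1⟩, ⟨x.1.2, x.2.2⟩)
  invFun y := ⟨(y.1.1, y.2.1), y.1.2, y.2.2⟩
  map_add' _ _ := rfl
  map_smul' _ _ := rfl
  left_inv _ := rfl
  right_inv _ := rfl

/-! ### Cohomology and its Hodge decomposition -/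

/-- `H¹(A, k) = Hom(H₁(A, ℤ), k) = Hom(Λ, k)`. -/
abbrev H1 (k : Type*) [Field k] (A : ComplexAbelianVariety.{u}) := A.Λ →ₗ[ℤ] k

/-- `H⋆(A, k)`, the exterior algebra of `H¹(A, k)`; its part of degree `n`,
`Hⁿ(A, k) = ⋀ⁿ H¹(A, k)`, is `⋀[k]^n (H1 k A)`. -/
abbrev Coh (k : Type*) [Field k] (A : ComplexAbelianVariety.{u}) := ExteriorAlgebra k (H1 k A)

/-- `H^{1,0}(A)`: the classes in `H¹(A, ℂ)` that are restrictions to `Λ` of `ℂ`-linear forms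
on `V`. -/
def H10 (A : ComplexAbelianVariety.{u}) : Submodule ℂ (H1 ℂ A) :=
  LinearMap.range
    { toFun := fun ψ : A.V →ₗ[ℂ] ℂ => (ψ.restrictScalars ℤ).comp A.Λ.subtype
      map_add' := fun _ _ => rfl
      map_smul' := fun _ _ => rfl : (A.V →ₗ[ℂ] ℂ) →ₗ[ℂ] H1 ℂ A }

/-- `H^{0,1}(A)`: the classes in `H¹(A, ℂ)` that are restrictions to `Λ` of conjugate-linear forms
on `V`. -/
def H01 (A : ComplexAbelianVariety.{u}) : Submodule ℂ (H1 ℂ A) :=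
  LinearMap.range
    { toFun := fun ψ : A.V →ₗ⋆[ℂ] ℂ => ψ.toAddMonoidHom.toIntLinearMap.comp A.Λ.subtype
      map_add' := fun _ _ => rfl
      map_smul' := fun _ _ => rfl : (A.V →ₗ⋆[ℂ] ℂ) →ₗ[ℂ] H1 ℂ A }

/-- `H^{p,q}(A) = ⋀^p H^{1,0} ∧ ⋀^q H^{0,1}`, as a subspace of `H⋆(A, ℂ)`; it is zero if
`p < 0` or `q < 0`. -/
def Hpq (A : ComplexAbelianVariety.{u}) (p q : ℤ) : Submodule ℂ (Coh ℂ A) :=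
  if 0 ≤ p ∧ 0 ≤ q then
    (A.H10.map (ExteriorAlgebra.ι ℂ)) ^ p.toNat * (A.H01.map (ExteriorAlgebra.ι ℂ)) ^ q.toNat
  else ⊥

/-- The change of coefficients `H¹(A, ℚ) → H¹(A, ℂ)`. -/
def H1Complexify (A : ComplexAbelianVariety.{u}) : H1 ℚ A →ₗ[ℚ] H1 ℂ A where
  toFun φ := (algebraMap ℚ ℂ).toIntAlgHom.toLinearMap.comp φ
  map_add' _ _ := by ext; simp
  map_smul' _ _ := by ext; simp [Algebra.smul_def]

/-- The change of coefficients `H⋆(A, ℚ) → H⋆(A, ℂ)`: the ring homomorphism that is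
`H1Complexify` in degree `1`. -/
def cohComplexify (A : ComplexAbelianVariety.{u}) : Coh ℚ A →ₐ[ℚ] Coh ℂ A :=
  ExteriorAlgebra.lift ℚ
    ⟨((ExteriorAlgebra.ι ℂ).restrictScalars ℚ).comp A.H1Complexify, fun _ => by simp⟩

/-! ### Rational Hodge structures in the cohomology -/

/-- For a rational subspace `W` of `H⋆(A, ℚ)`, the subspace `W^{p,q}` of `W_ℂ = ℂ ⊗ W`, the
inverse image of `H^{p,q}(A)` under the natural map `ℂ ⊗ W → H⋆(A, ℂ)`. -/
def hodgeComponent (A : ComplexAbelianVariety.{u}) (W : Submodule ℚ (Coh ℚ A)) (p q : ℤ) :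
    Submodule ℂ (ℂ ⊗[ℚ] W) :=
  (A.Hpq p q).comap
    (LinearMap.liftBaseChange ℂ (A.cohComplexify.toLinearMap.comp W.subtype))

/-- `W` is a Hodge structure in `Hⁿ(A, ℚ)`, i.e. a rational subspace such that
`W_ℂ = ⨁_{p + q = n} W^{p,q}`. -/
def IsHodgeSubstructure (A : ComplexAbelianVariety.{u}) (n : ℕ) (W : Submodule ℚ (Coh ℚ A)) :
    Prop :=
  W ≤ ⋀[ℚ]^n (H1 ℚ A) ∧ ⨆ p : ℤ, A.hodgeComponent W p (n - p) = ⊤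

/-- `W` is an irreducible Hodge structure in `Hⁿ(A, ℚ)`. -/
def IsIrreducibleHodgeSubstructure (A : ComplexAbelianVariety.{u}) (n : ℕ)
    (W : Submodule ℚ (Coh ℚ A)) : Prop :=
  A.IsHodgeSubstructure n W ∧ W ≠ ⊥ ∧
    ∀ W₁ ≤ W, A.IsHodgeSubstructure n W₁ → W₁ = ⊥ ∨ W₁ = W

/-- `W` is a fully twisted Hodge structure in `Hⁿ(A, ℚ)`: it is effective and `W^{n,0} ≠ 0`. -/
def IsFullyTwisted (A : ComplexAbelianVariety.{u}) (n : ℕ) (W : Submodule ℚ (Coh ℚ A)) : Prop :=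
  A.IsHodgeSubstructure n W ∧
    (∀ p q : ℤ, p < 0 ∨ q < 0 → A.hodgeComponent W p q = ⊥) ∧
    A.hodgeComponent W n 0 ≠ ⊥

/-- `W'`, in the cohomology of `X`, is isomorphic to a Tate twist `W(r)` of `W`, in the cohomology
of `A`: there is an isomorphism of rational vector spaces whose complexification carries
`W(r)^{p,q} = W^{p+r,q+r}` onto `W'^{p,q}`. -/
def IsIsoToTateTwist {A X : ComplexAbelianVariety.{u}} (W : Submodule ℚ (Coh ℚ A))
    (W' : Submodule ℚ (Coh ℚ X)) : Prop :=
  ∃ (r : ℤ) (f : W ≃ₗ[ℚ] W'), ∀ p q : ℤ,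
    (A.hodgeComponent W (p + r) (q + r)).map (f.toLinearMap.baseChange ℂ) =
      X.hodgeComponent W' p q

/-- `A` is dominated by the class `𝒜`: every irreducible Hodge structure in the cohomology
of `A` has a Tate twist isomorphic to a fully twisted Hodge structure in the cohomology of some
member of `𝒜`. -/
def IsDominated (A : ComplexAbelianVariety.{u}) (𝒜 : Set ComplexAbelianVariety.{u}) : Prop :=
  ∀ (n : ℕ) (W : Submodule ℚ (Coh ℚ A)), A.IsIrreducibleHodgeSubstructure n W →
    ∃ X ∈ 𝒜, ∃ (m : ℕ) (W' : Submodule ℚ (Coh ℚ X)),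
      X.IsFullyTwisted m W' ∧ IsIsoToTateTwist W W'

/-! ### The Hodge group -/

/-- The group of complex points of `GL(H¹(A, ℚ))`. -/
abbrev GLH1 (A : ComplexAbelianVariety.{u}) := H1 ℂ A ≃ₗ[ℂ] H1 ℂ A

/-- `Γ ≤ GL(H¹(A, ℂ))` is (the group of complex points of) an algebraic subgroup of `GL(H¹(A, ℚ))`
defined over `ℚ`: it is cut out by polynomials with rational coefficients in the matrix entries
`(g φ) λ`, where `φ ∈ H¹(A, ℚ)` and `λ ∈ Λ = H₁(A, ℤ)`. -/
def IsAlgebraicOverRat (A : ComplexAbelianVariety.{u}) (Γ : Subgroup A.GLH1) : Prop :=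
  ∃ S : Set (MvPolynomial (H1 ℚ A × A.Λ) ℚ), ∀ g : A.GLH1,
    g ∈ Γ ↔ ∀ P ∈ S, MvPolynomial.aeval (fun x => g (A.H1Complexify x.1) x.2) P = 0

/-- `g` is the operator on `H¹(A, ℂ)` by which `z`, in the unit circle, acts through the Hodge
structure: multiplication by `z` on `H^{1,0}` and by the conjugate of `z` on `H^{0,1}`. -/
def IsHodgeOperator (A : ComplexAbelianVariety.{u}) (z : ℂ) (g : A.GLH1) : Prop :=
  (∀ φ ∈ A.H10, g φ = z • φ) ∧ (∀ φ ∈ A.H01, g φ = conj z • φ)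

/-- The (complex points of the) Hodge group `G(A)`: the smallest algebraic subgroup of
`GL(H¹(A, ℚ))` defined over `ℚ` that contains the action of the unit circle on `H¹`. -/
def hodgeGroup (A : ComplexAbelianVariety.{u}) : Subgroup A.GLH1 :=
  sInf {Γ | A.IsAlgebraicOverRat Γ ∧ ∀ (z : ℂ) (g : A.GLH1), ‖z‖ = 1 → A.IsHodgeOperator z g →
    g ∈ Γ}

/-- `H¹(A, ℂ) ⊕ H¹(B, ℂ) ≃ H¹(A × B, ℂ)`, the sum of the pullbacks under the two projections. -/
def H1Prod (A B : ComplexAbelianVariety.{u}) : (H1 ℂ A × H1 ℂ B) ≃ₗ[ℂ] H1 ℂ (A.prod B) where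
  toFun x := (x.1.coprod x.2).comp (latticeProd A B).toLinearMap
  invFun φ := ((φ.comp (latticeProd A B).symm.toLinearMap).comp (LinearMap.inl ℤ A.Λ B.Λ),
    (φ.comp (latticeProd A B).symm.toLinearMap).comp (LinearMap.inr ℤ A.Λ B.Λ))
  map_add' x y := by
    ext v
    simp only [LinearMap.comp_apply, LinearMap.coprod_apply, LinearMap.add_apply, Prod.fst_add,
      Prod.snd_add]
    ring
  map_smul' c x := by
    ext v
    simp [mul_add]
  left_inv x := by
    ext v <;> simp
  right_inv φ := by
    ext v
    simp

/-- The embedding `GL(H¹(A)) × GL(H¹(B)) → GL(H¹(A × B))`. -/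
def prodGL (A B : ComplexAbelianVariety.{u}) : A.GLH1 × B.GLH1 →* (A.prod B).GLH1 where
  toFun x := (H1Prod A B).symm ≪≫ₗ (x.1.prodCongr x.2) ≪≫ₗ H1Prod A B
  map_one' := by
    ext1 φ
    exact (H1Prod A B).apply_symm_apply φ
  map_mul' x y := by
    ext1 φ
    simp [LinearEquiv.mul_apply]

/-! ### Modules over the Hodge group -/

/-- The action of `GL(H¹(A, ℂ))` on `H⋆(A, ℂ)`. -/
def act (A : ComplexAbelianVariety.{u}) (g : A.GLH1) : Coh ℂ A →ₐ[ℂ] Coh ℂ A :=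
  ExteriorAlgebra.map g.toLinearMap

/-- `U` is a `G(A)_ℂ`-submodule of `H⋆(A, ℂ)`. -/
def IsHodgeGroupSubmodule (A : ComplexAbelianVariety.{u}) (U : Submodule ℂ (Coh ℂ A)) : Prop :=
  ∀ g ∈ A.hodgeGroup, ∀ v ∈ U, A.act g v ∈ U

/-- `U` is an irreducible `G(A)_ℂ`-submodule of `H⋆(A, ℂ)`. -/
def IsIrreducibleHodgeGroupSubmodule (A : ComplexAbelianVariety.{u})
    (U : Submodule ℂ (Coh ℂ A)) : Prop :=
  A.IsHodgeGroupSubmodule U ∧ U ≠ ⊥ ∧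
    ∀ U₁ ≤ U, A.IsHodgeGroupSubmodule U₁ → U₁ = ⊥ ∨ U₁ = U

/-- `U`, in the cohomology of `A`, and `U'`, in the cohomology of `X`, are isomorphic as modules
over `G(A × X)_ℂ`, which is contained in `G(A)_ℂ × G(X)_ℂ` and so acts on both: an element `(a, x)`
acts on `U` through `a` and on `U'` through `x`. -/
def IsIsoOverProduct {A X : ComplexAbelianVariety.{u}} (U : Submodule ℂ (Coh ℂ A))
    (U' : Submodule ℂ (Coh ℂ X)) : Prop :=
  ∃ f : U ≃ₗ[ℂ] U', ∀ (a : A.GLH1) (x : X.GLH1), prodGL A X (a, x) ∈ (A.prod X).hodgeGroup →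
    ∀ v w : U, (w : Coh ℂ A) = A.act a v → (f w : Coh ℂ X) = X.act x (f v)

/-- `A` is `ℂ`-dominated by the class `𝒜`: for every irreducible `G(A)_ℂ`-submodule `U` of
`H⋆(A, ℂ)` there are `X ∈ 𝒜` and a `G(X)_ℂ`-submodule `U'` of some `Hⁿ(X, ℂ)` that is isomorphic
to `U` over `G(A × X)_ℂ` and contains a nonzero `(n, 0)`-form. -/
def IsCDominated (A : ComplexAbelianVariety.{u}) (𝒜 : Set ComplexAbelianVariety.{u}) : Prop :=
  ∀ U : Submodule ℂ (Coh ℂ A), A.IsIrreducibleHodgeGroupSubmodule U →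
    ∃ X ∈ 𝒜, ∃ (n : ℕ) (U' : Submodule ℂ (Coh ℂ X)),
      U' ≤ ⋀[ℂ]^n (H1 ℂ X) ∧ X.IsHodgeGroupSubmodule U' ∧ IsIsoOverProduct U U' ∧
      ∃ ω ∈ U', ω ∈ X.Hpq n 0 ∧ ω ≠ 0

end ComplexAbelianVariety

end

/-! For an irreducible Hodge structure W in the cohomology of A × B it is enough to find a morphism
F, defined over ℚ, to some H^{d+m}(X × Y) such that F(W) has a nonzero (d+m, 0)-part. The kernel of
F on W is a Hodge substructure, hence zero, and an injective morphism is an isomorphism onto its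
image up to a Tate twist (`IsIrreducibleHodgeSubstructure.isFullyTwisted_map`). F is built as a
tensor product ψ' ⊗ β' along the Künneth formula. "Holomorphic part" below means the image under
`projHp0`, an algebra endomorphism compatible with Künneth that kills every type (p, q) with q > 0.

Since G(A × B) = G(A) × G(B), the space W_ℂ is stable under each factor separately. Contracting W
with a rational linear form on H⋆(A) gives a rational Hodge structure in H⋆(B), and domination of B
gives β' over ℚ that is nonzero on it after passing to holomorphic parts. Composing β', the
holomorphic part and a linear form μ on H⋆(Y, ℂ) gives a linear form ν on H⋆(B, ℂ). Contracting W_ℂ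
with ν gives a nonzero G(A)_ℂ-submodule of H⋆(A, ℂ), which need not be rational. This is why
ℂ-domination is asked of A: it supplies a complex map ψ to H^d(X, ℂ), equivariant under G(A × X)_ℂ,
with nonzero holomorphic part on this submodule.

Descent makes ψ rational. Write ψ = ∑ e_j ψ_j with e_j in a basis of ℂ over ℚ and ψ_j rational.
Hodge groups are defined over ℚ, so they are stable under Aut(ℂ), and conjugating the equivariance
of ψ gives ∑ σ(e_j) (ψ_j g − h ψ_j) = 0 for every σ. An Artin-type argument based on ℂ^{Aut ℂ} = ℚ
(`LinearIndependent.eq_zero_of_forall_ringEquiv_sum_smul`) makes every ψ_j equivariant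
(`complexifyMap_ratComponent_act`). One of them keeps a nonzero holomorphic part and serves as ψ'.

Maps given only on a submodule are extended to the whole cohomology by equivariant projections.
These come from complete reducibility: by the polarization, the Hodge group is closed under
conjugate transposition in a suitable basis (`exists_basis_conjTranspose`), so orthogonal
complements are stable. -/

noncomputable section

/-! ### Automorphisms of ℂ -/

/-- A ring automorphism of the polynomial algebra on a transcendence basis of an algebraically
closed field extends to the field. -/
theorem IsTranscendenceBasis.exists_ringEquiv_extend {R L ι : Type*} [CommRing R] [Field L]
    [IsAlgClosed L] [Algebra R L] {v : ι → L} (hv : IsTranscendenceBasis R v)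
    (e : MvPolynomial ι R ≃+* MvPolynomial ι R) :
    ∃ σ : L ≃+* L, ∀ p, σ (MvPolynomial.aeval v p) = MvPolynomial.aeval v (e p) := by
  have := RingHom.domain_nontrivial (algebraMap R L)
  have := IsAlgClosed.isAlgClosure_of_transcendence_basis v hv
  let e' : Algebra.adjoin R (Set.range v) ≃+* Algebra.adjoin R (Set.range v) :=
    (hv.1.aevalEquiv.symm.toRingEquiv.trans e).trans hv.1.aevalEquiv.toRingEquiv
  refine ⟨IsAlgClosure.equivOfEquiv L L e', fun p => ?_⟩
  have h1 : MvPolynomial.aeval v p =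
      algebraMap (Algebra.adjoin R (Set.range v)) L (hv.1.aevalEquiv p) := by
    simp
  rw [h1, IsAlgClosure.equivOfEquiv_algebraMap]
  simp [e']

/-- The fixed field of the automorphism group of `ℂ` is `ℚ`. -/
theorem Complex.exists_ratCast_eq_of_forall_ringEquiv {z : ℂ} (hz : ∀ σ : ℂ ≃+* ℂ, σ z = z) :
    ∃ q : ℚ, (q : ℂ) = z := by
  by_cases halg : IsAlgebraic ℚ z
  · let z' : algebraicClosure ℚ ℂ := ⟨z, mem_algebraicClosure_iff.2 halg⟩
    have : IsAlgClosure ℚ (algebraicClosure ℚ ℂ) := algebraicClosure.isAlgClosure ℚ ℂ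
    have : Normal ℚ (algebraicClosure ℚ ℂ) := IsAlgClosure.normal ℚ _
    have : IsGalois ℚ (algebraicClosure ℚ ℂ) := ⟨⟩
    obtain ⟨s, hs⟩ := exists_isTranscendenceBasis (algebraicClosure ℚ ℂ) ℂ
    have h : z' ∈ (⊥ : IntermediateField ℚ (algebraicClosure ℚ ℂ)) := by
      rw [InfiniteGalois.mem_bot_iff_fixed]
      intro τ
      -- Every automorphism τ of the algebraic closure of ℚ extends to ℂ: let it act on the
      -- coefficients of polynomials in a transcendence basis.
      obtain ⟨σ, hσ⟩ := hs.exists_ringEquiv_extend (MvPolynomial.mapEquiv _ τ.toRingEquiv)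
      have := hσ (MvPolynomial.C z')
      simp only [MvPolynomial.aeval_C, MvPolynomial.mapEquiv_apply, MvPolynomial.map_C] at this
      apply (algebraMap (algebraicClosure ℚ ℂ) ℂ).injective
      exact this.symm.trans (hz σ)
    obtain ⟨q, hq⟩ := IntermediateField.mem_bot.1 h
    exact ⟨q, by simpa using congrArg (algebraMap (algebraicClosure ℚ ℂ) ℂ) hq⟩
  · exfalso
    have hind : AlgebraicIndepOn ℚ id ({z} : Set ℂ) :=
      algebraicIndependent_unique_type_iff.2 halg
    obtain ⟨s, hs, hs'⟩ := exists_isTranscendenceBasis_superset hind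
    -- A transcendental `z` belongs to a transcendence basis. Changing the sign of the whole basis
    -- extends to an automorphism of ℂ that moves `z` to `-z`.
    let neg : MvPolynomial s ℚ →ₐ[ℚ] MvPolynomial s ℚ :=
      MvPolynomial.aeval fun i => -MvPolynomial.X i
    have hneg : neg.comp neg = AlgHom.id ℚ _ := by
      ext i
      simp [neg]
    obtain ⟨σ, hσ⟩ := hs'.exists_ringEquiv_extend
      (AlgEquiv.ofAlgHom neg neg hneg hneg).toRingEquiv
    have h := hσ (MvPolynomial.X ⟨z, hs rfl⟩)
    simp only [MvPolynomial.aeval_X, hz] at h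
    have h0 : z = -z := by simpa [neg] using h
    have : z = 0 := by linear_combination h0 / 2
    exact halg (this ▸ isAlgebraic_zero)

/-- A vector orthogonal to all the conjugates of a `ℚ`-independent family is zero. -/
theorem LinearIndependent.eq_zero_of_forall_ringEquiv_sum_smul {ι N : Type*} [AddCommGroup N]
    [Module ℂ N] {e : ι → ℂ} (he : LinearIndependent ℚ e) (s : Finset ι) (v : ι → N)
    (h : ∀ σ : ℂ ≃+* ℂ, ∑ j ∈ s, σ (e j) • v j = 0) : ∀ j ∈ s, v j = 0 := by
  have key : ∀ (s : Finset ι) (v : ι → ℂ), (∀ σ : ℂ ≃+* ℂ, ∑ j ∈ s, σ (e j) * v j = 0) →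
      ∀ j ∈ s, v j = 0 := by
    classical
    intro s
    induction s using Finset.strongInduction with
    | H s ih =>
      intro v h
      by_contra! hne
      obtain ⟨j₀, hj₀, hv⟩ := hne
      -- Normalize the relation so that its coefficient at `j₀` is 1.
      have hu : ∀ σ : ℂ ≃+* ℂ, ∑ j ∈ s, σ (e j) * (v j / v j₀) = 0 := fun σ => by
        simp_rw [← mul_div_assoc, ← Finset.sum_div, h, zero_div]
      have hfix : ∀ j ∈ s, ∀ τ : ℂ ≃+* ℂ, τ (v j / v j₀) = v j / v j₀ := by
        intro j hj τ
        by_cases hjj : j = j₀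
        · subst hjj
          simp [hv]
        -- Subtracting the normalized relation from its image under τ cancels the term at `j₀`, so
        -- the induction hypothesis applies to what is left.
        refine sub_eq_zero.1 (ih (s.erase j₀) (Finset.erase_ssubset hj₀)
          (fun j => τ (v j / v j₀) - v j / v j₀) (fun σ => ?_) j (Finset.mem_erase.2 ⟨hjj, hj⟩))
        rw [Finset.sum_erase _ (by simp [hv])]
        -- The relation at τ⁻¹σ, after applying τ, has the same factors σ(e_j) and the coefficients
        -- moved by τ.
        have h1 := congrArg τ (hu (σ.trans τ.symm))
        simp only [map_sum, map_mul, RingEquiv.trans_apply, RingEquiv.apply_symm_apply,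
          map_zero] at h1
        simp only [mul_sub, Finset.sum_sub_distrib, h1, hu σ, sub_zero]
      have hq : ∀ j, ∃ q : ℚ, j ∈ s → (q : ℂ) = v j / v j₀ := fun j => by
        by_cases hj : j ∈ s
        · obtain ⟨q, hq⟩ := Complex.exists_ratCast_eq_of_forall_ringEquiv (hfix j hj)
          exact ⟨q, fun _ => hq⟩
        · exact ⟨0, fun h => absurd h hj⟩
      choose q hq using hq
      -- All coefficients are rational, so the relation at σ = id contradicts the independence of
      -- `e`.
      have h0 : ∑ j ∈ s, q j • e j = 0 := by
        rw [← hu (RingEquiv.refl ℂ)]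
        refine Finset.sum_congr rfl fun j hj => ?_
        rw [← hq j hj, Rat.smul_def, mul_comm]
        rfl
      have h1 := linearIndependent_iff'.1 he s q h0 j₀ hj₀
      have h2 := hq j₀ hj₀
      rw [h1, div_self hv] at h2
      simp at h2
  intro j hj
  by_contra hne
  -- Vectors reduce to scalars by testing against a linear form.
  obtain ⟨f, hf⟩ := Module.Projective.exists_dual_ne_zero ℂ hne
  refine hf (key s (fun j => f (v j)) (fun σ => ?_) j hj)
  simpa using congrArg f (h σ)

namespace ComplexAbelianVariety

variable {A B X Y : ComplexAbelianVariety.{u}}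

/-! ### Bases of the cohomology -/

theorem moduleFinite_lattice (A : ComplexAbelianVariety.{u}) : Module.Finite ℤ A.Λ :=
  ZLattice.module_finite ℝ A.Λ

theorem moduleFree_lattice (A : ComplexAbelianVariety.{u}) : Module.Free ℤ A.Λ :=
  ZLattice.module_free ℝ A.Λ

attribute [instance] moduleFinite_lattice moduleFree_lattice

/-- The first Betti number. -/
abbrev betti (A : ComplexAbelianVariety.{u}) : ℕ := Module.finrank ℤ A.Λ

/-- A basis of `H₁(A, ℤ)`. -/
def latticeBasis (A : ComplexAbelianVariety.{u}) : Module.Basis (Fin A.betti) ℤ A.Λ :=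
  Module.finBasis ℤ A.Λ

/-- The basis of `H¹(A, k)` dual to `latticeBasis`. -/
def H1Basis (k : Type*) [Field k] (A : ComplexAbelianVariety.{u}) :
    Module.Basis (Fin A.betti) k (H1 k A) :=
  Module.Basis.ofEquivFun (A.latticeBasis.constr k).symm

@[simp]
theorem H1Basis_repr (k : Type*) [Field k] (φ : H1 k A) (j : Fin A.betti) :
    (A.H1Basis k).repr φ j = φ (A.latticeBasis j) := by
  rw [← Module.Basis.equivFun_apply]
  simp [H1Basis, Module.Basis.constr]

theorem H1Basis_apply (k : Type*) [Field k] (i j : Fin A.betti) :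
    A.H1Basis k i (A.latticeBasis j) = if i = j then 1 else 0 := by
  rw [← H1Basis_repr, Module.Basis.repr_self, Finsupp.single_apply]

theorem H1_eq_sum (k : Type*) [Field k] (φ : H1 k A) :
    φ = ∑ j, φ (A.latticeBasis j) • A.H1Basis k j := by
  conv_lhs => rw [← (A.H1Basis k).sum_repr φ]
  simp

theorem H1Complexify_apply (φ : H1 ℚ A) (l : A.Λ) : A.H1Complexify φ l = (φ l : ℂ) := rfl

@[simp]
theorem H1Complexify_H1Basis (i : Fin A.betti) :
    A.H1Complexify (A.H1Basis ℚ i) = A.H1Basis ℂ i := by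
  refine A.latticeBasis.ext fun j => ?_
  rw [H1Complexify_apply, H1Basis_apply, H1Basis_apply]
  split_ifs <;> simp

theorem moduleFinite_coh (k : Type*) [Field k] (A : ComplexAbelianVariety.{u}) :
    Module.Finite k (Coh k A) :=
  Module.Finite.of_basis (A.H1Basis k).ExteriorAlgebra

attribute [instance] moduleFinite_coh

@[simp]
theorem cohComplexify_ι (φ : H1 ℚ A) :
    A.cohComplexify (ExteriorAlgebra.ι ℚ φ) = ExteriorAlgebra.ι ℂ (A.H1Complexify φ) := by
  simp [cohComplexify]

theorem cohComplexify_ιMulti {n : ℕ} (v : Fin n → H1 ℚ A) :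
    A.cohComplexify (ExteriorAlgebra.ιMulti ℚ n v) =
      ExteriorAlgebra.ιMulti ℂ n (A.H1Complexify ∘ v) := by
  simp [ExteriorAlgebra.ιMulti_apply, map_list_prod, List.map_ofFn, Function.comp_def]

theorem cohComplexify_basis (s : Finset (Fin A.betti)) :
    A.cohComplexify ((A.H1Basis ℚ).ExteriorAlgebra s) = (A.H1Basis ℂ).ExteriorAlgebra s := by
  rw [ExteriorAlgebra.basis_apply, ExteriorAlgebra.basis_apply]
  simp only [ExteriorAlgebra.ιMulti_family]
  rw [cohComplexify_ιMulti]
  congr 1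
  ext i : 1
  simp

/-! ### Extension of scalars from `ℚ` to `ℂ` -/

/-- The exterior monomials in the rational dual lattice basis are carried to the corresponding
complex monomials, so a basis goes to a basis. -/
theorem isBaseChange_cohComplexify (A : ComplexAbelianVariety.{u}) :
    IsBaseChange ℂ A.cohComplexify.toLinearMap := by
  refine IsBaseChange.of_equiv (((A.H1Basis ℚ).ExteriorAlgebra.baseChange ℂ).equiv
    (A.H1Basis ℂ).ExteriorAlgebra (Equiv.refl _)) fun x => ?_
  rw [← (A.H1Basis ℚ).ExteriorAlgebra.sum_repr x]
  simp only [TensorProduct.tmul_sum, map_sum]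
  refine Finset.sum_congr rfl fun s _ => ?_
  rw [AlgHom.toLinearMap_apply, map_smul, cohComplexify_basis, TensorProduct.tmul_smul,
    ← Module.Basis.baseChange_apply]
  rw [← algebraMap_smul ℂ, map_smul, Module.Basis.equiv_apply, algebraMap_smul]
  rfl

theorem coh_hom_ext {N : Type*} [AddCommGroup N] [Module ℂ N] {f g : Coh ℂ A →ₗ[ℂ] N}
    (h : ∀ m, f (A.cohComplexify m) = g (A.cohComplexify m)) : f = g :=
  A.isBaseChange_cohComplexify.algHom_ext f g h

/-- The `ℂ`-linear extension of a `ℚ`-linear map out of `H⋆(A, ℚ)`. -/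
def extendLinear {N : Type*} [AddCommGroup N] [Module ℚ N] [Module ℂ N] [IsScalarTower ℚ ℂ N]
    (f : Coh ℚ A →ₗ[ℚ] N) : Coh ℂ A →ₗ[ℂ] N :=
  A.isBaseChange_cohComplexify.lift f

@[simp]
theorem extendLinear_cohComplexify {N : Type*} [AddCommGroup N] [Module ℚ N] [Module ℂ N]
    [IsScalarTower ℚ ℂ N] (f : Coh ℚ A →ₗ[ℚ] N) (m : Coh ℚ A) :
    extendLinear f (A.cohComplexify m) = f m :=
  A.isBaseChange_cohComplexify.lift_eq f m

/-- The complexification of a `ℚ`-linear map between cohomologies. -/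
def complexifyMap (f : Coh ℚ A →ₗ[ℚ] Coh ℚ X) : Coh ℂ A →ₗ[ℂ] Coh ℂ X :=
  extendLinear (X.cohComplexify.toLinearMap ∘ₗ f)

@[simp]
theorem complexifyMap_cohComplexify (f : Coh ℚ A →ₗ[ℚ] Coh ℚ X) (m : Coh ℚ A) :
    complexifyMap f (A.cohComplexify m) = X.cohComplexify (f m) := by
  simp [complexifyMap]

theorem complexifyMap_comp (g : Coh ℚ X →ₗ[ℚ] Coh ℚ Y) (f : Coh ℚ A →ₗ[ℚ] Coh ℚ X) :
    complexifyMap (g ∘ₗ f) = complexifyMap g ∘ₗ complexifyMap f :=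
  coh_hom_ext fun m => by simp

/-- The complexification of a rational subspace of the cohomology. -/
def complexSpan (W : Submodule ℚ (Coh ℚ A)) : Submodule ℂ (Coh ℂ A) :=
  Submodule.span ℂ (A.cohComplexify '' W)

theorem cohComplexify_mem_complexSpan {W : Submodule ℚ (Coh ℚ A)} {m : Coh ℚ A} (hm : m ∈ W) :
    A.cohComplexify m ∈ complexSpan W :=
  Submodule.subset_span ⟨m, hm, rfl⟩

theorem complexSpan_le {W : Submodule ℚ (Coh ℚ A)} {U : Submodule ℂ (Coh ℂ A)} :
    complexSpan W ≤ U ↔ ∀ m ∈ W, A.cohComplexify m ∈ U := by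
  rw [complexSpan, Submodule.span_le, Set.image_subset_iff]
  rfl

theorem complexSpan_mono {W₁ W₂ : Submodule ℚ (Coh ℚ A)} (h : W₁ ≤ W₂) :
    complexSpan W₁ ≤ complexSpan W₂ :=
  complexSpan_le.2 fun _ hm => cohComplexify_mem_complexSpan (h hm)

theorem complexSpan_map (f : Coh ℚ A →ₗ[ℚ] Coh ℚ X) (W : Submodule ℚ (Coh ℚ A)) :
    complexSpan (W.map f) = (complexSpan W).map (complexifyMap f) := by
  rw [complexSpan, complexSpan, Submodule.map_span, Submodule.map_coe, ← Set.image_comp,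
    ← Set.image_comp]
  congr 1
  refine Set.image_congr fun m _ => ?_
  simp

/-- The natural map `ℂ ⊗ W → H⋆(A, ℂ)`. -/
def tensorToCoh (W : Submodule ℚ (Coh ℚ A)) : (ℂ ⊗[ℚ] W) →ₗ[ℂ] Coh ℂ A :=
  LinearMap.liftBaseChange ℂ (A.cohComplexify.toLinearMap.comp W.subtype)

@[simp]
theorem tensorToCoh_tmul (W : Submodule ℚ (Coh ℚ A)) (c : ℂ) (w : W) :
    tensorToCoh W (c ⊗ₜ w) = c • A.cohComplexify w := by
  simp [tensorToCoh]

/-- By flatness, the inclusion of `W` stays injective after tensoring with ℂ; it is followed by the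
isomorphism ℂ ⊗ H⋆(A, ℚ) ≃ H⋆(A, ℂ). -/
theorem tensorToCoh_injective (W : Submodule ℚ (Coh ℚ A)) :
    Function.Injective (tensorToCoh W) := by
  have : tensorToCoh W = A.isBaseChange_cohComplexify.equiv.toLinearMap ∘ₗ
      W.subtype.baseChange ℂ := by
    ext w
    simp [IsBaseChange.equiv_tmul]
  rw [this, LinearMap.coe_comp]
  exact A.isBaseChange_cohComplexify.equiv.injective.comp
    (Module.Flat.lTensor_preserves_injective_linearMap _ W.injective_subtype)

theorem range_tensorToCoh (W : Submodule ℚ (Coh ℚ A)) :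
    LinearMap.range (tensorToCoh W) = complexSpan W := by
  apply le_antisymm
  · rintro _ ⟨t, rfl⟩
    induction t with
    | zero => simp
    | add x y hx hy => rw [map_add]; exact add_mem hx hy
    | tmul c w =>
      rw [tensorToCoh_tmul]
      exact Submodule.smul_mem _ _ (cohComplexify_mem_complexSpan w.2)
  · exact complexSpan_le.2 fun m hm => ⟨1 ⊗ₜ ⟨m, hm⟩, by simp⟩

theorem cohComplexify_injective (A : ComplexAbelianVariety.{u}) :
    Function.Injective A.cohComplexify := fun x y h => by
  have h1 := A.isBaseChange_cohComplexify.equiv.injective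
    (a₁ := 1 ⊗ₜ x) (a₂ := 1 ⊗ₜ y) (by simpa [IsBaseChange.equiv_tmul] using h)
  exact Module.Flat.rTensor_preserves_injective_linearMap (M := Coh ℚ A)
    (Algebra.linearMap ℚ ℂ) (algebraMap ℚ ℂ).injective |>.comp
    (TensorProduct.lid ℚ (Coh ℚ A)).symm.injective (by simpa using h1)

theorem complexSpan_eq_bot {W : Submodule ℚ (Coh ℚ A)} : complexSpan W = ⊥ ↔ W = ⊥ := by
  rw [eq_bot_iff, complexSpan_le, eq_bot_iff]
  refine forall₂_congr fun m _ => ?_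
  rw [Submodule.mem_bot, Submodule.mem_bot, map_eq_zero_iff _ A.cohComplexify_injective]

/-! ### Coordinates over `ℚ` -/

/-- A basis of `ℂ` over `ℚ`. -/
abbrev complexRatBasis : Module.Basis (Module.Basis.ofVectorSpaceIndex ℚ ℂ) ℚ ℂ :=
  Module.Basis.ofVectorSpace ℚ ℂ

/-- The coordinates in `H⋆(A, ℚ)` of an element of `H⋆(A, ℂ) = ⨁ e_j ⊗ H⋆(A, ℚ)`, where `e_j` runs
through a basis of `ℂ` over `ℚ`. -/
def ratCoord (A : ComplexAbelianVariety.{u}) :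
    Coh ℂ A ≃ₗ[ℚ] (Module.Basis.ofVectorSpaceIndex ℚ ℂ →₀ Coh ℚ A) :=
  A.isBaseChange_cohComplexify.equiv.symm.restrictScalars ℚ ≪≫ₗ
    TensorProduct.equivFinsuppOfBasisLeft complexRatBasis

theorem ratCoord_smul_cohComplexify (c : ℂ) (m : Coh ℚ A) (j) :
    A.ratCoord (c • A.cohComplexify m) j = complexRatBasis.repr c j • m := by
  have h : A.isBaseChange_cohComplexify.equiv.symm (c • A.cohComplexify m) = c ⊗ₜ m := by
    rw [LinearEquiv.symm_apply_eq, IsBaseChange.equiv_tmul]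
    rfl
  simp only [ratCoord, LinearEquiv.trans_apply, LinearEquiv.restrictScalars_apply, h]
  rw [TensorProduct.equivFinsuppOfBasisLeft_apply_tmul_apply]

theorem sum_ratCoord (x : Coh ℂ A) :
    (A.ratCoord x).sum (fun j m => complexRatBasis j • A.cohComplexify m) = x := by
  obtain ⟨v, rfl⟩ := A.ratCoord.symm.surjective x
  rw [LinearEquiv.apply_symm_apply]
  induction v using Finsupp.induction_linear with
  | zero => simp
  | add v w hv hw =>
    rw [Finsupp.sum_add_index' (by simp) (by simp), hv, hw, map_add]
  | single j m =>
    rw [Finsupp.sum_single_index (by simp)]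
    apply A.ratCoord.injective
    ext1 i
    rw [ratCoord_smul_cohComplexify, LinearEquiv.apply_symm_apply, Module.Basis.repr_self]
    by_cases h : j = i
    · subst h; simp
    · simp [h]

/-- The `j`-th coordinate in `Hom(H⋆(A, ℚ), H⋆(X, ℚ))` of a `ℂ`-linear map
`H⋆(A, ℂ) → H⋆(X, ℂ)`. -/
def ratComponent (ψ : Coh ℂ A →ₗ[ℂ] Coh ℂ X) (j : Module.Basis.ofVectorSpaceIndex ℚ ℂ) :
    Coh ℚ A →ₗ[ℚ] Coh ℚ X :=
  Finsupp.lapply j ∘ₗ X.ratCoord.toLinearMap ∘ₗ ψ.restrictScalars ℚ ∘ₗ A.cohComplexify.toLinearMap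

theorem ratComponent_apply (ψ : Coh ℂ A →ₗ[ℂ] Coh ℂ X) (j) (m : Coh ℚ A) :
    ratComponent ψ j m = X.ratCoord (ψ (A.cohComplexify m)) j := rfl

/-- H⋆(A, ℚ) has a finite basis, and the image of each basis vector has finitely many nonzero
coordinates. The freedom to enlarge `s` lets a prescribed index enter the sum. -/
theorem exists_eq_sum_ratComponent (ψ : Coh ℂ A →ₗ[ℂ] Coh ℂ X) :
    ∃ s : Finset (Module.Basis.ofVectorSpaceIndex ℚ ℂ), ∀ t, s ⊆ t →
      ψ = ∑ j ∈ t, complexRatBasis j • complexifyMap (ratComponent ψ j) := by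
  classical
  let b := Module.finBasis ℚ (Coh ℚ A)
  refine ⟨Finset.univ.biUnion fun i => (X.ratCoord (ψ (A.cohComplexify (b i)))).support,
    fun t ht => coh_hom_ext fun m => ?_⟩
  rw [← b.sum_repr m]
  simp only [map_sum, map_smul]
  have hsmul : ∀ (f : Coh ℂ A →ₗ[ℂ] Coh ℂ X) (q : ℚ) (x : Coh ℂ A), f (q • x) = q • f x :=
    fun f q x => f.map_smul_of_tower q x
  refine Finset.sum_congr rfl fun i _ => ?_
  rw [hsmul, hsmul]
  congr 1
  conv_lhs => rw [← sum_ratCoord (ψ (A.cohComplexify (b i)))]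
  rw [Finsupp.sum_of_support_subset (s := t) _ ((Finset.subset_biUnion_of_mem
    (fun i => (X.ratCoord (ψ (A.cohComplexify (b i)))).support) (Finset.mem_univ i)).trans ht) _
    (by simp)]
  simp [ratComponent_apply]

theorem ratCoord_mem {W : Submodule ℚ (Coh ℚ A)} {x : Coh ℂ A} (hx : x ∈ complexSpan W) (j) :
    A.ratCoord x j ∈ W := by
  rw [← range_tensorToCoh] at hx
  obtain ⟨t, rfl⟩ := hx
  induction t with
  | zero => simp
  | add x y hx hy => rw [map_add, map_add]; exact add_mem hx hy
  | tmul c w =>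
    rw [tensorToCoh_tmul, ratCoord_smul_cohComplexify]
    exact W.smul_mem _ w.2

/-! ### Field automorphisms -/

/-- The isomorphism of algebras `ℂ ⊗ H⋆(A, ℚ) ≃ H⋆(A, ℂ)`. -/
def cohEquiv (A : ComplexAbelianVariety.{u}) : (ℂ ⊗[ℚ] Coh ℚ A) ≃ₐ[ℂ] Coh ℂ A :=
  AlgEquiv.ofBijective
    (Algebra.TensorProduct.lift (Algebra.ofId ℂ (Coh ℂ A)) A.cohComplexify
      fun _ _ => Algebra.commutes _ _) (by
    convert A.isBaseChange_cohComplexify.equiv.bijective using 1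
    ext t
    induction t with
    | zero => simp
    | add x y hx hy => rw [map_add, map_add, hx, hy]
    | tmul c w =>
      rw [IsBaseChange.equiv_tmul, Algebra.smul_def]
      exact Algebra.TensorProduct.lift_tmul _ _ _ _ _)

@[simp]
theorem cohEquiv_tmul (c : ℂ) (m : Coh ℚ A) :
    A.cohEquiv (c ⊗ₜ m) = c • A.cohComplexify m := by
  rw [Algebra.smul_def]
  exact Algebra.TensorProduct.lift_tmul (Algebra.ofId ℂ (Coh ℂ A)) A.cohComplexify
    (fun _ _ => Algebra.commutes _ _) c m

/-- The action of a field automorphism of `ℂ` on `H⋆(A, ℂ) = ℂ ⊗ H⋆(A, ℚ)`. -/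
def galCoh (A : ComplexAbelianVariety.{u}) (σ : ℂ ≃+* ℂ) : Coh ℂ A →+* Coh ℂ A :=
  (A.cohEquiv.toRingEquiv.toRingHom.comp
    (Algebra.TensorProduct.map (σ.toRingHom.toRatAlgHom) (AlgHom.id ℚ (Coh ℚ A))).toRingHom).comp
    A.cohEquiv.symm.toRingEquiv.toRingHom

@[simp]
theorem galCoh_smul_cohComplexify (σ : ℂ ≃+* ℂ) (c : ℂ) (m : Coh ℚ A) :
    A.galCoh σ (c • A.cohComplexify m) = σ c • A.cohComplexify m := by
  have h : A.cohEquiv.symm (c • A.cohComplexify m) = c ⊗ₜ m := by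
    rw [AlgEquiv.symm_apply_eq, cohEquiv_tmul]
  simp [galCoh, h]

theorem coh_induction {P : Coh ℂ A → Prop} (x : Coh ℂ A)
    (hs : ∀ (c : ℂ) m, P (c • A.cohComplexify m)) (ha : ∀ x y, P x → P y → P (x + y)) : P x := by
  obtain ⟨t, rfl⟩ := A.cohEquiv.surjective x
  induction t with
  | zero => simpa using hs 0 0
  | add x y hx hy => rw [map_add]; exact ha _ _ hx hy
  | tmul c m => rw [cohEquiv_tmul]; exact hs c m

@[simp]
theorem galCoh_cohComplexify (σ : ℂ ≃+* ℂ) (m : Coh ℚ A) :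
    A.galCoh σ (A.cohComplexify m) = A.cohComplexify m := by
  simpa using galCoh_smul_cohComplexify σ 1 m

theorem galCoh_smul (σ : ℂ ≃+* ℂ) (c : ℂ) (x : Coh ℂ A) :
    A.galCoh σ (c • x) = σ c • A.galCoh σ x := by
  induction x using coh_induction with
  | hs d m => simp [smul_smul]
  | ha x y hx hy => simp [hx, hy]

@[simp]
theorem galCoh_galCoh_symm (σ : ℂ ≃+* ℂ) (x : Coh ℂ A) :
    A.galCoh σ (A.galCoh σ.symm x) = x := by
  induction x using coh_induction with
  | hs d m => simp
  | ha x y hx hy => simp [hx, hy]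

theorem galCoh_complexifyMap (σ : ℂ ≃+* ℂ) (f : Coh ℚ A →ₗ[ℚ] Coh ℚ X) (x : Coh ℂ A) :
    X.galCoh σ (complexifyMap f x) = complexifyMap f (A.galCoh σ x) := by
  induction x using coh_induction with
  | hs d m => simp
  | ha x y hx hy => simp [hx, hy]

/-- The action of a field automorphism of `ℂ` on `H¹(A, ℂ)`. -/
def galH1 (A : ComplexAbelianVariety.{u}) (σ : ℂ ≃+* ℂ) : H1 ℂ A →+ H1 ℂ A where
  toFun φ := σ.toRingHom.toAddMonoidHom.toIntLinearMap.comp φ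
  map_zero' := by ext; simp
  map_add' _ _ := by ext; simp

@[simp]
theorem galH1_apply (σ : ℂ ≃+* ℂ) (φ : H1 ℂ A) (l : A.Λ) : A.galH1 σ φ l = σ (φ l) := rfl

theorem galH1_smul (σ : ℂ ≃+* ℂ) (c : ℂ) (φ : H1 ℂ A) :
    A.galH1 σ (c • φ) = σ c • A.galH1 σ φ := by
  ext; simp

@[simp]
theorem galH1_H1Complexify (σ : ℂ ≃+* ℂ) (φ : H1 ℚ A) :
    A.galH1 σ (A.H1Complexify φ) = A.H1Complexify φ := by
  ext; simp [H1Complexify_apply]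

theorem galCoh_ι (σ : ℂ ≃+* ℂ) (φ : H1 ℂ A) :
    A.galCoh σ (ExteriorAlgebra.ι ℂ φ) = ExteriorAlgebra.ι ℂ (A.galH1 σ φ) := by
  rw [H1_eq_sum ℂ φ]
  simp only [map_sum, map_smul, galCoh_smul, galH1_smul, ← H1Complexify_H1Basis,
    ← cohComplexify_ι, galCoh_cohComplexify, galH1_H1Complexify]

/-- The conjugate of an operator on `H¹(A, ℂ)` by a field automorphism of `ℂ`. -/
def galConj (σ : ℂ ≃+* ℂ) (g : A.GLH1) : A.GLH1 where
  toFun φ := A.galH1 σ (g (A.galH1 σ.symm φ))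
  invFun φ := A.galH1 σ (g.symm (A.galH1 σ.symm φ))
  map_add' _ _ := by simp
  map_smul' c φ := by simp [galH1_smul]
  left_inv φ := by
    have : ∀ φ, A.galH1 σ.symm (A.galH1 σ φ) = φ := fun φ => by ext; simp
    have h : ∀ φ, A.galH1 σ (A.galH1 σ.symm φ) = φ := fun φ => by ext; simp
    simp [this, h]
  right_inv φ := by
    have : ∀ φ, A.galH1 σ.symm (A.galH1 σ φ) = φ := fun φ => by ext; simp
    have h : ∀ φ, A.galH1 σ (A.galH1 σ.symm φ) = φ := fun φ => by ext; simp
    simp [this, h]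

theorem galConj_apply (σ : ℂ ≃+* ℂ) (g : A.GLH1) (φ : H1 ℂ A) :
    galConj σ g φ = A.galH1 σ (g (A.galH1 σ.symm φ)) := rfl

@[simp]
theorem act_ι (g : A.GLH1) (φ : H1 ℂ A) :
    A.act g (ExteriorAlgebra.ι ℂ φ) = ExteriorAlgebra.ι ℂ (g φ) := by
  simp [act]

/-- Both sides are σ-semilinear ring homomorphisms in `x`, so only degree 1 matters, where the
identity is the definition of `galConj`. -/
theorem act_galConj_galCoh (σ : ℂ ≃+* ℂ) (g : A.GLH1) (x : Coh ℂ A) :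
    A.act (galConj σ g) (A.galCoh σ x) = A.galCoh σ (A.act g x) := by
  induction x using ExteriorAlgebra.induction with
  | algebraMap r =>
    rw [AlgHom.commutes, Algebra.algebraMap_eq_smul_one, galCoh_smul, map_one, map_smul, map_one]
  | ι φ =>
    have h : A.galH1 σ.symm (A.galH1 σ φ) = φ := by ext; simp
    rw [act_ι, galCoh_ι, galCoh_ι, act_ι, galConj_apply, h]
  | mul a b ha hb => simp only [map_mul, ha, hb]
  | add a b ha hb => simp only [map_add, ha, hb]

end ComplexAbelianVariety

/-! ### Eigenvectors in stable subspaces and in algebras -/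

/-- The components of a vector of a stable subspace along distinct eigenspaces lie in the
subspace. -/
theorem Module.End.mem_of_sum_eigenspace_mem {K M ι : Type*} [Field K] [AddCommGroup M] [Module K M]
    {f : Module.End K M} {U : Submodule K M} (hU : ∀ x ∈ U, f x ∈ U) (s : Finset ι) {μ : ι → K}
    (hμ : Set.InjOn μ s) (x : ι → M) (hx : ∀ i ∈ s, f (x i) = μ i • x i)
    (hsum : ∑ i ∈ s, x i ∈ U) : ∀ i ∈ s, x i ∈ U := by
  classical
  induction s using Finset.induction_on generalizing x with
  | empty => simp
  | insert a s ha ih =>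
    have hs : ∀ i ∈ s, x i ∈ U := by
      intro i hi
      -- Applying f − μ_a removes the component at `a` and rescales the others by nonzero factors.
      have h1 : ∑ i ∈ s, (μ i - μ a) • x i ∈ U := by
        have h2 := sub_mem (hU _ hsum) (U.smul_mem (μ a) hsum)
        rw [map_sum, Finset.smul_sum, ← Finset.sum_sub_distrib, Finset.sum_insert ha,
          hx a (Finset.mem_insert_self a s), sub_self, zero_add] at h2
        convert h2 using 1
        refine Finset.sum_congr rfl fun j hj => ?_
        rw [hx j (Finset.mem_insert_of_mem hj), sub_smul]
      have h3 := ih (fun i hi j hj => hμ (by simp_all) (by simp_all))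
        (fun i => (μ i - μ a) • x i) (fun j hj => by
          rw [map_smul, hx j (Finset.mem_insert_of_mem hj), smul_comm]) h1 i hi
      have hne : μ i - μ a ≠ 0 := sub_ne_zero.2 fun h => ha (by
        rwa [← hμ (by simp [hi]) (by simp) h])
      exact (U.smul_mem_iff hne).1 h3
    intro i hi
    rcases Finset.mem_insert.1 hi with rfl | hi
    · rw [Finset.sum_insert ha] at hsum
      exact (Submodule.add_mem_iff_left U (sum_mem hs)).1 hsum
    · exact hs i hi

/-- Products of eigenvectors of an algebra endomorphism are eigenvectors. -/
theorem AlgHom.map_eq_smul_of_mem_pow_mul_pow {K R : Type*} [Field K] [Ring R] [Algebra K R]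
    {f : R →ₐ[K] R} {P Q : Submodule K R} {c d : K} (hP : ∀ x ∈ P, f x = c • x)
    (hQ : ∀ x ∈ Q, f x = d • x) (p q : ℕ) {x : R} (hx : x ∈ P ^ p * Q ^ q) :
    f x = (c ^ p * d ^ q) • x := by
  have key : ∀ {P Q : Submodule K R} {c d : K}, (∀ x ∈ P, f x = c • x) →
      (∀ x ∈ Q, f x = d • x) → ∀ x ∈ P * Q, f x = (c * d) • x := by
    intro P Q c d hP hQ x hx
    induction hx using Submodule.mul_induction_on' with
    | mem_mul_mem m hm n hn => rw [map_mul, hP m hm, hQ n hn, smul_mul_smul_comm]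
    | add x _ y _ hx hy => rw [map_add, hx, hy, smul_add]
  have hpow : ∀ {P : Submodule K R} {c : K}, (∀ x ∈ P, f x = c • x) →
      ∀ n : ℕ, ∀ x ∈ P ^ n, f x = c ^ n • x := by
    intro P c hP n
    induction n with
    | zero =>
      intro x hx
      rw [pow_zero] at hx
      obtain ⟨r, rfl⟩ := Submodule.mem_one.1 hx
      simp
    | succ n ih => rw [pow_succ, pow_succ]; exact key ih hP
  exact key (hpow hP p) (hpow hQ q) x hx

namespace ComplexAbelianVariety

variable {A B X Y : ComplexAbelianVariety.{u}}

/-! ### The operators of the Hodge structure -/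

/-- The `ℝ`-linear extension to `V` of a class in `H¹(A, ℂ) = Hom(Λ, ℂ)`. -/
def realExt (A : ComplexAbelianVariety.{u}) : H1 ℂ A →ₗ[ℂ] (A.V →ₗ[ℝ] ℂ) where
  toFun φ := (A.latticeBasis.ofZLatticeBasis ℝ A.Λ).constr ℝ fun i => φ (A.latticeBasis i)
  map_add' φ ψ := (A.latticeBasis.ofZLatticeBasis ℝ A.Λ).ext fun i => by
    simp only [LinearMap.add_apply, Module.Basis.constr_basis]
  map_smul' c φ := (A.latticeBasis.ofZLatticeBasis ℝ A.Λ).ext fun i => by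
    simp only [LinearMap.smul_apply, RingHom.id_apply, Module.Basis.constr_basis]

theorem realExt_latticeBasis (φ : H1 ℂ A) (i) :
    A.realExt φ (A.latticeBasis i) = φ (A.latticeBasis i) := by
  have := (A.latticeBasis.ofZLatticeBasis ℝ A.Λ).constr_basis ℝ (fun i => φ (A.latticeBasis i)) i
  rwa [Module.Basis.ofZLatticeBasis_apply] at this

@[simp]
theorem realExt_coe (φ : H1 ℂ A) (l : A.Λ) : A.realExt φ l = φ l := by
  have : ((A.realExt φ).toAddMonoidHom.toIntLinearMap.comp A.Λ.subtype) = φ :=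
    A.latticeBasis.ext fun i => realExt_latticeBasis φ i
  exact congrArg (fun f : H1 ℂ A => f l) this

theorem real_hom_ext {N : Type*} [AddCommGroup N] [Module ℝ N] {f g : A.V →ₗ[ℝ] N}
    (h : ∀ l : A.Λ, f l = g l) : f = g :=
  (A.latticeBasis.ofZLatticeBasis ℝ A.Λ).ext fun i => by
    rw [Module.Basis.ofZLatticeBasis_apply]
    exact h _

/-- The operator `φ ↦ φ ∘ z` on `H¹(A, ℂ) = Hom_ℝ(V, ℂ)`. -/
def scaleH1 (A : ComplexAbelianVariety.{u}) (z : ℂ) : H1 ℂ A →ₗ[ℂ] H1 ℂ A where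
  toFun φ :=
    { toFun := fun l => A.realExt φ (z • (l : A.V))
      map_add' := fun l m => by simp
      map_smul' := fun c l => by
        rw [Submodule.coe_smul, smul_comm, map_zsmul]; rfl }
  map_add' φ ψ := by ext l; simp
  map_smul' c φ := by ext l; simp

theorem scaleH1_apply (z : ℂ) (φ : H1 ℂ A) (l : A.Λ) :
    A.scaleH1 z φ l = A.realExt φ (z • (l : A.V)) := rfl

theorem realExt_scaleH1 (z : ℂ) (φ : H1 ℂ A) (v : A.V) :
    A.realExt (A.scaleH1 z φ) v = A.realExt φ (z • v) := by
  have : A.realExt (A.scaleH1 z φ) =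
      A.realExt φ ∘ₗ ((LinearMap.lsmul ℂ A.V z).restrictScalars ℝ) :=
    real_hom_ext fun l => by rw [realExt_coe]; rfl
  rw [this]; rfl

theorem scaleH1_scaleH1 (z w : ℂ) (φ : H1 ℂ A) :
    A.scaleH1 z (A.scaleH1 w φ) = A.scaleH1 (w * z) φ := by
  ext l
  rw [scaleH1_apply, realExt_scaleH1, smul_smul, scaleH1_apply]

@[simp]
theorem scaleH1_one (φ : H1 ℂ A) : A.scaleH1 1 φ = φ := by
  ext l
  rw [scaleH1_apply, one_smul, realExt_coe]

theorem scaleH1_of_mem_H10 (z : ℂ) {φ : H1 ℂ A} (hφ : φ ∈ A.H10) : A.scaleH1 z φ = z • φ := by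
  obtain ⟨ψ, rfl⟩ := hφ
  set φ : H1 ℂ A := (ψ.restrictScalars ℤ).comp A.Λ.subtype with hφ
  have h : A.realExt φ = ψ.restrictScalars ℝ := real_hom_ext fun l => by rw [realExt_coe]; rfl
  ext l
  change A.realExt φ _ = z • ψ l
  rw [h]
  simp

theorem scaleH1_of_mem_H01 (z : ℂ) {φ : H1 ℂ A} (hφ : φ ∈ A.H01) :
    A.scaleH1 z φ = conj z • φ := by
  obtain ⟨ψ, rfl⟩ := hφ
  set φ : H1 ℂ A := ψ.toAddMonoidHom.toIntLinearMap.comp A.Λ.subtype with hφ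
  let ψ' : A.V →ₗ[ℝ] ℂ :=
    { toFun := ψ
      map_add' := map_add ψ
      map_smul' := fun r v => by
        rw [← Complex.coe_smul, map_smulₛₗ, Complex.conj_ofReal]; rfl }
  have h : A.realExt φ = ψ' := real_hom_ext fun l => by rw [realExt_coe]; rfl
  ext l
  change A.realExt φ _ = conj z • ψ l
  rw [h]
  exact map_smulₛₗ ψ z _

/-- The projection of `H¹(A, ℂ)` to `H^{1,0}` along `H^{0,1}`. -/
def projH10 (A : ComplexAbelianVariety.{u}) : H1 ℂ A →ₗ[ℂ] H1 ℂ A :=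
  (2⁻¹ : ℂ) • (LinearMap.id - Complex.I • A.scaleH1 Complex.I)

theorem projH10_apply (φ : H1 ℂ A) :
    A.projH10 φ = (2⁻¹ : ℂ) • (φ - Complex.I • A.scaleH1 Complex.I φ) := rfl

/-- With φ extended ℝ-linearly to V, the form v ↦ (φ(v) − iφ(iv))/2 is ℂ-linear. -/
theorem projH10_mem (φ : H1 ℂ A) : A.projH10 φ ∈ A.H10 := by
  have hz : ∀ (z : ℂ) (v : A.V), A.realExt φ (z • v) =
      z.re • A.realExt φ v + z.im • A.realExt φ (Complex.I • v) := fun z v => by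
    conv_lhs => rw [← Complex.re_add_im z]
    rw [add_smul, mul_smul, map_add, Complex.coe_smul, Complex.coe_smul, map_smul, map_smul]
  refine ⟨{ toFun := fun v => (2⁻¹ : ℂ) * (A.realExt φ v - Complex.I *
              A.realExt φ (Complex.I • v))
            map_add' := fun v w => by simp only [smul_add, map_add]; ring
            map_smul' := fun z v => ?_ }, ?_⟩
  · rw [smul_smul, hz, hz (Complex.I * z)]
    simp only [Complex.real_smul, RingHom.id_apply, smul_eq_mul, Complex.mul_re, Complex.mul_im,
      Complex.I_re, Complex.I_im]
    conv_rhs => rw [← Complex.re_add_im z]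
    push_cast
    linear_combination (2⁻¹ * (z.im : ℂ) * A.realExt φ (Complex.I • v)) * Complex.I_sq
  · ext l
    change (2⁻¹ : ℂ) * (A.realExt φ l - Complex.I * A.realExt φ (Complex.I • (l : A.V))) = _
    simp [projH10_apply, scaleH1_apply]

/-- The complementary form v ↦ (φ(v) + iφ(iv))/2 is conjugate-linear. -/
theorem sub_projH10_mem (φ : H1 ℂ A) : φ - A.projH10 φ ∈ A.H01 := by
  have hz : ∀ (z : ℂ) (v : A.V), A.realExt φ (z • v) =
      z.re • A.realExt φ v + z.im • A.realExt φ (Complex.I • v) := fun z v => by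
    conv_lhs => rw [← Complex.re_add_im z]
    rw [add_smul, mul_smul, map_add, Complex.coe_smul, Complex.coe_smul, map_smul, map_smul]
  refine ⟨{ toFun := fun v => (2⁻¹ : ℂ) * (A.realExt φ v + Complex.I *
              A.realExt φ (Complex.I • v))
            map_add' := fun v w => by simp only [smul_add, map_add]; ring
            map_smul' := fun z v => ?_ }, ?_⟩
  · rw [smul_smul, hz, hz (Complex.I * z)]
    have hc : conj z = (z.re : ℂ) - z.im * Complex.I := by
      apply Complex.ext <;> simp
    rw [hc]
    simp only [Complex.real_smul, smul_eq_mul, Complex.mul_re, Complex.mul_im,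
      Complex.I_re, Complex.I_im]
    push_cast
    linear_combination (2⁻¹ * (z.im : ℂ) * A.realExt φ (Complex.I • v)) * Complex.I_sq
  · ext l
    change (2⁻¹ : ℂ) * (A.realExt φ l + Complex.I * A.realExt φ (Complex.I • (l : A.V))) = _
    simp only [projH10_apply, scaleH1_apply, LinearMap.sub_apply, LinearMap.smul_apply,
      smul_eq_mul, realExt_coe]
    ring

theorem H10_sup_H01 (A : ComplexAbelianVariety.{u}) : A.H10 ⊔ A.H01 = ⊤ :=
  eq_top_iff.2 fun φ _ => by
    rw [← add_sub_cancel (A.projH10 φ) φ]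
    exact Submodule.add_mem_sup (projH10_mem φ) (sub_projH10_mem φ)

theorem projH10_of_mem_H10 {φ : H1 ℂ A} (hφ : φ ∈ A.H10) : A.projH10 φ = φ := by
  rw [projH10_apply, scaleH1_of_mem_H10 _ hφ, smul_smul, Complex.I_mul_I, neg_one_smul,
    sub_neg_eq_add, ← two_smul ℂ φ, smul_smul]
  norm_num

theorem projH10_of_mem_H01 {φ : H1 ℂ A} (hφ : φ ∈ A.H01) : A.projH10 φ = 0 := by
  rw [projH10_apply, scaleH1_of_mem_H01 _ hφ, smul_smul, Complex.conj_I, mul_neg, Complex.I_mul_I,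
    neg_neg, one_smul, sub_self, smul_zero]

/-- The operator on `H¹(A, ℂ)` by which `z` acts through the Hodge structure. -/
def hodgeOp (A : ComplexAbelianVariety.{u}) (z : Circle) : A.GLH1 :=
  LinearEquiv.ofLinearMap (A.scaleH1 z) (A.scaleH1 (z⁻¹ : Circle))
    (by ext1 φ; simp [scaleH1_scaleH1, ← Circle.coe_mul, -Circle.coe_inv])
    (by ext1 φ; simp [scaleH1_scaleH1, ← Circle.coe_mul, -Circle.coe_inv])

@[simp]
theorem hodgeOp_apply (z : Circle) (φ : H1 ℂ A) : A.hodgeOp z φ = A.scaleH1 z φ := rfl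

theorem isHodgeOperator_hodgeOp (z : Circle) : A.IsHodgeOperator z (A.hodgeOp z) :=
  ⟨fun _ h => scaleH1_of_mem_H10 _ h, fun _ h => scaleH1_of_mem_H01 _ h⟩

theorem IsHodgeOperator.eq_hodgeOp {z : Circle} {g : A.GLH1} (h : A.IsHodgeOperator z g) :
    g = A.hodgeOp z := by
  ext1 φ
  obtain ⟨a, ha, b, hb, rfl⟩ := Submodule.mem_sup.1 (A.H10_sup_H01 ▸ Submodule.mem_top (x := φ))
  have h' := isHodgeOperator_hodgeOp (A := A) z
  rw [map_add, map_add, h.1 a ha, h.2 b hb, h'.1 a ha, h'.2 b hb]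

/-! ### Hodge types -/

theorem Hpq_natCast (p q : ℕ) : A.Hpq p q =
    (A.H10.map (ExteriorAlgebra.ι ℂ)) ^ p * (A.H01.map (ExteriorAlgebra.ι ℂ)) ^ q := by
  simp [Hpq]

theorem Hpq_eq_bot {p q : ℤ} (h : p < 0 ∨ q < 0) : A.Hpq p q = ⊥ := by
  rw [Hpq, if_neg (by omega)]

theorem map_ι_le_exteriorPower_one (P : Submodule ℂ (H1 ℂ A)) :
    P.map (ExteriorAlgebra.ι ℂ) ≤ LinearMap.range (ExteriorAlgebra.ι ℂ : H1 ℂ A →ₗ[ℂ] Coh ℂ A) :=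
  LinearMap.map_le_range

theorem Hpq_natCast_le (p q : ℕ) : A.Hpq p q ≤ ⋀[ℂ]^(p + q) (H1 ℂ A) := by
  rw [Hpq_natCast, ExteriorAlgebra.exteriorPower, pow_add]
  exact mul_le_mul' (pow_le_pow_left' (map_ι_le_exteriorPower_one _) p)
    (pow_le_pow_left' (map_ι_le_exteriorPower_one _) q)

/-- Classes of degree 1 anticommute, so a factor from H^{0,1} can be moved to the right of those
from H^{1,0}, the order used in `Hpq`. -/
theorem map_H01_mul_map_H10_pow_le (p : ℕ) :
    A.H01.map (ExteriorAlgebra.ι ℂ) * A.H10.map (ExteriorAlgebra.ι ℂ) ^ p ≤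
      A.H10.map (ExteriorAlgebra.ι ℂ) ^ p * A.H01.map (ExteriorAlgebra.ι ℂ) := by
  have h1 : A.H01.map (ExteriorAlgebra.ι ℂ) * A.H10.map (ExteriorAlgebra.ι ℂ) ≤
      A.H10.map (ExteriorAlgebra.ι ℂ) * A.H01.map (ExteriorAlgebra.ι ℂ) := by
    rw [Submodule.mul_le]
    rintro _ ⟨a, ha, rfl⟩ _ ⟨b, hb, rfl⟩
    have : ExteriorAlgebra.ι ℂ a * ExteriorAlgebra.ι ℂ b =
        -(ExteriorAlgebra.ι ℂ b * ExteriorAlgebra.ι ℂ a) :=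
      eq_neg_of_add_eq_zero_left (ExteriorAlgebra.ι_add_mul_swap a b)
    rw [this]
    exact neg_mem (Submodule.mul_mem_mul ⟨b, hb, rfl⟩ ⟨a, ha, rfl⟩)
  induction p with
  | zero => simp
  | succ p ih =>
    rw [pow_succ, ← mul_assoc]
    refine (mul_le_mul' ih le_rfl).trans ?_
    rw [mul_assoc, mul_assoc]
    exact mul_le_mul' (le_refl (A.H10.map (ExteriorAlgebra.ι ℂ) ^ p)) h1

/-- Expand the n-th power of H^{1,0} + H^{0,1}. In the induction a new left factor from H^{1,0}
raises p, and one from H^{0,1} raises q after being moved past the others. -/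
theorem exists_sum_Hpq {n : ℕ} {x : Coh ℂ A} (hx : x ∈ ⋀[ℂ]^n (H1 ℂ A)) :
    ∃ y : ℕ → Coh ℂ A, (∀ p ∈ Finset.range (n + 1), y p ∈ A.Hpq p (n - p : ℕ)) ∧
      x = ∑ p ∈ Finset.range (n + 1), y p := by
  have h : ⋀[ℂ]^n (H1 ℂ A) ≤ ⨆ p ∈ Finset.range (n + 1), A.Hpq p (n - p : ℕ) := by
    simp_rw [Hpq_natCast, ExteriorAlgebra.exteriorPower, LinearMap.range_eq_map, ← A.H10_sup_H01,
      Submodule.map_sup]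
    set P := A.H10.map (ExteriorAlgebra.ι ℂ) with hP
    set Q := A.H01.map (ExteriorAlgebra.ι ℂ) with hQ
    clear hx
    induction n with
    | zero => simp
    | succ n ih =>
      rw [pow_succ']
      refine (mul_le_mul' le_rfl ih).trans ?_
      rw [Submodule.mul_iSup]
      refine iSup_le fun p => ?_
      rw [Submodule.mul_iSup]
      refine iSup_le fun hp => ?_
      rw [Finset.mem_range] at hp
      rw [Submodule.sup_mul]
      refine sup_le ?_ ?_
      · refine le_iSup₂_of_le (p + 1) (Finset.mem_range.2 (by omega)) ?_
        rw [← mul_assoc, ← pow_succ', show n + 1 - (p + 1) = n - p by omega]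
      · refine le_iSup₂_of_le p (Finset.mem_range.2 (by omega)) ?_
        rw [← mul_assoc, show n + 1 - p = (n - p) + 1 by omega, pow_succ', ← mul_assoc]
        exact mul_le_mul' (map_H01_mul_map_H10_pow_le p) le_rfl
  obtain ⟨μ, hμ⟩ := (Submodule.mem_iSup_finset_iff_exists_sum _ _).1 (h hx)
  exact ⟨fun p => μ p, fun p _ => (μ p).2, hμ.symm⟩

/-- A unit complex number of infinite order. -/
def genericCircle : Circle := Circle.exp 1

/-- An equality e^{ik} = e^{il} with k ≠ l would make π rational. -/
theorem genericCircle_zpow_injective :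
    Function.Injective fun k : ℤ => (genericCircle : ℂ) ^ k := by
  intro k l h
  have h1 : ∀ k : ℤ, (genericCircle : ℂ) ^ k = Complex.exp (k * Complex.I) := fun k => by
    rw [genericCircle, Circle.coe_exp, Complex.ofReal_one, one_mul, Complex.exp_int_mul]
  simp only [h1] at h
  obtain ⟨n, hn⟩ := Complex.exp_eq_exp_iff_exists_int.1 h
  have h2 : (k : ℂ) = l + n * (2 * Real.pi) := by
    apply mul_right_cancel₀ Complex.I_ne_zero
    linear_combination hn
  have h3 : (k : ℝ) = l + n * (2 * Real.pi) := by exact_mod_cast h2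
  by_cases hn0 : n = 0
  · subst hn0
    simpa using h3
  · exfalso
    refine irrational_pi ⟨(k - l) / (2 * n), ?_⟩
    have : (n : ℝ) ≠ 0 := by exact_mod_cast hn0
    push_cast
    rw [h3]
    field_simp
    ring

/-- The action on cohomology of a unit complex number of infinite order. -/
def hodgeEnd (A : ComplexAbelianVariety.{u}) : Coh ℂ A →ₐ[ℂ] Coh ℂ A :=
  A.act (A.hodgeOp genericCircle)

/-- On the unit circle conj z = z⁻¹, so each factor from H^{0,1} contributes z⁻¹. The exponent p − q
is insensitive to Tate twists. -/
theorem act_of_mem_Hpq {p q : ℤ} (z : Circle) {x : Coh ℂ A} (hx : x ∈ A.Hpq p q) :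
    A.act (A.hodgeOp z) x = (z : ℂ) ^ (p - q) • x := by
  by_cases h : p < 0 ∨ q < 0
  · rw [Hpq_eq_bot h, Submodule.mem_bot] at hx
    simp [hx]
  obtain ⟨a, rfl⟩ := Int.eq_ofNat_of_zero_le (not_lt.1 fun h' => h (Or.inl h'))
  obtain ⟨b, rfl⟩ := Int.eq_ofNat_of_zero_le (not_lt.1 fun h' => h (Or.inr h'))
  rw [Hpq_natCast] at hx
  rw [AlgHom.map_eq_smul_of_mem_pow_mul_pow (c := (z : ℂ)) (d := (z : ℂ)⁻¹) ?_ ?_ a b hx,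
    zpow_sub₀ z.coe_ne_zero, zpow_natCast, zpow_natCast, inv_pow, div_eq_mul_inv]
  · rintro _ ⟨φ, hφ, rfl⟩
    rw [act_ι, (isHodgeOperator_hodgeOp z).1 φ hφ, map_smul]
  · rintro _ ⟨φ, hφ, rfl⟩
    rw [act_ι, (isHodgeOperator_hodgeOp z).2 φ hφ, map_smul, ← Circle.coe_inv,
      Circle.coe_inv_eq_conj]

/-- The Hodge components of a vector of a subspace stable under `hodgeEnd` lie in the subspace. -/
theorem mem_of_sum_Hpq_mem {U : Submodule ℂ (Coh ℂ A)} (hU : ∀ x ∈ U, A.hodgeEnd x ∈ U) {n : ℕ}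
    {y : ℕ → Coh ℂ A} (hy : ∀ p ∈ Finset.range (n + 1), y p ∈ A.Hpq p (n - p : ℕ))
    (hsum : ∑ p ∈ Finset.range (n + 1), y p ∈ U) : ∀ p ∈ Finset.range (n + 1), y p ∈ U := by
  refine Module.End.mem_of_sum_eigenspace_mem (f := A.hodgeEnd.toLinearMap) hU _
    (μ := fun p : ℕ => (genericCircle : ℂ) ^ ((p : ℤ) - (n - p : ℕ))) ?_ y
    (fun p hp => act_of_mem_Hpq _ (hy p hp)) hsum
  intro p hp q hq h
  -- In degree n the exponent is 2p − n, so distinct p have distinct eigenvalues.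
  have h1 := genericCircle_zpow_injective h
  simp only [Finset.coe_range, Set.mem_Iio] at hp hq
  omega

/-- An eigenvector of `hodgeEnd` in `Hⁿ` has a single Hodge type. -/
theorem exists_mem_Hpq_of_hodgeEnd {n : ℕ} {d : ℤ} {x : Coh ℂ A}
    (hx : x ∈ ⋀[ℂ]^n (H1 ℂ A)) (h : A.hodgeEnd x = (genericCircle : ℂ) ^ d • x) (hne : x ≠ 0) :
    ∃ p q : ℤ, p + q = n ∧ p - q = d ∧ x ∈ A.Hpq p q := by
  obtain ⟨y, hy, rfl⟩ := exists_sum_Hpq hx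
  have hmem := mem_of_sum_Hpq_mem
    (U := Module.End.eigenspace A.hodgeEnd.toLinearMap ((genericCircle : ℂ) ^ d))
    (fun x hx => by
      rw [Module.End.mem_eigenspace_iff] at hx ⊢
      have hx' : A.hodgeEnd x = (genericCircle : ℂ) ^ d • x := hx
      rw [AlgHom.toLinearMap_apply, hx', map_smul, hx']) hy (Module.End.mem_eigenspace_iff.2 h)
  have hz : ∀ p ∈ Finset.range (n + 1), (p : ℤ) - (n - p : ℕ) ≠ d → y p = 0 := by
    intro p hp hpd
    have h1 := Module.End.mem_eigenspace_iff.1 (hmem p hp)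
    have h2 : A.hodgeEnd (y p) = _ := act_of_mem_Hpq genericCircle (hy p hp)
    rw [AlgHom.toLinearMap_apply, h2, ← sub_eq_zero, ← sub_smul, smul_eq_zero, sub_eq_zero] at h1
    exact h1.resolve_left fun h => hpd (genericCircle_zpow_injective h)
  obtain ⟨p, hp, hpy⟩ := Finset.exists_ne_zero_of_sum_ne_zero hne
  have hpd : (p : ℤ) - (n - p : ℕ) = d := by
    by_contra h
    exact hpy (hz p hp h)
  have hpn := Finset.mem_range.1 hp
  refine ⟨p, (n - p : ℕ), by omega, hpd, ?_⟩
  rw [Finset.sum_eq_single_of_mem p hp fun q hq hqp => hz q hq fun h' => hqp ?_]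
  · exact hy p hp
  · have hqn := Finset.mem_range.1 hq
    omega

/-- In a fixed degree p + q = n, the difference p − q determines the type. -/
theorem mem_Hpq_of_hodgeEnd {n : ℕ} {p q : ℤ} (hpq : p + q = n) {x : Coh ℂ A}
    (hx : x ∈ ⋀[ℂ]^n (H1 ℂ A)) (h : A.hodgeEnd x = (genericCircle : ℂ) ^ (p - q) • x) :
    x ∈ A.Hpq p q := by
  by_cases hne : x = 0
  · rw [hne]; exact zero_mem _
  obtain ⟨p', q', h1, h2, h3⟩ := exists_mem_Hpq_of_hodgeEnd hx h hne
  rwa [show p = p' by omega, show q = q' by omega]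

theorem eq_zero_of_hodgeEnd {n : ℕ} {d : ℤ} (hd : ∀ p q : ℤ, p + q = n → p - q ≠ d) {x : Coh ℂ A}
    (hx : x ∈ ⋀[ℂ]^n (H1 ℂ A)) (h : A.hodgeEnd x = (genericCircle : ℂ) ^ d • x) : x = 0 := by
  by_contra hne
  obtain ⟨p, q, h1, h2, -⟩ := exists_mem_Hpq_of_hodgeEnd hx h hne
  exact hd p q h1 h2

theorem eq_zero_of_mem_Hpq {n : ℕ} {p q : ℤ} (hpq : p + q ≠ n) {x : Coh ℂ A}
    (hx : x ∈ ⋀[ℂ]^n (H1 ℂ A)) (h : x ∈ A.Hpq p q) : x = 0 := by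
  by_cases hneg : p < 0 ∨ q < 0
  · rwa [Hpq_eq_bot hneg, Submodule.mem_bot] at h
  obtain ⟨a, rfl⟩ := Int.eq_ofNat_of_zero_le (not_lt.1 fun h' => hneg (Or.inl h'))
  obtain ⟨b, rfl⟩ := Int.eq_ofNat_of_zero_le (not_lt.1 fun h' => hneg (Or.inr h'))
  by_contra hne
  have := DirectSum.degree_eq_of_mem_mem (fun i => ⋀[ℂ]^i (H1 ℂ A)) hx (Hpq_natCast_le a b h) hne
  omega

theorem complexSpan_exteriorPower (n : ℕ) :
    complexSpan (⋀[ℚ]^n (H1 ℚ A)) = ⋀[ℂ]^n (H1 ℂ A) := by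
  apply le_antisymm
  · rw [← ExteriorAlgebra.ιMulti_span_fixedDegree ℚ, complexSpan_le]
    intro m hm
    induction hm using Submodule.span_induction with
    | mem x hx =>
      obtain ⟨v, rfl⟩ := hx
      rw [cohComplexify_ιMulti]
      exact ExteriorAlgebra.ιMulti_range ℂ n ⟨_, rfl⟩
    | zero => rw [map_zero]; exact zero_mem _
    | add x y _ _ hx hy => rw [map_add]; exact add_mem hx hy
    | smul q x _ hx =>
      rw [map_smul, ← algebraMap_smul ℂ]
      exact Submodule.smul_mem _ _ hx
  · rw [← exteriorPower.ιMulti_span_fixedDegree_of_span_eq_top ℂ n (H1 ℂ A)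
      (A.H1Basis ℂ).span_eq, Submodule.span_le]
    rintro _ ⟨v, hv, rfl⟩
    choose f hf using fun i => hv ⟨i, rfl⟩
    have hv' : v = A.H1Complexify ∘ fun i => A.H1Basis ℚ (f i) := by
      ext1 i
      rw [← hf i]
      exact (H1Complexify_H1Basis _).symm
    rw [hv', ← cohComplexify_ιMulti]
    exact cohComplexify_mem_complexSpan (ExteriorAlgebra.ιMulti_range ℚ n ⟨_, rfl⟩)

theorem mem_hodgeComponent {W : Submodule ℚ (Coh ℚ A)} {p q : ℤ} {t : ℂ ⊗[ℚ] W} :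
    t ∈ A.hodgeComponent W p q ↔ tensorToCoh W t ∈ A.Hpq p q := Iff.rfl

theorem IsHodgeSubstructure.act_mem {n : ℕ} {W : Submodule ℚ (Coh ℚ A)}
    (h : A.IsHodgeSubstructure n W) (z : Circle) {x : Coh ℂ A} (hx : x ∈ complexSpan W) :
    A.act (A.hodgeOp z) x ∈ complexSpan W := by
  rw [← range_tensorToCoh] at hx
  obtain ⟨t, rfl⟩ := hx
  have ht : t ∈ ⨆ p : ℤ, A.hodgeComponent W p (n - p) := h.2 ▸ Submodule.mem_top
  induction ht using Submodule.iSup_induction' with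
  | mem p t ht =>
    rw [act_of_mem_Hpq z (mem_hodgeComponent.1 ht), ← map_smul, ← range_tensorToCoh]
    exact LinearMap.mem_range_self _ _
  | zero => simp
  | add s t _ _ hs ht => rw [map_add, map_add]; exact add_mem hs ht

/-- In degree n the Hodge components are eigenspaces of `hodgeEnd` with distinct eigenvalues, so
stability under this single operator forces `W` to split. -/
theorem isHodgeSubstructure_of_hodgeEnd {n : ℕ} {W : Submodule ℚ (Coh ℚ A)}
    (hn : W ≤ ⋀[ℚ]^n (H1 ℚ A)) (h : ∀ x ∈ complexSpan W, A.hodgeEnd x ∈ complexSpan W) :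
    A.IsHodgeSubstructure n W := by
  refine ⟨hn, eq_top_iff.2 fun t _ => ?_⟩
  have hx : tensorToCoh W t ∈ complexSpan W := range_tensorToCoh W ▸ LinearMap.mem_range_self _ t
  obtain ⟨y, hy, hsum⟩ := exists_sum_Hpq
    (complexSpan_exteriorPower (A := A) n ▸ complexSpan_mono hn hx)
  have hmem := mem_of_sum_Hpq_mem h hy (hsum ▸ hx)
  rw [← range_tensorToCoh] at hmem
  choose! s hs using hmem
  have ht : t = ∑ p ∈ Finset.range (n + 1), s p := by
    apply tensorToCoh_injective W
    rw [hsum, map_sum]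
    exact Finset.sum_congr rfl fun p hp => (hs p hp).symm
  rw [ht]
  refine sum_mem fun p hp => Submodule.mem_iSup_of_mem (p : ℤ) ?_
  rw [mem_hodgeComponent, hs p hp,
    show (n : ℤ) - p = (n - p : ℕ) by have := Finset.mem_range.1 hp; omega]
  exact hy p hp

/-- The projection of the cohomology to the classes of type `(p, 0)`. -/
def projHp0 (A : ComplexAbelianVariety.{u}) : Coh ℂ A →ₐ[ℂ] Coh ℂ A :=
  ExteriorAlgebra.map A.projH10

theorem projHp0_eq_smul_of_mem {p q : ℕ} {x : Coh ℂ A} (hx : x ∈ A.Hpq p q) :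
    A.projHp0 x = ((1 : ℂ) ^ p * 0 ^ q) • x := by
  rw [Hpq_natCast] at hx
  refine AlgHom.map_eq_smul_of_mem_pow_mul_pow ?_ ?_ p q hx
  · rintro _ ⟨φ, hφ, rfl⟩
    rw [projHp0, ExteriorAlgebra.map_apply_ι, projH10_of_mem_H10 hφ, one_smul]
  · rintro _ ⟨φ, hφ, rfl⟩
    rw [projHp0, ExteriorAlgebra.map_apply_ι, projH10_of_mem_H01 hφ, map_zero, zero_smul]

theorem projHp0_of_mem {n : ℕ} {x : Coh ℂ A} (hx : x ∈ A.Hpq n 0) : A.projHp0 x = x := by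
  simpa using projHp0_eq_smul_of_mem (q := 0) (by simpa using hx)

/-- A Hodge structure in `Hⁿ` has a nonzero `(n, 0)`-part as soon as its projection to the classes
of type `(p, 0)` is not zero. -/
theorem IsHodgeSubstructure.hodgeComponent_ne_bot {n : ℕ} {W : Submodule ℚ (Coh ℚ A)}
    (h : A.IsHodgeSubstructure n W) {x : Coh ℂ A} (hx : x ∈ complexSpan W)
    (hne : A.projHp0 x ≠ 0) : A.hodgeComponent W n 0 ≠ ⊥ := by
  intro hbot
  refine hne ?_
  clear hne
  rw [← range_tensorToCoh] at hx
  obtain ⟨t, rfl⟩ := hx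
  have ht : t ∈ ⨆ p : ℤ, A.hodgeComponent W p (n - p) := h.2 ▸ Submodule.mem_top
  induction ht using Submodule.iSup_induction' with
  | mem p t ht =>
    by_cases hpq : p < 0 ∨ (n : ℤ) - p < 0
    · rw [mem_hodgeComponent, Hpq_eq_bot hpq, Submodule.mem_bot] at ht
      rw [ht, map_zero]
    by_cases hp : p = n
    · subst hp
      rw [sub_self, hbot, Submodule.mem_bot] at ht
      rw [ht, map_zero, map_zero]
    obtain ⟨a, rfl⟩ := Int.eq_ofNat_of_zero_le (not_lt.1 fun h' => hpq (Or.inl h'))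
    obtain ⟨b, hb⟩ := Int.eq_ofNat_of_zero_le (not_lt.1 fun h' => hpq (Or.inr h'))
    rw [hb, mem_hodgeComponent] at ht
    rw [projHp0_eq_smul_of_mem ht, zero_pow (by omega), mul_zero, zero_smul]
  | zero => simp
  | add s t _ _ hs ht =>
    rw [map_add, map_add, hs, ht, add_zero]

theorem IsHodgeSubstructure.isFullyTwisted {n : ℕ} {W : Submodule ℚ (Coh ℚ A)}
    (h : A.IsHodgeSubstructure n W) {x : Coh ℂ A} (hx : x ∈ complexSpan W)
    (hne : A.projHp0 x ≠ 0) : A.IsFullyTwisted n W := by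
  refine ⟨h, fun p q hpq => ?_, h.hodgeComponent_ne_bot hx hne⟩
  rw [eq_bot_iff]
  intro t ht
  rw [mem_hodgeComponent, Hpq_eq_bot hpq, Submodule.mem_bot] at ht
  exact tensorToCoh_injective W (by rw [ht, map_zero])

theorem IsFullyTwisted.exists_projHp0_ne_zero {n : ℕ} {W : Submodule ℚ (Coh ℚ A)}
    (h : A.IsFullyTwisted n W) : ∃ x ∈ complexSpan W, A.projHp0 x ≠ 0 := by
  obtain ⟨t, ht, hne⟩ := Submodule.exists_mem_ne_zero_of_ne_bot h.2.2
  rw [mem_hodgeComponent] at ht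
  refine ⟨tensorToCoh W t, range_tensorToCoh W ▸ LinearMap.mem_range_self _ t, ?_⟩
  rw [projHp0_of_mem ht]
  exact (map_ne_zero_iff _ (tensorToCoh_injective W)).2 hne

/-! ### The Hodge group as an algebraic group over `ℚ` -/

theorem act_mul (g h : A.GLH1) (x : Coh ℂ A) : A.act (g * h) x = A.act g (A.act h x) := by
  have : A.act (g * h) = (A.act g).comp (A.act h) := by
    rw [act, act, act, ExteriorAlgebra.map_comp_map]
    rfl
  rw [this]; rfl

@[simp]
theorem act_one (x : Coh ℂ A) : A.act 1 x = x := by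
  have : A.act 1 = AlgHom.id ℂ _ := ExteriorAlgebra.map_id
  rw [this]; rfl

theorem act_injective (g : A.GLH1) : Function.Injective (A.act g) := fun x y h => by
  rw [← act_one x, ← act_one y, ← inv_mul_cancel g, act_mul, act_mul, h]

/-- Evaluation at `g` of polynomials in the matrix entries. -/
def evalGL (g : A.GLH1) : MvPolynomial (H1 ℚ A × A.Λ) ℚ →ₐ[ℚ] ℂ :=
  MvPolynomial.aeval fun x => g (A.H1Complexify x.1) x.2

theorem evalGL_X (g : A.GLH1) (φ : H1 ℚ A) (l : A.Λ) :
    evalGL g (MvPolynomial.X (φ, l)) = g (A.H1Complexify φ) l := by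
  simp [evalGL]

theorem evalGL_galConj (σ : ℂ ≃+* ℂ) (g : A.GLH1) (P : MvPolynomial (H1 ℚ A × A.Λ) ℚ) :
    evalGL (galConj σ g) P = σ (evalGL g P) := by
  have : evalGL (galConj σ g) = (σ.toRingHom.toRatAlgHom).comp (evalGL g) := by
    ext ⟨φ, l⟩
    rw [AlgHom.comp_apply, evalGL_X, evalGL_X, galConj_apply, galH1_H1Complexify]
    rfl
  rw [this]; rfl

/-- An intersection of algebraic subgroups is cut out by all rational polynomials vanishing on it,
since these include the equations of every member. -/
theorem isAlgebraicOverRat_hodgeGroup (A : ComplexAbelianVariety.{u}) :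
    A.IsAlgebraicOverRat A.hodgeGroup := by
  refine ⟨{P | ∀ g ∈ A.hodgeGroup, evalGL g P = 0}, fun g => ⟨fun hg P hP => hP g hg, fun h => ?_⟩⟩
  rw [hodgeGroup, Subgroup.mem_sInf]
  intro Γ hΓ
  obtain ⟨S, hS⟩ := hΓ.1
  rw [hS]
  intro P hP
  exact h P fun g' hg' => (hS g').1 (Subgroup.mem_sInf.1 hg' Γ hΓ) P hP

theorem hodgeOp_mem_hodgeGroup (z : Circle) : A.hodgeOp z ∈ A.hodgeGroup :=
  Subgroup.mem_sInf.2 fun _ hΓ => hΓ.2 z _ z.norm_coe (isHodgeOperator_hodgeOp z)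

theorem hodgeGroup_le {Γ : Subgroup A.GLH1} (h : A.IsAlgebraicOverRat Γ)
    (hop : ∀ z : Circle, A.hodgeOp z ∈ Γ) : A.hodgeGroup ≤ Γ :=
  sInf_le ⟨h, fun z g hz hg => by
    have := IsHodgeOperator.eq_hodgeOp (z := ⟨z, mem_sphere_zero_iff_norm.2 hz⟩) hg
    exact this ▸ hop _⟩

/-- The equations have rational coefficients, and conjugating `g` applies σ to its entries against
rational classes. -/
theorem galConj_mem_hodgeGroup (σ : ℂ ≃+* ℂ) {g : A.GLH1} (hg : g ∈ A.hodgeGroup) :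
    galConj σ g ∈ A.hodgeGroup := by
  obtain ⟨S, hS⟩ := A.isAlgebraicOverRat_hodgeGroup
  rw [hS] at hg ⊢
  intro P hP
  change evalGL _ P = 0
  rw [evalGL_galConj, show evalGL g P = 0 from hg P hP, map_zero]

/-! ### Rational Hodge structures are stable under the Hodge group -/

/-- Evaluation at `g` of the coefficients of a polynomial with values in the cohomology. -/
def evalCoh (g : A.GLH1) : MvPolynomial (H1 ℚ A × A.Λ) ℚ ⊗[ℚ] Coh ℚ A →ₐ[ℚ] Coh ℂ A :=
  Algebra.TensorProduct.lift (((Algebra.ofId ℂ (Coh ℂ A)).restrictScalars ℚ).comp (evalGL g))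
    A.cohComplexify fun P m => Algebra.commutes (evalGL g P) (A.cohComplexify m)

theorem evalCoh_tmul (g : A.GLH1) (P) (m : Coh ℚ A) :
    evalCoh g (P ⊗ₜ m) = evalGL g P • A.cohComplexify m := by
  rw [Algebra.smul_def]
  exact Algebra.TensorProduct.lift_tmul
    (((Algebra.ofId ℂ (Coh ℂ A)).restrictScalars ℚ).comp (evalGL g)) A.cohComplexify
    (fun P m => Algebra.commutes (evalGL g P) (A.cohComplexify m)) P m

/-- The action of `g` on a rational class is a polynomial with rational coefficients in the matrix
entries of `g`. -/
theorem exists_act_eq_evalCoh (m : Coh ℚ A) :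
    ∃ t, ∀ g : A.GLH1, A.act g (A.cohComplexify m) = evalCoh g t := by
  induction m using ExteriorAlgebra.induction with
  | algebraMap r =>
    refine ⟨algebraMap ℚ _ r, fun g => ?_⟩
    rw [AlgHom.commutes, AlgHom.commutes]
    exact AlgHom.commutes ((A.act g).restrictScalars ℚ) r
  | ι φ =>
    refine ⟨∑ j, MvPolynomial.X (φ, A.latticeBasis j) ⊗ₜ ExteriorAlgebra.ι ℚ (A.H1Basis ℚ j),
      fun g => ?_⟩
    rw [cohComplexify_ι, act_ι, map_sum, H1_eq_sum ℂ (g (A.H1Complexify φ)), map_sum]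
    refine Finset.sum_congr rfl fun j _ => ?_
    rw [evalCoh_tmul, evalGL_X, map_smul, cohComplexify_ι, H1Complexify_H1Basis]
  | mul a b ha hb =>
    obtain ⟨s, hs⟩ := ha
    obtain ⟨t, ht⟩ := hb
    exact ⟨s * t, fun g => by rw [map_mul, map_mul, map_mul, hs, ht]⟩
  | add a b ha hb =>
    obtain ⟨s, hs⟩ := ha
    obtain ⟨t, ht⟩ := hb
    exact ⟨s + t, fun g => by rw [map_add, map_add, map_add, hs, ht]⟩

/-- The extension to `H⋆(A, ℂ)` of a linear form on `H⋆(A, ℚ)`. -/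
def extendForm (f : Coh ℚ A →ₗ[ℚ] ℚ) : Coh ℂ A →ₗ[ℂ] ℂ :=
  extendLinear (Algebra.linearMap ℚ ℂ ∘ₗ f)

@[simp]
theorem extendForm_cohComplexify (f : Coh ℚ A →ₗ[ℚ] ℚ) (m : Coh ℚ A) :
    extendForm f (A.cohComplexify m) = (f m : ℂ) := by
  simp [extendForm]

theorem exists_extendForm_act_eq_evalGL (m : Coh ℚ A) (f : Coh ℚ A →ₗ[ℚ] ℚ) :
    ∃ P, ∀ g : A.GLH1, extendForm f (A.act g (A.cohComplexify m)) = evalGL g P := by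
  obtain ⟨t, ht⟩ := exists_act_eq_evalCoh m
  refine ⟨TensorProduct.rid ℚ _ (f.lTensor _ t), fun g => ?_⟩
  rw [ht]
  clear ht
  induction t with
  | zero => simp
  | add s t hs ht => simp only [map_add, hs, ht]
  | tmul P m =>
    rw [evalCoh_tmul, map_smul, extendForm_cohComplexify, LinearMap.lTensor_tmul,
      TensorProduct.rid_tmul, map_smul, smul_eq_mul, Rat.smul_def, mul_comm]

theorem mem_complexSpan_iff {W : Submodule ℚ (Coh ℚ A)} {x : Coh ℂ A} :
    x ∈ complexSpan W ↔ ∀ j, A.ratCoord x j ∈ W := by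
  refine ⟨fun hx j => ratCoord_mem hx j, fun h => ?_⟩
  rw [← sum_ratCoord x]
  exact sum_mem fun j _ => Submodule.smul_mem _ _ (cohComplexify_mem_complexSpan (h j))

/-- A rational form vanishes on ∑ e_j ⊗ m_j exactly when it vanishes on every m_j, because the e_j
are independent over ℚ. So the rational equations of `W` also cut out its complexification. -/
theorem mem_complexSpan_iff_extendForm {W : Submodule ℚ (Coh ℚ A)} {x : Coh ℂ A} :
    x ∈ complexSpan W ↔ ∀ f ∈ W.dualAnnihilator, extendForm f x = 0 := by
  refine ⟨fun hx f hf => ?_, fun h => mem_complexSpan_iff.2 fun j => ?_⟩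
  · induction hx using Submodule.span_induction with
    | mem x hx =>
      obtain ⟨m, hm, rfl⟩ := hx
      rw [extendForm_cohComplexify, (Submodule.mem_dualAnnihilator f).1 hf m hm, Rat.cast_zero]
    | zero => simp
    | add x y _ _ hx hy => rw [map_add, hx, hy, add_zero]
    | smul c x _ hx => rw [map_smul, hx, smul_zero]
  · rw [← Subspace.forall_mem_dualAnnihilator_apply_eq_zero_iff]
    intro f hf
    have h1 := h f hf
    have h2 : Finsupp.linearCombination ℚ complexRatBasis
        ((A.ratCoord x).mapRange f (map_zero f)) = 0 := by
      rw [← h1, Finsupp.linearCombination_apply, Finsupp.sum_mapRange_index (by simp)]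
      conv_rhs => rw [← sum_ratCoord x]
      rw [Finsupp.sum, Finsupp.sum, map_sum]
      refine Finset.sum_congr rfl fun j _ => ?_
      rw [map_smul, extendForm_cohComplexify, Rat.smul_def, smul_eq_mul, mul_comm]
    have h3 := linearIndependent_iff.1 complexRatBasis.linearIndependent _ h2
    simpa using DFunLike.congr_fun h3 j

/-- The stabilizer in `GL(H¹(A, ℂ))` of a rational subspace of the cohomology. -/
def stabilizer (W : Submodule ℚ (Coh ℚ A)) : Subgroup A.GLH1 where
  carrier := {g | ∀ x ∈ complexSpan W, A.act g x ∈ complexSpan W}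
  one_mem' x hx := by rwa [act_one]
  mul_mem' hg hh x hx := by
    rw [act_mul]
    exact hg _ (hh _ hx)
  inv_mem' {g} hg x hx := by
    -- An injective operator preserving a finite-dimensional space maps it onto itself.
    have h1 : (complexSpan W).map (A.act g).toLinearMap = complexSpan W :=
      Submodule.eq_of_le_of_finrank_eq (Submodule.map_le_iff_le_comap.2 hg)
        ((Submodule.equivMapOfInjective _ (act_injective g) _).finrank_eq).symm
    rw [← h1] at hx
    obtain ⟨y, hy, rfl⟩ := hx
    rw [AlgHom.toLinearMap_apply, ← act_mul, inv_mul_cancel, act_one]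
    exact hy

/-- The equations are f(g m) = 0 for m in `W` and f in its annihilator; they are rational
polynomials in the entries of g. -/
theorem isAlgebraicOverRat_stabilizer (W : Submodule ℚ (Coh ℚ A)) :
    A.IsAlgebraicOverRat (stabilizer W) := by
  choose P hP using fun (m : Coh ℚ A) (f : Coh ℚ A →ₗ[ℚ] ℚ) => exists_extendForm_act_eq_evalGL m f
  refine ⟨{Q | ∃ m ∈ W, ∃ f ∈ W.dualAnnihilator, Q = P m f}, fun g => ⟨?_, fun h x hx => ?_⟩⟩
  · rintro hg _ ⟨m, hm, f, hf, rfl⟩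
    change evalGL g _ = 0
    rw [← hP]
    exact mem_complexSpan_iff_extendForm.1 (hg _ (cohComplexify_mem_complexSpan hm)) f hf
  · suffices complexSpan W ≤ (complexSpan W).comap (A.act g).toLinearMap from this hx
    rw [complexSpan_le]
    intro m hm
    refine mem_complexSpan_iff_extendForm.2 fun f hf => ?_
    rw [AlgHom.toLinearMap_apply, hP]
    exact h _ ⟨m, hm, f, hf, rfl⟩

/-- A rational Hodge structure is stable under the Hodge group. -/
theorem IsHodgeSubstructure.act_mem_of_mem_hodgeGroup {n : ℕ} {W : Submodule ℚ (Coh ℚ A)}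
    (h : A.IsHodgeSubstructure n W) {g : A.GLH1} (hg : g ∈ A.hodgeGroup) {x : Coh ℂ A}
    (hx : x ∈ complexSpan W) : A.act g x ∈ complexSpan W :=
  hodgeGroup_le (isAlgebraicOverRat_stabilizer W) (fun z _ hx => h.act_mem z hx) hg x hx

end ComplexAbelianVariety

/-! ### Orthonormal bases for real forms -/

/-- A positive definite symmetric bilinear form on a finite-dimensional real vector space has an
orthonormal basis. -/
theorem LinearMap.BilinForm.exists_orthonormal_basis {V : Type*} [AddCommGroup V] [Module ℝ V]
    [FiniteDimensional ℝ V] {S : LinearMap.BilinForm ℝ V} (hS : ∀ x y, S x y = S y x)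
    (hpos : ∀ x, x ≠ 0 → 0 < S x x) :
    ∃ (n : ℕ) (e : Module.Basis (Fin n) ℝ V), ∀ i j, S (e i) (e j) = if i = j then 1 else 0 := by
  obtain ⟨v, hv⟩ := LinearMap.BilinForm.exists_orthogonal_basis (B := S) ⟨hS⟩
  have hvpos : ∀ i, 0 < S (v i) (v i) := fun i => hpos _ (v.ne_zero i)
  refine ⟨_, v.isUnitSMul (w := fun i => (Real.sqrt (S (v i) (v i)))⁻¹) fun i =>
    (inv_ne_zero (Real.sqrt_pos.2 (hvpos i)).ne').isUnit, fun i j => ?_⟩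
  simp only [Module.Basis.isUnitSMul_apply, map_smul, LinearMap.smul_apply, smul_eq_mul]
  split_ifs with h
  · subst h
    have h1 := (Real.sqrt_pos.2 (hvpos i)).ne'
    have h2 := Real.mul_self_sqrt (hvpos i).le
    field_simp
    nlinarith
  · have : S (v i) (v j) = 0 := hv h
    rw [this, mul_zero, mul_zero]

namespace ComplexAbelianVariety

variable {A B X Y : ComplexAbelianVariety.{u}}

/-! ### Polarizations -/

/-- The matrix of an operator on `H¹(A, ℂ)` in the basis dual to a basis of the lattice. -/
def latticeMatrix (g : A.GLH1) : Matrix (Fin A.betti) (Fin A.betti) ℂ :=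
  LinearMap.toMatrix (A.H1Basis ℂ) (A.H1Basis ℂ) g.toLinearMap

theorem latticeMatrix_apply (g : A.GLH1) (i j : Fin A.betti) :
    latticeMatrix g i j = g (A.H1Basis ℂ j) (A.latticeBasis i) := by
  rw [latticeMatrix, LinearMap.toMatrix_apply, H1Basis_repr]
  rfl

theorem latticeMatrix_mul (g h : A.GLH1) :
    latticeMatrix (g * h) = latticeMatrix g * latticeMatrix h :=
  LinearMap.toMatrix_mul (A.H1Basis ℂ) g.toLinearMap h.toLinearMap

@[simp]
theorem latticeMatrix_one : latticeMatrix (1 : A.GLH1) = 1 :=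
  LinearMap.toMatrix_one (A.H1Basis ℂ)

/-- The group of operators on `H¹(A, ℂ)` that preserve a bilinear form on the lattice. -/
def formStabilizer (M : Matrix (Fin A.betti) (Fin A.betti) ℂ) : Subgroup A.GLH1 where
  carrier := {g | latticeMatrix g * M * (latticeMatrix g).transpose = M}
  one_mem' := by simp
  mul_mem' {g h} hg hh := by
    simp only [Set.mem_ofPred_eq] at hg hh ⊢
    rw [latticeMatrix_mul, Matrix.transpose_mul]
    calc _ = latticeMatrix g * (latticeMatrix h * M * (latticeMatrix h).transpose) *
        (latticeMatrix g).transpose := by simp only [Matrix.mul_assoc]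
      _ = M := by rw [hh, hg]
  inv_mem' {g} hg := by
    simp only [Set.mem_ofPred_eq] at hg ⊢
    have h1 : latticeMatrix g⁻¹ * latticeMatrix g = 1 := by
      rw [← latticeMatrix_mul, inv_mul_cancel, latticeMatrix_one]
    have h2 : (latticeMatrix g).transpose * (latticeMatrix g⁻¹).transpose = 1 := by
      rw [← Matrix.transpose_mul, h1, Matrix.transpose_one]
    calc _ = latticeMatrix g⁻¹ * (latticeMatrix g * M * (latticeMatrix g).transpose) *
        (latticeMatrix g⁻¹).transpose := by rw [hg]
      _ = (latticeMatrix g⁻¹ * latticeMatrix g) * M *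
        ((latticeMatrix g).transpose * (latticeMatrix g⁻¹).transpose) := by
          simp only [Matrix.mul_assoc]
      _ = M := by rw [h1, h2, one_mul, mul_one]

theorem mem_formStabilizer {M : Matrix (Fin A.betti) (Fin A.betti) ℂ} {g : A.GLH1} :
    g ∈ formStabilizer M ↔ latticeMatrix g * M * (latticeMatrix g).transpose = M := Iff.rfl

theorem isAlgebraicOverRat_formStabilizer (M : Matrix (Fin A.betti) (Fin A.betti) ℤ) :
    A.IsAlgebraicOverRat (formStabilizer (M.map fun m => (m : ℂ))) := by
  let P : Fin A.betti → Fin A.betti → MvPolynomial (H1 ℚ A × A.Λ) ℚ := fun i l =>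
    (∑ k, (∑ j, MvPolynomial.X (A.H1Basis ℚ j, A.latticeBasis i) * MvPolynomial.C (M j k : ℚ)) *
      MvPolynomial.X (A.H1Basis ℚ k, A.latticeBasis l)) - MvPolynomial.C (M i l : ℚ)
  have hP : ∀ (g : A.GLH1) i l, evalGL g (P i l) = (latticeMatrix g *
      (M.map fun m => (m : ℂ)) * (latticeMatrix g).transpose) i l - M i l := by
    intro g i l
    have hC : ∀ q : ℚ, evalGL g (MvPolynomial.C q) = (q : ℂ) := fun q =>
      (evalGL g).commutes q
    simp only [P, map_sub, map_sum, map_mul, evalGL_X, hC, H1Complexify_H1Basis, Matrix.mul_apply,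
      Matrix.transpose_apply, Matrix.map_apply, latticeMatrix_apply, Rat.cast_intCast]
  refine ⟨{Q | ∃ i l, Q = P i l}, fun g => ⟨?_, fun h => ?_⟩⟩
  · rintro hg _ ⟨i, l, rfl⟩
    change evalGL g _ = 0
    rw [hP, mem_formStabilizer.1 hg, Matrix.map_apply, sub_self]
  · rw [mem_formStabilizer]
    ext i l
    rw [Matrix.map_apply, ← sub_eq_zero, ← hP]
    exact h _ ⟨i, l, rfl⟩

/-- The real basis of `V` given by the basis of the lattice. -/
abbrev realBasis (A : ComplexAbelianVariety.{u}) : Module.Basis (Fin A.betti) ℝ A.V :=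
  A.latticeBasis.ofZLatticeBasis ℝ A.Λ

theorem realExt_H1Basis (j : Fin A.betti) (v : A.V) :
    A.realExt (A.H1Basis ℂ j) v = (A.realBasis.repr v j : ℂ) := by
  have : A.realExt (A.H1Basis ℂ j) = Complex.ofRealLI.toLinearMap ∘ₗ A.realBasis.coord j :=
    A.realBasis.ext fun i => by
      rw [LinearMap.comp_apply, Module.Basis.coord_apply, Module.Basis.repr_self,
        Module.Basis.ofZLatticeBasis_apply, realExt_latticeBasis, H1Basis_apply,
        Finsupp.single_apply]
      simp only [eq_comm (a := i)]
      split_ifs <;> simp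
  rw [this]; rfl

/-- The basis of `H¹(A, ℂ)` dual to a real basis of `V`. -/
def dualRealBasis {n : ℕ} (e : Module.Basis (Fin n) ℝ A.V) : Module.Basis (Fin n) ℂ (H1 ℂ A) :=
  Module.Basis.ofEquivFun
    { toFun := fun φ i => A.realExt φ (e i)
      map_add' := fun _ _ => by ext; simp
      map_smul' := fun _ _ => by ext; simp
      invFun := fun c => (e.constr ℝ c).toAddMonoidHom.toIntLinearMap.comp A.Λ.subtype
      left_inv := fun φ => by
        ext l
        have : e.constr ℝ (fun i => A.realExt φ (e i)) = A.realExt φ :=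
          e.ext fun i => by rw [e.constr_basis]
        rw [← realExt_coe φ l, ← this]
        rfl
      right_inv := fun c => by
        ext i
        have : A.realExt ((e.constr ℝ c).toAddMonoidHom.toIntLinearMap.comp A.Λ.subtype) =
            e.constr ℝ c := real_hom_ext fun l => by rw [realExt_coe]; rfl
        change A.realExt ((e.constr ℝ c).toAddMonoidHom.toIntLinearMap.comp A.Λ.subtype) (e i) = _
        rw [this, e.constr_basis] }

@[simp]
theorem dualRealBasis_repr {n : ℕ} (e : Module.Basis (Fin n) ℝ A.V) (φ : H1 ℂ A) (i : Fin n) :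
    (dualRealBasis e).repr φ i = A.realExt φ (e i) := rfl

theorem realExt_dualRealBasis {n : ℕ} (e : Module.Basis (Fin n) ℝ A.V) (j : Fin n) (v : A.V) :
    A.realExt (dualRealBasis e j) v = (e.repr v j : ℂ) := by
  have : A.realExt (dualRealBasis e j) = Complex.ofRealLI.toLinearMap ∘ₗ e.coord j :=
    e.ext fun i => by
      rw [← dualRealBasis_repr, Module.Basis.repr_self, LinearMap.comp_apply,
        Module.Basis.coord_apply, Module.Basis.repr_self, Finsupp.single_apply,
        Finsupp.single_apply]
      simp only [eq_comm (a := i)]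
      split_ifs <;> simp
  rw [this]; rfl

theorem realExt_galH1_conj (φ : H1 ℂ A) (v : A.V) :
    A.realExt (A.galH1 starRingAut φ) v = conj (A.realExt φ v) := by
  have : A.realExt (A.galH1 starRingAut φ) =
      (Complex.conjLIE.toLinearEquiv.toLinearMap ∘ₗ A.realExt φ) :=
    real_hom_ext fun l => by rw [realExt_coe]; simp
  rw [this]; rfl

/-- There is a basis of `H¹(A, ℂ)` in which the Hodge group is closed under conjugate
transposition. -/
theorem exists_basis_conjTranspose (A : ComplexAbelianVariety.{u}) :
    ∃ (n : ℕ) (e : Module.Basis (Fin n) ℂ (H1 ℂ A)), ∀ g ∈ A.hodgeGroup, ∃ g' ∈ A.hodgeGroup,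
      LinearMap.toMatrix e e g'.toLinearMap =
        (LinearMap.toMatrix e e g.toLinearMap).conjTranspose := by
  obtain ⟨E, hE0, hEint, hEI, hEpos⟩ := A.exists_riemannForm
  have hEsymm : ∀ x y, E x y = -E y x := fun x y => by
    have := hE0 (x + y)
    simp only [map_add, LinearMap.add_apply, hE0] at this
    linarith
  have hEscale : ∀ (z : Circle) x y, E ((z : ℂ) • x) ((z : ℂ) • y) = E x y := by
    intro z x y
    have hz : ∀ x : A.V, (z : ℂ) • x = (z : ℂ).re • x + (z : ℂ).im • Complex.I • x := fun x => by
      conv_lhs => rw [← Complex.re_add_im (z : ℂ)]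
      rw [add_smul, mul_smul, Complex.coe_smul, Complex.coe_smul]
    have h1 : E (Complex.I • x) y = -E x (Complex.I • y) := by
      have := hEI x (Complex.I • y)
      rw [smul_smul, Complex.I_mul_I, neg_one_smul, map_neg] at this
      linarith
    have h2 : (z : ℂ).re * (z : ℂ).re + (z : ℂ).im * (z : ℂ).im = 1 := by
      rw [← Complex.normSq_apply, Circle.normSq_coe]
    rw [hz x, hz y]
    simp only [map_add, map_smul, LinearMap.add_apply, LinearMap.smul_apply, smul_eq_mul, hEI, h1]
    linear_combination E x y * h2
  choose M hM using fun i j => hEint _ (A.latticeBasis i).2 _ (A.latticeBasis j).2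
  set Mc : Matrix (Fin A.betti) (Fin A.betti) ℂ :=
    Matrix.map M fun m => (m : ℂ) with hMc
  have hexp : ∀ x y, (E x y : ℂ) =
      ∑ k, (∑ j, (A.realBasis.repr x j : ℂ) * Mc j k) * (A.realBasis.repr y k : ℂ) := by
    intro x y
    have h1 : E x y = ∑ k, (∑ j, A.realBasis.repr x j * (M j k : ℝ)) * A.realBasis.repr y k := by
      conv_lhs => rw [← A.realBasis.sum_repr x, ← A.realBasis.sum_repr y]
      simp only [map_sum, map_smul, LinearMap.sum_apply, LinearMap.smul_apply, smul_eq_mul,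
        Module.Basis.ofZLatticeBasis_apply, hM]
      refine Finset.sum_congr rfl fun k _ => ?_
      rw [mul_comm]
    rw [h1]
    push_cast
    rfl
  -- The Riemann form has integral matrix and is invariant under the circle, so its stabilizer is
  -- algebraic over ℚ and contains the Hodge group.
  have hstab : ∀ g ∈ A.hodgeGroup, latticeMatrix g * Mc * (latticeMatrix g).transpose = Mc := by
    refine hodgeGroup_le (isAlgebraicOverRat_formStabilizer M) fun z => ?_
    rw [mem_formStabilizer]
    ext i l
    have hentry : ∀ i j, latticeMatrix (A.hodgeOp z) i j =
        (A.realBasis.repr ((z : ℂ) • (A.latticeBasis i : A.V)) j : ℂ) := fun i j => by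
      rw [latticeMatrix_apply, hodgeOp_apply, scaleH1_apply, realExt_H1Basis]
    simp only [Matrix.mul_apply, Matrix.transpose_apply, hentry]
    rw [← hMc, ← hexp, hEscale, hM]
    exact Complex.ofReal_intCast _
  -- The form E(ix, y) is symmetric and positive definite. In the dual of an orthonormal basis for
  -- it, the action of i is minus the matrix of E.
  obtain ⟨n, e, he⟩ := LinearMap.BilinForm.exists_orthonormal_basis
    (S := E ∘ₗ (LinearMap.lsmul ℂ A.V Complex.I).restrictScalars ℝ)
    (fun x y => by
      change E (Complex.I • x) y = E (Complex.I • y) x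
      have h1 := hEI (Complex.I • x) y
      rw [smul_smul, Complex.I_mul_I, neg_one_smul, map_neg, LinearMap.neg_apply] at h1
      rw [hEsymm (Complex.I • y), ← h1]) hEpos
  replace he : ∀ i j, E (Complex.I • e i) (e j) = if i = j then 1 else 0 := he
  set f := dualRealBasis e with hf
  let N : A.GLH1 → Matrix (Fin n) (Fin n) ℂ := fun g => LinearMap.toMatrix f f g.toLinearMap
  have hNmul : ∀ g h, N (g * h) = N g * N h := fun g h =>
    LinearMap.toMatrix_mul f g.toLinearMap h.toLinearMap
  have hNone : N 1 = 1 := LinearMap.toMatrix_one f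
  have hNapply : ∀ g i j, N g i j = A.realExt (g (f j)) (e i) := fun g i j => by
    simp only [N, LinearMap.toMatrix_apply]
    rfl
  let E' : Matrix (Fin n) (Fin n) ℂ := fun i j => (E (e i) (e j) : ℂ)
  have hE' : E' = f.toMatrix (A.H1Basis ℂ) * Mc * (f.toMatrix (A.H1Basis ℂ)).transpose := by
    ext i j
    simp only [E', hexp, Matrix.mul_apply, Matrix.transpose_apply, Module.Basis.toMatrix_apply, hf,
      dualRealBasis_repr, realExt_H1Basis]
  have hNE : ∀ g ∈ A.hodgeGroup, N g * E' * (N g).transpose = E' := by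
    intro g hg
    have h1 : N g = f.toMatrix (A.H1Basis ℂ) * latticeMatrix g * (A.H1Basis ℂ).toMatrix f :=
      (basis_toMatrix_mul_linearMap_toMatrix_mul_basis_toMatrix f (A.H1Basis ℂ) f
        (A.H1Basis ℂ) g.toLinearMap).symm
    have h2 : (A.H1Basis ℂ).toMatrix f * f.toMatrix (A.H1Basis ℂ) = 1 :=
      Module.Basis.toMatrix_mul_toMatrix_flip _ _
    have h3 : (f.toMatrix (A.H1Basis ℂ)).transpose * ((A.H1Basis ℂ).toMatrix f).transpose = 1 := by
      rw [← Matrix.transpose_mul, h2, Matrix.transpose_one]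
    generalize f.toMatrix (A.H1Basis ℂ) = R at *
    generalize (A.H1Basis ℂ).toMatrix f = R' at *
    rw [h1, hE', Matrix.transpose_mul, Matrix.transpose_mul]
    calc _ = R * latticeMatrix g * (R' * R) * Mc * (R.transpose * R'.transpose) *
          (latticeMatrix g).transpose * R.transpose := by simp only [Matrix.mul_assoc]
      _ = R * (latticeMatrix g * Mc * (latticeMatrix g).transpose) * R.transpose := by
          rw [h2, h3]; simp only [Matrix.mul_assoc, Matrix.mul_one]
      _ = _ := by rw [hstab g hg]
  let zI : Circle := ⟨Complex.I, mem_sphere_zero_iff_norm.2 Complex.norm_I⟩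
  have hrepr : ∀ v j, e.repr v j = E (Complex.I • v) (e j) := fun v j => by
    conv_rhs => rw [← e.sum_repr v]
    simp only [Finset.smul_sum, smul_comm Complex.I, map_sum, map_smul, LinearMap.sum_apply,
      LinearMap.smul_apply, he]
    simp
  have hNI : N (A.hodgeOp zI) = -E' := by
    ext i j
    rw [hNapply, hodgeOp_apply, realExt_scaleH1, hf, realExt_dualRealBasis, hrepr]
    change ((E (Complex.I • Complex.I • e i) (e j) : ℝ) : ℂ) = -(E (e i) (e j) : ℂ)
    rw [smul_smul, Complex.I_mul_I, neg_one_smul, map_neg, LinearMap.neg_apply, Complex.ofReal_neg]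
  have hfreal : ∀ j, A.galH1 starRingAut (f j) = f j := fun j => by
    apply f.repr.injective
    ext i
    rw [hf, dualRealBasis_repr, dualRealBasis_repr, realExt_galH1_conj, realExt_dualRealBasis,
      Complex.conj_ofReal]
  -- The basis `f` is real, so conjugation by complex conjugation conjugates the matrix entrywise.
  have hNconj : ∀ g, (N (galConj starRingAut g)).transpose = (N g).conjTranspose := fun g => by
    ext i j
    have h1 : A.galH1 (RingEquiv.symm starRingAut) (f i) = f i := by
      conv_lhs => rw [← hfreal i]
      ext l
      exact (starRingAut (R := ℂ)).symm_apply_apply _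
    rw [Matrix.transpose_apply, Matrix.conjTranspose_apply, hNapply, hNapply, galConj_apply, h1,
      realExt_galH1_conj]
    rfl
  -- With h the action of i and k the conjugate of g, invariance of E reads N(k) N(h) N(k)ᵀ = N(h).
  -- Hence N(k)ᵀ = N(h⁻¹k⁻¹h), and N(k)ᵀ is the conjugate transpose of N(g).
  refine ⟨n, f, fun g hg => ⟨(A.hodgeOp zI)⁻¹ * (galConj starRingAut g)⁻¹ * A.hodgeOp zI,
    mul_mem (mul_mem (inv_mem (hodgeOp_mem_hodgeGroup _))
      (inv_mem (galConj_mem_hodgeGroup _ hg))) (hodgeOp_mem_hodgeGroup _), ?_⟩⟩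
  change N _ = (N g).conjTranspose
  rw [← hNconj]
  set k := galConj starRingAut g with hk
  set h := A.hodgeOp zI with hh
  have h1 := hNE k (galConj_mem_hodgeGroup _ hg)
  have h2 : N k * N h * (N k).transpose = N h := by
    rw [hNI]
    simp only [Matrix.mul_neg, Matrix.neg_mul, h1]
  calc N (h⁻¹ * k⁻¹ * h) = N (h⁻¹ * k⁻¹) * (N k * N h * (N k).transpose) := by rw [h2, hNmul _ h]
    _ = N (h⁻¹ * k⁻¹ * (k * h)) * (N k).transpose := by
      rw [hNmul _ (k * h), hNmul k h]; simp only [Matrix.mul_assoc]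
    _ = (N k).transpose := by
      rw [show h⁻¹ * k⁻¹ * (k * h) = 1 by group, hNone, Matrix.one_mul]

end ComplexAbelianVariety

/-! ### The grading of the exterior algebra -/

namespace ExteriorAlgebra

/-- The projection of the exterior algebra to its part of degree `n`. -/
def degreeProj (R : Type*) {M : Type*} [CommRing R] [AddCommGroup M] [Module R M] (n : ℕ) :
    ExteriorAlgebra R M →ₗ[R] ExteriorAlgebra R M :=
  GradedAlgebra.proj (fun i : ℕ => ⋀[R]^i M) n

section

variable {R M : Type*} [CommRing R] [AddCommGroup M] [Module R M]

theorem degreeProj_mem (n : ℕ) (x : ExteriorAlgebra R M) : degreeProj R n x ∈ ⋀[R]^n M :=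
  (DirectSum.decompose (fun i : ℕ => ⋀[R]^i M) x n).2

theorem degreeProj_of_mem {n : ℕ} {x : ExteriorAlgebra R M} (hx : x ∈ ⋀[R]^n M) :
    degreeProj R n x = x :=
  DirectSum.decompose_of_mem_same (fun i : ℕ => ⋀[R]^i M) hx

theorem degreeProj_of_mem_ne {m n : ℕ} {x : ExteriorAlgebra R M} (hx : x ∈ ⋀[R]^m M)
    (h : m ≠ n) : degreeProj R n x = 0 :=
  DirectSum.decompose_of_mem_ne (fun i : ℕ => ⋀[R]^i M) hx h

theorem exists_degreeProj_ne_zero {x : ExteriorAlgebra R M} (hx : x ≠ 0) :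
    ∃ n, degreeProj R n x ≠ 0 := by
  classical
  by_contra! h
  apply hx
  rw [← DirectSum.sum_support_decompose (fun i : ℕ => ⋀[R]^i M) x]
  exact Finset.sum_eq_zero fun n _ => h n

/-- A map that preserves degrees commutes with the projections to the homogeneous parts. -/
theorem map_degreeProj {R' M' F : Type*} [CommRing R'] [AddCommGroup M'] [Module R' M']
    [FunLike F (ExteriorAlgebra R M) (ExteriorAlgebra R' M')]
    [AddMonoidHomClass F (ExteriorAlgebra R M) (ExteriorAlgebra R' M')] (f : F)
    (hf : ∀ n, ∀ x ∈ ⋀[R]^n M, f x ∈ ⋀[R']^n M') (n : ℕ) (x : ExteriorAlgebra R M) :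
    f (degreeProj R n x) = degreeProj R' n (f x) := by
  induction x using DirectSum.Decomposition.inductionOn (fun i : ℕ => ⋀[R]^i M) with
  | zero => simp
  | @homogeneous i m =>
    by_cases h : i = n
    · subst h
      rw [degreeProj_of_mem m.2, degreeProj_of_mem (hf _ _ m.2)]
    · rw [degreeProj_of_mem_ne m.2 h, degreeProj_of_mem_ne (hf _ _ m.2) h, map_zero]
  | add x y hx hy => simp only [map_add, hx, hy]

theorem map_mem_exteriorPower {M' : Type*} [AddCommGroup M'] [Module R M'] (f : M →ₗ[R] M') {n : ℕ}
    {x : ExteriorAlgebra R M} (hx : x ∈ ⋀[R]^n M) : map f x ∈ ⋀[R]^n M' := by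
  rw [← ιMulti_span_fixedDegree] at hx
  induction hx using Submodule.span_induction with
  | mem x hx =>
    obtain ⟨v, rfl⟩ := hx
    rw [map_apply_ιMulti]
    exact ιMulti_range R n ⟨_, rfl⟩
  | zero => rw [map_zero]; exact zero_mem _
  | add x y _ _ hx hy => rw [map_add]; exact add_mem hx hy
  | smul c x _ hx => rw [map_smul]; exact Submodule.smul_mem _ _ hx

end

end ExteriorAlgebra

namespace ComplexAbelianVariety

open ExteriorAlgebra

variable {A B X Y : ComplexAbelianVariety.{u}}

theorem act_degreeProj (g : A.GLH1) (n : ℕ) (x : Coh ℂ A) :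
    A.act g (degreeProj ℂ n x) = degreeProj ℂ n (A.act g x) :=
  map_degreeProj (A.act g) (fun _ _ hx => map_mem_exteriorPower _ hx) n x

theorem complexifyMap_degreeProj (n : ℕ) :
    complexifyMap (degreeProj ℚ n : Coh ℚ A →ₗ[ℚ] Coh ℚ A) = degreeProj ℂ n :=
  coh_hom_ext fun m => by
    rw [complexifyMap_cohComplexify]
    exact map_degreeProj A.cohComplexify (fun n x hx =>
      complexSpan_exteriorPower (A := A) n ▸ cohComplexify_mem_complexSpan hx) n m

/-! ### Complete reducibility -/

/-- A submodule of `Hⁿ(A, ℂ)` over the Hodge group has a complement. -/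
theorem IsHodgeGroupSubmodule.exists_compl {n : ℕ} {U : Submodule ℂ (Coh ℂ A)}
    (hU : A.IsHodgeGroupSubmodule U) (hn : U ≤ ⋀[ℂ]^n (H1 ℂ A)) :
    ∃ U', A.IsHodgeGroupSubmodule U' ∧ U ⊓ U' = ⊥ ∧ U ⊔ U' = ⋀[ℂ]^n (H1 ℂ A) := by
  obtain ⟨d, e, he⟩ := A.exists_basis_conjTranspose
  -- `L` presents Hⁿ as a quotient of the n-th tensor power of H¹, which carries a standard inner
  -- product. Below, `N g` is the n-th Kronecker power of the matrix of g; it lifts the action of g.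
  let L : EuclideanSpace ℂ (Fin n → Fin d) →ₗ[ℂ] Coh ℂ A :=
    ∑ f : Fin n → Fin d, (EuclideanSpace.proj f).toLinearMap.smulRight (ιMulti ℂ n (e ∘ f))
  have hL : ∀ v, L v = ∑ f : Fin n → Fin d, v f • ιMulti ℂ n (e ∘ f) := fun v => by
    simp [L, LinearMap.sum_apply]
  have hLrange : LinearMap.range L = ⋀[ℂ]^n (H1 ℂ A) := by
    apply le_antisymm
    · rintro _ ⟨v, rfl⟩
      rw [hL]
      exact sum_mem fun f _ => Submodule.smul_mem _ _ (ιMulti_range ℂ n ⟨_, rfl⟩)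
    · rw [← exteriorPower.ιMulti_span_fixedDegree_of_span_eq_top ℂ n (H1 ℂ A) e.span_eq,
        Submodule.span_le]
      rintro _ ⟨v, hv, rfl⟩
      choose f hf using fun i => hv ⟨i, rfl⟩
      refine ⟨EuclideanSpace.single f 1, ?_⟩
      rw [hL, Finset.sum_eq_single f (fun g _ hg => by simp [hg]) (by simp)]
      have : (e ∘ f) = v := funext hf
      simp [this]
  let N : A.GLH1 → Matrix (Fin n → Fin d) (Fin n → Fin d) ℂ := fun g => Matrix.of fun f' f =>
    ∏ k, LinearMap.toMatrix e e g.toLinearMap (f' k) (f k)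
  have hact : ∀ g v, A.act g (L v) = L (Matrix.toEuclideanLin (N g) v) := by
    intro g v
    have h1 : ∀ f : Fin n → Fin d, A.act g (ιMulti ℂ n (e ∘ f)) =
        ∑ f' : Fin n → Fin d, N g f' f • ιMulti ℂ n (e ∘ f') := by
      intro f
      rw [act, map_apply_ιMulti]
      have h2 : (g.toLinearMap : H1 ℂ A → H1 ℂ A) ∘ e ∘ f = fun k => ∑ j,
          LinearMap.toMatrix e e g.toLinearMap j (f k) • e j := by
        ext1 k
        simp only [Function.comp_apply, LinearMap.toMatrix_apply]
        exact (e.sum_repr _).symm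
      rw [h2]
      have h3 := (ιMulti ℂ n (M := H1 ℂ A)).toMultilinearMap.map_sum
        (fun k j => LinearMap.toMatrix e e g.toLinearMap j (f k) • e j)
      refine h3.trans (Finset.sum_congr rfl fun f' _ => ?_)
      exact (ιMulti ℂ n (M := H1 ℂ A)).toMultilinearMap.map_smul_univ _ _
    rw [hL, hL, map_sum]
    simp only [map_smul, h1, Finset.smul_sum, smul_smul]
    rw [Finset.sum_comm]
    refine Finset.sum_congr rfl fun f' _ => ?_
    rw [← Finset.sum_smul]
    congr 1
    simp only [Matrix.toLpLin_apply, Matrix.mulVec, dotProduct]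
    exact Finset.sum_congr rfl fun f _ => mul_comm _ _
  have hNadj : ∀ g ∈ A.hodgeGroup, ∃ g' ∈ A.hodgeGroup, ∀ x y,
      inner ℂ x (Matrix.toEuclideanLin (N g) y) = inner ℂ (Matrix.toEuclideanLin (N g') x) y := by
    intro g hg
    obtain ⟨g', hg', h⟩ := he g hg
    refine ⟨g', hg', fun x y => ?_⟩
    have : N g' = (N g).conjTranspose := by
      ext f' f
      simp only [N, h, Matrix.conjTranspose_apply, Matrix.of_apply, star_prod]
    rw [this, Matrix.toEuclideanLin_conjTranspose_eq_adjoint, LinearMap.adjoint_inner_left]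
  -- The orthogonal complement of the preimage of `U` is stable because the adjoint of `N g` is `N
  -- g'` with g' again in the Hodge group.
  refine ⟨(U.comap L)ᗮ.map L, ?_, ?_, ?_⟩
  · rintro g hg _ ⟨x, hx, rfl⟩
    rw [hact]
    refine ⟨_, ?_, rfl⟩
    obtain ⟨g', hg', h⟩ := hNadj g hg
    rw [SetLike.mem_coe, Submodule.mem_orthogonal]
    intro u hu
    rw [h]
    refine (Submodule.mem_orthogonal _ _).1 hx _ ?_
    rw [Submodule.mem_comap, ← hact]
    exact hU g' hg' _ hu
  · rw [eq_bot_iff]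
    rintro _ ⟨hu, x, hx, rfl⟩
    have : x = 0 := by
      rw [← Submodule.mem_bot ℂ, ← Submodule.inf_orthogonal_eq_bot (U.comap L)]
      exact ⟨hu, hx⟩
    rw [this, map_zero]
    exact zero_mem _
  · have h1 : U = (U.comap L).map L := by
      rw [Submodule.map_comap_eq, hLrange, inf_eq_right.2 hn]
    conv_lhs => enter [1]; rw [h1]
    rw [← Submodule.map_sup, Submodule.sup_orthogonal_of_hasOrthogonalProjection,
      Submodule.map_top, hLrange]

/-- A submodule of `Hⁿ(A, ℂ)` over the Hodge group is the image of an equivariant projection. -/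
theorem IsHodgeGroupSubmodule.exists_projection {n : ℕ} {U : Submodule ℂ (Coh ℂ A)}
    (hU : A.IsHodgeGroupSubmodule U) (hn : U ≤ ⋀[ℂ]^n (H1 ℂ A)) :
    ∃ q : Coh ℂ A →ₗ[ℂ] Coh ℂ A, (∀ x, q x ∈ U) ∧ (∀ x ∈ U, q x = x) ∧
      ∀ g ∈ A.hodgeGroup, ∀ x, q (A.act g x) = A.act g (q x) := by
  obtain ⟨U', hU', hinf, hsup⟩ := hU.exists_compl hn
  -- The comap adds all other degrees to `U'`, which turns a complement in Hⁿ into one in the whole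
  -- cohomology.
  have hcompl : IsCompl U (U'.comap (degreeProj ℂ n)) := by
    constructor
    · rw [disjoint_iff, eq_bot_iff, ← hinf]
      rintro x ⟨hx, hx'⟩
      exact ⟨hx, by simpa [degreeProj_of_mem (hn hx)] using hx'⟩
    · rw [codisjoint_iff, eq_top_iff]
      intro x _
      have h := degreeProj_mem (R := ℂ) n x
      rw [← hsup] at h
      obtain ⟨u, hu, u', hu', h⟩ := Submodule.mem_sup.1 h
      refine Submodule.mem_sup.2 ⟨u, hu, x - u, ?_, add_sub_cancel _ _⟩
      rw [Submodule.mem_comap, map_sub, degreeProj_of_mem (hn hu), ← h, add_sub_cancel_left]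
      exact hu'
  refine ⟨U.projection _ hcompl, fun x => Submodule.projection_apply_mem hcompl x, fun x hx =>
    Submodule.projection_apply_of_mem_left hcompl hx, fun g hg x => ?_⟩
  obtain ⟨u, hu, w, hw, rfl⟩ :=
    Submodule.mem_sup.1 (hcompl.sup_eq_top ▸ Submodule.mem_top (x := x))
  have hw' : A.act g w ∈ U'.comap (degreeProj ℂ n) := by
    rw [Submodule.mem_comap, ← act_degreeProj]
    exact hU' g hg _ hw
  simp only [map_add, Submodule.projection_apply_of_mem_left hcompl hu,
    Submodule.projection_apply_of_mem_left hcompl (hU g hg u hu),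
    Submodule.projection_apply_of_mem_right hcompl hw,
    Submodule.projection_apply_of_mem_right hcompl hw', map_zero]

/-! ### Descent from `ℂ` to `ℚ` -/

/-- The components over `ℚ` of a map that is equivariant under a set of operators stable under the
automorphisms of `ℂ` are equivariant. -/
theorem complexifyMap_ratComponent_act {𝒢 : Set (A.GLH1 × X.GLH1)}
    (h𝒢 : ∀ (σ : ℂ ≃+* ℂ), ∀ x ∈ 𝒢, (galConj σ x.1, galConj σ x.2) ∈ 𝒢)
    {ψ : Coh ℂ A →ₗ[ℂ] Coh ℂ X}
    (hψ : ∀ x ∈ 𝒢, ∀ y, ψ (A.act x.1 y) = X.act x.2 (ψ y)) (j) {x : A.GLH1 × X.GLH1} (hx : x ∈ 𝒢)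
    (y : Coh ℂ A) : complexifyMap (ratComponent ψ j) (A.act x.1 y) =
      X.act x.2 (complexifyMap (ratComponent ψ j) y) := by
  classical
  obtain ⟨s, hs⟩ := exists_eq_sum_ratComponent ψ
  have hsum := hs (insert j s) (Finset.subset_insert j s)
  refine sub_eq_zero.1 (complexRatBasis.linearIndependent.eq_zero_of_forall_ringEquiv_sum_smul
    (insert j s) (fun i => complexifyMap (ratComponent ψ i) (A.act x.1 y) -
      X.act x.2 (complexifyMap (ratComponent ψ i) y)) (fun σ => ?_) j (Finset.mem_insert_self j s))
  -- Conjugating ψ by σ leaves the rational components unchanged and replaces the coefficients e_i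
  -- by σ(e_i).
  have hgal : ∀ w, ψ (A.galCoh σ.symm w) = X.galCoh σ.symm
      (∑ i ∈ insert j s, σ (complexRatBasis i) • complexifyMap (ratComponent ψ i) w) := by
    intro w
    conv_lhs => rw [hsum]
    simp only [LinearMap.sum_apply, LinearMap.smul_apply, map_sum, galCoh_smul,
      galCoh_complexifyMap, RingEquiv.symm_apply_apply]
  have h1 := hψ _ (h𝒢 σ.symm x hx) (A.galCoh σ.symm y)
  rw [act_galConj_galCoh, hgal, hgal, act_galConj_galCoh] at h1
  have h2 := congrArg (X.galCoh σ) h1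
  rw [galCoh_galCoh_symm, galCoh_galCoh_symm, map_sum] at h2
  simp only [smul_sub, Finset.sum_sub_distrib, sub_eq_zero, map_smul] at h2 ⊢
  exact h2

/-- Lets descent, formulated for pairs of operators, apply to one group acting on source and target
alike. -/
theorem galConj_mem_diag (σ : ℂ ≃+* ℂ) :
    ∀ x ∈ {x : A.GLH1 × A.GLH1 | x.1 ∈ A.hodgeGroup ∧ x.2 = x.1},
      (galConj σ x.1, galConj σ x.2) ∈ {x : A.GLH1 × A.GLH1 | x.1 ∈ A.hodgeGroup ∧ x.2 = x.1} :=
  fun _ hx => ⟨galConj_mem_hodgeGroup σ hx.1, by rw [hx.2]⟩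

/-- A rational Hodge structure in the cohomology is the image of an equivariant projection defined
over `ℚ`. -/
theorem IsHodgeSubstructure.exists_projection {n : ℕ} {W : Submodule ℚ (Coh ℚ A)}
    (hW : A.IsHodgeSubstructure n W) :
    ∃ p : Coh ℚ A →ₗ[ℚ] Coh ℚ A, (∀ x, p x ∈ W) ∧ (∀ x ∈ W, p x = x) ∧
      ∀ g ∈ A.hodgeGroup, ∀ x, complexifyMap p (A.act g x) = A.act g (complexifyMap p x) := by
  obtain ⟨q, hq, hq', hqg⟩ := IsHodgeGroupSubmodule.exists_projection (U := complexSpan W) (n := n)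
    (fun g hg x hx => hW.act_mem_of_mem_hodgeGroup hg hx)
    (complexSpan_exteriorPower (A := A) n ▸ complexSpan_mono hW.1)
  -- On `W` the complex projection q is the identity, so its j-th component is multiplication by the
  -- j-th coordinate of 1. Dividing by a nonzero one gives a rational projection.
  obtain ⟨j, hj⟩ : ∃ j, complexRatBasis.repr (1 : ℂ) j ≠ 0 := by
    by_contra! h
    have : complexRatBasis.repr (1 : ℂ) = 0 := by ext j; simp [h]
    simp at this
  have hcomp : ∀ x ∈ W, ratComponent q j x = complexRatBasis.repr (1 : ℂ) j • x := fun x hx => by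
    rw [ratComponent_apply, hq' _ (cohComplexify_mem_complexSpan hx), ← ratCoord_smul_cohComplexify,
      one_smul]
  have hsmul : complexifyMap ((complexRatBasis.repr (1 : ℂ) j)⁻¹ • ratComponent q j) =
      ((complexRatBasis.repr (1 : ℂ) j)⁻¹ : ℂ) • complexifyMap (ratComponent q j) :=
    coh_hom_ext fun m => by
      rw [complexifyMap_cohComplexify, LinearMap.smul_apply, LinearMap.smul_apply,
        complexifyMap_cohComplexify, map_smul, ← algebraMap_smul ℂ]
      simp
  refine ⟨(complexRatBasis.repr (1 : ℂ) j)⁻¹ • ratComponent q j, fun x => ?_, fun x hx => ?_,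
    fun g hg x => ?_⟩
  · exact W.smul_mem _ (ratCoord_mem (hq _) j)
  · rw [LinearMap.smul_apply, hcomp x hx, smul_smul, inv_mul_cancel₀ hj, one_smul]
  · rw [hsmul, LinearMap.smul_apply, LinearMap.smul_apply, map_smul]
    congr 1
    exact complexifyMap_ratComponent_act galConj_mem_diag
      (fun x hx y => by rw [hx.2]; exact hqg _ hx.1 y) j (x := (g, g)) ⟨hg, rfl⟩ x

/-! ### Irreducible submodules -/

theorem IsHodgeSubstructure.exists_isIrreducible {n : ℕ} {W : Submodule ℚ (Coh ℚ A)}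
    (hW : A.IsHodgeSubstructure n W) (hne : W ≠ ⊥) :
    ∃ V ≤ W, A.IsIrreducibleHodgeSubstructure n V := by
  obtain ⟨V, ⟨hV1, hV2, hV3⟩, hmin⟩ := wellFounded_lt.has_min
    {V : Submodule ℚ (Coh ℚ A) | V ≤ W ∧ A.IsHodgeSubstructure n V ∧ V ≠ ⊥} ⟨W, le_rfl, hW, hne⟩
  refine ⟨V, hV1, hV2, hV3, fun V₁ h₁ hV₁ => or_iff_not_imp_left.2 fun h0 => ?_⟩
  by_contra h
  exact hmin V₁ ⟨h₁.trans hV1, hV₁, h0⟩ (lt_of_le_of_ne h₁ h)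

theorem IsHodgeGroupSubmodule.exists_isIrreducible {U : Submodule ℂ (Coh ℂ A)}
    (hU : A.IsHodgeGroupSubmodule U) (hne : U ≠ ⊥) :
    ∃ V ≤ U, A.IsIrreducibleHodgeGroupSubmodule V := by
  obtain ⟨V, ⟨hV1, hV2, hV3⟩, hmin⟩ := wellFounded_lt.has_min
    {V : Submodule ℂ (Coh ℂ A) | V ≤ U ∧ A.IsHodgeGroupSubmodule V ∧ V ≠ ⊥} ⟨U, le_rfl, hU, hne⟩
  refine ⟨V, hV1, hV2, hV3, fun V₁ h₁ hV₁ => or_iff_not_imp_left.2 fun h0 => ?_⟩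
  by_contra h
  exact hmin V₁ ⟨h₁.trans hV1, hV₁, h0⟩ (lt_of_le_of_ne h₁ h)

end ComplexAbelianVariety

/-! ### The exterior algebra of a direct sum -/

namespace ExteriorAlgebra

section

variable {R M N P : Type*} [CommRing R] [AddCommGroup M] [AddCommGroup N] [AddCommGroup P]
  [Module R M] [Module R N] [Module R P]

/-- The exterior algebra of a direct sum. -/
def tensorEquiv (e : (M × N) ≃ₗ[R] P) :
    (ExteriorAlgebra R M ⊗[R] ExteriorAlgebra R N) ≃ₗ[R] ExteriorAlgebra R P :=
  GradedTensorProduct.of R (CliffordAlgebra.evenOdd (0 : QuadraticForm R M))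
      (CliffordAlgebra.evenOdd (0 : QuadraticForm R N)) ≪≫ₗ
    (CliffordAlgebra.prodEquiv (0 : QuadraticForm R M) (0 : QuadraticForm R N)).symm.toLinearEquiv
    ≪≫ₗ (CliffordAlgebra.equivOfIsometry (Q₂ := (0 : QuadraticForm R P))
      { e with map_app' := fun _ => by simp }).toLinearEquiv

theorem tensorEquiv_tmul (e : (M × N) ≃ₗ[R] P) (x : ExteriorAlgebra R M)
    (y : ExteriorAlgebra R N) : tensorEquiv e (x ⊗ₜ y) =
      map (e.toLinearMap ∘ₗ LinearMap.inl R M N) x *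
        map (e.toLinearMap ∘ₗ LinearMap.inr R M N) y := by
  have h : tensorEquiv e (x ⊗ₜ y) =
      CliffordAlgebra.equivOfIsometry (Q₂ := (0 : QuadraticForm R P))
        { e with map_app' := fun _ => by simp }
        (CliffordAlgebra.toProd (0 : QuadraticForm R M) (0 : QuadraticForm R N)
          (GradedTensorProduct.tmul R x y)) := rfl
  rw [h, CliffordAlgebra.toProd, GradedTensorProduct.lift_tmul, map_mul]
  congr 1
  · exact DFunLike.congr_fun (CliffordAlgebra.map_comp_map _ _) x
  · exact DFunLike.congr_fun (CliffordAlgebra.map_comp_map _ _) y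

/-- One computation for two uses: group elements acting on the factors, and the projections to
H^{1,0}. -/
theorem map_tensorEquiv {M' N' P' : Type*} [AddCommGroup M'] [AddCommGroup N'] [AddCommGroup P']
    [Module R M'] [Module R N'] [Module R P'] (e : (M × N) ≃ₗ[R] P) (e' : (M' × N') ≃ₗ[R] P')
    {f : M →ₗ[R] M'} {g : N →ₗ[R] N'} {h : P →ₗ[R] P'} (hfg : ∀ x y, h (e (x, y)) = e' (f x, g y))
    (x : ExteriorAlgebra R M) (y : ExteriorAlgebra R N) :
    map h (tensorEquiv e (x ⊗ₜ y)) = tensorEquiv e' (map f x ⊗ₜ map g y) := by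
  rw [tensorEquiv_tmul, tensorEquiv_tmul, map_mul]
  have h1 : h ∘ₗ e.toLinearMap ∘ₗ LinearMap.inl R M N =
      (e'.toLinearMap ∘ₗ LinearMap.inl R M' N') ∘ₗ f := by
    ext x; simp [hfg]
  have h2 : h ∘ₗ e.toLinearMap ∘ₗ LinearMap.inr R M N =
      (e'.toLinearMap ∘ₗ LinearMap.inr R M' N') ∘ₗ g := by
    ext x; simp [hfg]
  congr 1
  · rw [← AlgHom.comp_apply, ← AlgHom.comp_apply, map_comp_map, map_comp_map, h1]
  · rw [← AlgHom.comp_apply, ← AlgHom.comp_apply, map_comp_map, map_comp_map, h2]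

theorem tensorEquiv_tmul_mem (e : (M × N) ≃ₗ[R] P) {m n : ℕ} {x : ExteriorAlgebra R M}
    {y : ExteriorAlgebra R N} (hx : x ∈ ⋀[R]^m M) (hy : y ∈ ⋀[R]^n N) :
    tensorEquiv e (x ⊗ₜ y) ∈ ⋀[R]^(m + n) P := by
  rw [tensorEquiv_tmul]
  exact SetLike.mul_mem_graded (A := fun i : ℕ => ⋀[R]^i P) (map_mem_exteriorPower _ hx)
    (map_mem_exteriorPower _ hy)

end

end ExteriorAlgebra

namespace ComplexAbelianVariety

open ExteriorAlgebra

variable {A B X Y : ComplexAbelianVariety.{u}} {k : Type*} [Field k]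

/-! ### The Künneth formula -/

/-- `H¹(A, k) ⊕ H¹(B, k) ≃ H¹(A × B, k)`. -/
def H1ProdEquiv (k : Type*) [Field k] (A B : ComplexAbelianVariety.{u}) :
    (H1 k A × H1 k B) ≃ₗ[k] H1 k (A.prod B) where
  toFun x := (x.1.coprod x.2).comp (latticeProd A B).toLinearMap
  invFun φ := ((φ.comp (latticeProd A B).symm.toLinearMap).comp (LinearMap.inl ℤ A.Λ B.Λ),
    (φ.comp (latticeProd A B).symm.toLinearMap).comp (LinearMap.inr ℤ A.Λ B.Λ))
  map_add' x y := by
    ext v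
    simp only [LinearMap.comp_apply, LinearMap.coprod_apply, LinearMap.add_apply, Prod.fst_add,
      Prod.snd_add]
    ring
  map_smul' c x := by
    ext v
    simp [mul_add]
  left_inv x := by
    ext v <;> simp
  right_inv φ := by
    ext v
    simp

theorem H1ProdEquiv_apply (x : H1 k A × H1 k B) (l : (A.prod B).Λ) :
    H1ProdEquiv k A B x l = x.1 (latticeProd A B l).1 + x.2 (latticeProd A B l).2 := rfl

theorem H1ProdEquiv_complex : H1ProdEquiv ℂ A B = H1Prod A B := rfl

/-- `H⋆(A, k) ⊗ H⋆(B, k) ≃ H⋆(A × B, k)`. -/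
def kunneth (k : Type*) [Field k] (A B : ComplexAbelianVariety.{u}) :
    (Coh k A ⊗[k] Coh k B) ≃ₗ[k] Coh k (A.prod B) :=
  tensorEquiv (H1ProdEquiv k A B)

theorem kunneth_hom_ext {N : Type*} [AddCommGroup N] [Module k N]
    {f g : Coh k (A.prod B) →ₗ[k] N}
    (h : ∀ x y, f (kunneth k A B (x ⊗ₜ y)) = g (kunneth k A B (x ⊗ₜ y))) : f = g := by
  have : f ∘ₗ (kunneth k A B).toLinearMap = g ∘ₗ (kunneth k A B).toLinearMap :=
    TensorProduct.ext' h
  refine LinearMap.ext fun w => ?_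
  obtain ⟨t, rfl⟩ := (kunneth k A B).surjective w
  exact DFunLike.congr_fun this t

theorem cohComplexify_kunneth (x : Coh ℚ A) (y : Coh ℚ B) :
    (A.prod B).cohComplexify (kunneth ℚ A B (x ⊗ₜ y)) =
      kunneth ℂ A B (A.cohComplexify x ⊗ₜ B.cohComplexify y) := by
  rw [kunneth, kunneth, tensorEquiv_tmul, tensorEquiv_tmul, map_mul]
  have h1 : ∀ φ : H1 ℚ A, (A.prod B).H1Complexify (H1ProdEquiv ℚ A B (φ, 0)) =
      H1ProdEquiv ℂ A B (A.H1Complexify φ, 0) := fun φ => by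
    ext l
    simp [H1Complexify_apply, H1ProdEquiv_apply]
  have h2 : ∀ φ : H1 ℚ B, (A.prod B).H1Complexify (H1ProdEquiv ℚ A B (0, φ)) =
      H1ProdEquiv ℂ A B (0, B.H1Complexify φ) := fun φ => by
    ext l
    simp [H1Complexify_apply, H1ProdEquiv_apply]
  congr 1
  · suffices (A.prod B).cohComplexify.comp (map ((H1ProdEquiv ℚ A B).toLinearMap ∘ₗ
        LinearMap.inl ℚ (H1 ℚ A) (H1 ℚ B))) = ((map ((H1ProdEquiv ℂ A B).toLinearMap ∘ₗ
        LinearMap.inl ℂ (H1 ℂ A) (H1 ℂ B))).restrictScalars ℚ).comp A.cohComplexify from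
      DFunLike.congr_fun this x
    refine ExteriorAlgebra.hom_ext (LinearMap.ext fun φ => ?_)
    simp [h1]
  · suffices (A.prod B).cohComplexify.comp (map ((H1ProdEquiv ℚ A B).toLinearMap ∘ₗ
        LinearMap.inr ℚ (H1 ℚ A) (H1 ℚ B))) = ((map ((H1ProdEquiv ℂ A B).toLinearMap ∘ₗ
        LinearMap.inr ℂ (H1 ℂ A) (H1 ℂ B))).restrictScalars ℚ).comp B.cohComplexify from
      DFunLike.congr_fun this y
    refine ExteriorAlgebra.hom_ext (LinearMap.ext fun φ => ?_)
    simp [h2]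

theorem prodGL_H1Prod (g : A.GLH1) (h : B.GLH1) (φ : H1 ℂ A) (χ : H1 ℂ B) :
    prodGL A B (g, h) (H1Prod A B (φ, χ)) = H1Prod A B (g φ, h χ) := by
  simp [prodGL]

theorem act_prodGL_kunneth (g : A.GLH1) (h : B.GLH1) (x : Coh ℂ A) (y : Coh ℂ B) :
    (A.prod B).act (prodGL A B (g, h)) (kunneth ℂ A B (x ⊗ₜ y)) =
      kunneth ℂ A B (A.act g x ⊗ₜ B.act h y) :=
  map_tensorEquiv _ _ (prodGL_H1Prod g h) x y

theorem galConj_prodGL (σ : ℂ ≃+* ℂ) (g : A.GLH1) (h : B.GLH1) :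
    prodGL A B (galConj σ g, galConj σ h) = galConj σ (prodGL A B (g, h)) := by
  have hgal : ∀ (τ : ℂ ≃+* ℂ) φ χ, (A.prod B).galH1 τ (H1Prod A B (φ, χ)) =
      H1Prod A B (A.galH1 τ φ, B.galH1 τ χ) := fun τ φ χ => by
    ext l
    simp [← H1ProdEquiv_complex, H1ProdEquiv_apply]
  ext1 φ
  obtain ⟨⟨φ, χ⟩, rfl⟩ := (H1Prod A B).surjective φ
  rw [prodGL_H1Prod, galConj_apply, galConj_apply, galConj_apply, hgal, prodGL_H1Prod, hgal]

theorem H1Prod_mem_H10 {φ : H1 ℂ A} {χ : H1 ℂ B} (hφ : φ ∈ A.H10) (hχ : χ ∈ B.H10) :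
    H1Prod A B (φ, χ) ∈ (A.prod B).H10 := by
  obtain ⟨f, rfl⟩ := hφ
  obtain ⟨g, rfl⟩ := hχ
  exact ⟨f.coprod g, rfl⟩

theorem H1Prod_mem_H01 {φ : H1 ℂ A} {χ : H1 ℂ B} (hφ : φ ∈ A.H01) (hχ : χ ∈ B.H01) :
    H1Prod A B (φ, χ) ∈ (A.prod B).H01 := by
  obtain ⟨f, rfl⟩ := hφ
  obtain ⟨g, rfl⟩ := hχ
  exact ⟨f.comp (LinearMap.fst ℂ A.V B.V) + g.comp (LinearMap.snd ℂ A.V B.V), rfl⟩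

theorem hom_H1Prod_ext {N : Type*} [AddCommGroup N] [Module ℂ N]
    {f g : H1 ℂ (A.prod B) →ₗ[ℂ] N}
    (h10 : ∀ φ ∈ A.H10, ∀ χ ∈ B.H10, f (H1Prod A B (φ, χ)) = g (H1Prod A B (φ, χ)))
    (h01 : ∀ φ ∈ A.H01, ∀ χ ∈ B.H01, f (H1Prod A B (φ, χ)) = g (H1Prod A B (φ, χ))) : f = g := by
  ext φ
  obtain ⟨⟨φ, χ⟩, rfl⟩ := (H1Prod A B).surjective φ
  have h : (φ, χ) = (A.projH10 φ, B.projH10 χ) + (φ - A.projH10 φ, χ - B.projH10 χ) := by simp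
  rw [h, map_add, map_add, map_add, h10 _ (projH10_mem φ) _ (projH10_mem χ),
    h01 _ (sub_projH10_mem φ) _ (sub_projH10_mem χ)]

/-- `projHp0` is induced from degree 1, where the splitting of H¹(A × B) respects Hodge types. -/
theorem projHp0_kunneth (x : Coh ℂ A) (y : Coh ℂ B) :
    (A.prod B).projHp0 (kunneth ℂ A B (x ⊗ₜ y)) =
      kunneth ℂ A B (A.projHp0 x ⊗ₜ B.projHp0 y) := by
  have h : (A.prod B).projH10 = (H1Prod A B).toLinearMap ∘ₗ
      (A.projH10.prodMap B.projH10) ∘ₗ (H1Prod A B).symm.toLinearMap := by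
    refine hom_H1Prod_ext (fun φ hφ χ hχ => ?_) fun φ hφ χ hχ => ?_
    · simp [projH10_of_mem_H10 (H1Prod_mem_H10 hφ hχ), projH10_of_mem_H10 hφ,
        projH10_of_mem_H10 hχ]
    · simp [projH10_of_mem_H01 (H1Prod_mem_H01 hφ hχ), projH10_of_mem_H01 hφ,
        projH10_of_mem_H01 hχ, ← Prod.zero_eq_mk]
  refine map_tensorEquiv _ _ (fun φ χ => ?_) x y
  rw [h]
  simp [H1ProdEquiv_complex]

theorem prodGL_hodgeOp (z : Circle) :
    prodGL A B (A.hodgeOp z, B.hodgeOp z) = (A.prod B).hodgeOp z := by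
  apply LinearEquiv.toLinearMap_injective
  refine hom_H1Prod_ext (fun φ hφ χ hχ => ?_) fun φ hφ χ hχ => ?_
  · rw [LinearEquiv.coe_coe, LinearEquiv.coe_coe, prodGL_H1Prod,
      (isHodgeOperator_hodgeOp z).1 φ hφ, (isHodgeOperator_hodgeOp z).1 χ hχ,
      (isHodgeOperator_hodgeOp z).1 _ (H1Prod_mem_H10 hφ hχ), ← map_smul, Prod.smul_mk]
  · rw [LinearEquiv.coe_coe, LinearEquiv.coe_coe, prodGL_H1Prod,
      (isHodgeOperator_hodgeOp z).2 φ hφ, (isHodgeOperator_hodgeOp z).2 χ hχ,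
      (isHodgeOperator_hodgeOp z).2 _ (H1Prod_mem_H01 hφ hχ), ← map_smul, Prod.smul_mk]

theorem hodgeEnd_kunneth (x : Coh ℂ A) (y : Coh ℂ B) :
    (A.prod B).hodgeEnd (kunneth ℂ A B (x ⊗ₜ y)) =
      kunneth ℂ A B (A.hodgeEnd x ⊗ₜ B.hodgeEnd y) := by
  rw [hodgeEnd, ← prodGL_hodgeOp, act_prodGL_kunneth]
  rfl

/-! ### Maps between the cohomologies of products -/

/-- The map `ψ ⊗ β` between the cohomologies of products. -/
def boxMap (ψ : Coh k A →ₗ[k] Coh k X) (β : Coh k B →ₗ[k] Coh k Y) :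
    Coh k (A.prod B) →ₗ[k] Coh k (X.prod Y) :=
  (kunneth k X Y).toLinearMap ∘ₗ TensorProduct.map ψ β ∘ₗ (kunneth k A B).symm.toLinearMap

@[simp]
theorem boxMap_kunneth (ψ : Coh k A →ₗ[k] Coh k X) (β : Coh k B →ₗ[k] Coh k Y) (x : Coh k A)
    (y : Coh k B) : boxMap ψ β (kunneth k A B (x ⊗ₜ y)) = kunneth k X Y (ψ x ⊗ₜ β y) := by
  simp [boxMap]

theorem complexifyMap_boxMap (ψ : Coh ℚ A →ₗ[ℚ] Coh ℚ X) (β : Coh ℚ B →ₗ[ℚ] Coh ℚ Y) :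
    complexifyMap (boxMap ψ β) = boxMap (complexifyMap ψ) (complexifyMap β) := by
  refine coh_hom_ext fun w => ?_
  obtain ⟨t, rfl⟩ := (kunneth ℚ A B).surjective w
  induction t with
  | zero => simp
  | add s t hs ht => simp only [map_add, hs, ht]
  | tmul x y =>
    rw [complexifyMap_cohComplexify, boxMap_kunneth, cohComplexify_kunneth, cohComplexify_kunneth,
      boxMap_kunneth, complexifyMap_cohComplexify, complexifyMap_cohComplexify]

theorem boxMap_mem {m n : ℕ} {ψ : Coh k A →ₗ[k] Coh k X} {β : Coh k B →ₗ[k] Coh k Y}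
    (hψ : ∀ x, ψ x ∈ ⋀[k]^m (H1 k X)) (hβ : ∀ y, β y ∈ ⋀[k]^n (H1 k Y)) (w : Coh k (A.prod B)) :
    boxMap ψ β w ∈ ⋀[k]^(m + n) (H1 k (X.prod Y)) := by
  obtain ⟨t, rfl⟩ := (kunneth k A B).surjective w
  induction t with
  | zero => rw [map_zero, map_zero]; exact zero_mem _
  | add s t hs ht => rw [map_add, map_add]; exact add_mem hs ht
  | tmul x y =>
    rw [boxMap_kunneth]
    exact tensorEquiv_tmul_mem _ (hψ x) (hβ y)

theorem boxMap_hodgeEnd {ψ : Coh ℂ A →ₗ[ℂ] Coh ℂ X} {β : Coh ℂ B →ₗ[ℂ] Coh ℂ Y}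
    (hψ : ∀ x, ψ (A.hodgeEnd x) = X.hodgeEnd (ψ x))
    (hβ : ∀ y, β (B.hodgeEnd y) = Y.hodgeEnd (β y)) (w : Coh ℂ (A.prod B)) :
    boxMap ψ β ((A.prod B).hodgeEnd w) = (X.prod Y).hodgeEnd (boxMap ψ β w) := by
  refine DFunLike.congr_fun (f := boxMap ψ β ∘ₗ (A.prod B).hodgeEnd.toLinearMap)
    (g := (X.prod Y).hodgeEnd.toLinearMap ∘ₗ boxMap ψ β) (kunneth_hom_ext fun x y => ?_) w
  simp [hodgeEnd_kunneth, hψ, hβ]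

/-- Contraction of the cohomology of a product with a linear form on the first factor. -/
def sliceRight (f : Coh k A →ₗ[k] k) : Coh k (A.prod B) →ₗ[k] Coh k B :=
  (TensorProduct.lid k _).toLinearMap ∘ₗ f.rTensor _ ∘ₗ (kunneth k A B).symm.toLinearMap

/-- Contraction of the cohomology of a product with a linear form on the second factor. -/
def sliceLeft (f : Coh k B →ₗ[k] k) : Coh k (A.prod B) →ₗ[k] Coh k A :=
  (TensorProduct.rid k _).toLinearMap ∘ₗ f.lTensor _ ∘ₗ (kunneth k A B).symm.toLinearMap

@[simp]
theorem sliceRight_kunneth (f : Coh k A →ₗ[k] k) (x : Coh k A) (y : Coh k B) :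
    sliceRight f (kunneth k A B (x ⊗ₜ y)) = f x • y := by
  simp [sliceRight]

@[simp]
theorem sliceLeft_kunneth (f : Coh k B →ₗ[k] k) (x : Coh k A) (y : Coh k B) :
    sliceLeft f (kunneth k A B (x ⊗ₜ y)) = f y • x := by
  simp [sliceLeft]

/-- Contracting with both forms gives the same scalar in either order. This transfers nonvanishing
from a slice in B to a slice in A. -/
theorem apply_sliceLeft (f : Coh k A →ₗ[k] k) (g : Coh k B →ₗ[k] k) (w : Coh k (A.prod B)) :
    f (sliceLeft g w) = g (sliceRight f w) := by
  refine DFunLike.congr_fun (f := f ∘ₗ sliceLeft g) (g := g ∘ₗ sliceRight f)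
    (kunneth_hom_ext fun x y => ?_) w
  simp [mul_comm]

/-- The coordinates of `w` along a basis of the cohomology of A are such contractions. -/
theorem exists_sliceRight_ne_zero {w : Coh k (A.prod B)} (hw : w ≠ 0) :
    ∃ f : Coh k A →ₗ[k] k, sliceRight f w ≠ 0 := by
  let b := Module.finBasis k (Coh k A)
  have h : ∀ t i, TensorProduct.equivFinsuppOfBasisLeft (N := Coh k B) b t i =
      TensorProduct.lid k _ ((b.coord i).rTensor _ t) := fun t i => by
    induction t with
    | zero => simp
    | add s t hs ht => simp only [map_add, Finsupp.add_apply, hs, ht]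
    | tmul x y => simp
  by_contra! h0
  apply hw
  apply (kunneth k A B).symm.injective
  apply (TensorProduct.equivFinsuppOfBasisLeft (N := Coh k B) b).injective
  ext1 i
  rw [h, map_zero, map_zero]
  exact h0 (b.coord i)

theorem complexifyMap_sliceRight (f : Coh ℚ A →ₗ[ℚ] ℚ) :
    complexifyMap (sliceRight f : Coh ℚ (A.prod B) →ₗ[ℚ] Coh ℚ B) = sliceRight (extendForm f) := by
  refine coh_hom_ext fun w => ?_
  obtain ⟨t, rfl⟩ := (kunneth ℚ A B).surjective w
  induction t with
  | zero => simp
  | add s t hs ht => simp only [map_add, hs, ht]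
  | tmul x y =>
    rw [complexifyMap_cohComplexify, sliceRight_kunneth, cohComplexify_kunneth, sliceRight_kunneth,
      extendForm_cohComplexify, map_smul, ← algebraMap_smul ℂ]
    rfl

theorem sliceRight_act (f : Coh ℂ A →ₗ[ℂ] ℂ) (h : B.GLH1) (w : Coh ℂ (A.prod B)) :
    sliceRight f ((A.prod B).act (prodGL A B (1, h)) w) = B.act h (sliceRight f w) := by
  refine DFunLike.congr_fun (f := sliceRight f ∘ₗ ((A.prod B).act (prodGL A B (1, h))).toLinearMap)
    (g := (B.act h).toLinearMap ∘ₗ sliceRight f) (kunneth_hom_ext fun x y => ?_) w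
  simp [act_prodGL_kunneth]

theorem sliceLeft_act (f : Coh ℂ B →ₗ[ℂ] ℂ) (g : A.GLH1) (w : Coh ℂ (A.prod B)) :
    sliceLeft f ((A.prod B).act (prodGL A B (g, 1)) w) = A.act g (sliceLeft f w) := by
  refine DFunLike.congr_fun (f := sliceLeft f ∘ₗ ((A.prod B).act (prodGL A B (g, 1))).toLinearMap)
    (g := (A.act g).toLinearMap ∘ₗ sliceLeft f) (kunneth_hom_ext fun x y => ?_) w
  simp [act_prodGL_kunneth]

/-- Reduces the nonvanishing of the holomorphic part of (ψ ⊗ β)(w) to that of ψ at one contraction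
of `w`, which depends on β alone. So ψ can be chosen after β. -/
theorem sliceLeft_projHp0_boxMap (f : Coh ℂ Y →ₗ[ℂ] ℂ) (ψ : Coh ℂ A →ₗ[ℂ] Coh ℂ X)
    (β : Coh ℂ B →ₗ[ℂ] Coh ℂ Y) (w : Coh ℂ (A.prod B)) :
    sliceLeft f ((X.prod Y).projHp0 (boxMap ψ β w)) =
      X.projHp0 (ψ (sliceLeft (f ∘ₗ Y.projHp0.toLinearMap ∘ₗ β) w)) := by
  refine DFunLike.congr_fun (f := sliceLeft f ∘ₗ (X.prod Y).projHp0.toLinearMap ∘ₗ boxMap ψ β)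
    (g := X.projHp0.toLinearMap ∘ₗ ψ ∘ₗ sliceLeft (f ∘ₗ Y.projHp0.toLinearMap ∘ₗ β))
    (kunneth_hom_ext fun x y => ?_) w
  simp [projHp0_kunneth]

/-! ### Domination -/

/-- An isomorphism with a Tate twist commutes with the action of the circle. -/
theorem exists_hodgeEnd_tensorToCoh {n : ℕ} {V : Submodule ℚ (Coh ℚ B)}
    {V' : Submodule ℚ (Coh ℚ Y)} (hV : B.IsHodgeSubstructure n V) {r : ℤ} {f : V ≃ₗ[ℚ] V'}
    (hf : ∀ p q : ℤ, (B.hodgeComponent V (p + r) (q + r)).map (f.toLinearMap.baseChange ℂ) =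
      Y.hodgeComponent V' p q) (t : ℂ ⊗[ℚ] V) :
    ∃ s, B.hodgeEnd (tensorToCoh V t) = tensorToCoh V s ∧
      Y.hodgeEnd (tensorToCoh V' (f.toLinearMap.baseChange ℂ t)) =
        tensorToCoh V' (f.toLinearMap.baseChange ℂ s) := by
  have ht : t ∈ ⨆ p : ℤ, B.hodgeComponent V p (n - p) := hV.2 ▸ Submodule.mem_top
  induction ht using Submodule.iSup_induction' with
  | mem p t ht =>
    have ht' : f.toLinearMap.baseChange ℂ t ∈ Y.hodgeComponent V' (p - r) (n - p - r) := by
      rw [← hf, sub_add_cancel, sub_add_cancel]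
      exact ⟨t, ht, rfl⟩
    refine ⟨(genericCircle : ℂ) ^ (p - (n - p)) • t, ?_, ?_⟩
    · rw [map_smul]
      exact act_of_mem_Hpq _ ht
    · rw [map_smul, map_smul, show p - (n - p) = p - r - (n - p - r) by ring]
      exact act_of_mem_Hpq _ ht'
  | zero => exact ⟨0, by simp, by simp⟩
  | add s t _ _ hs ht =>
    obtain ⟨s', h1, h2⟩ := hs
    obtain ⟨t', h3, h4⟩ := ht
    exact ⟨s' + t', by simp only [map_add, h1, h3], by simp only [map_add, h2, h4]⟩

/-- If `B` is dominated, a rational Hodge structure in its cohomology has a morphism to the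
cohomology of a member of the class whose image has a nonzero `(m, 0)`-part. -/
theorem IsDominated.exists_map {ℬ : Set ComplexAbelianVariety.{u}} (hB : B.IsDominated ℬ) {n : ℕ}
    {Z : Submodule ℚ (Coh ℚ B)} (hZ : B.IsHodgeSubstructure n Z) (hne : Z ≠ ⊥) :
    ∃ Y ∈ ℬ, ∃ (m : ℕ) (β : Coh ℚ B →ₗ[ℚ] Coh ℚ Y), (∀ x, β x ∈ ⋀[ℚ]^m (H1 ℚ Y)) ∧
      (∀ x, complexifyMap β (B.hodgeEnd x) = Y.hodgeEnd (complexifyMap β x)) ∧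
      ∃ x ∈ complexSpan Z, Y.projHp0 (complexifyMap β x) ≠ 0 := by
  obtain ⟨V, hVZ, hV⟩ := hZ.exists_isIrreducible hne
  obtain ⟨Y, hY, m, V', hV', r, f, hf⟩ := hB n V hV
  obtain ⟨p, hpV, hp, hpG⟩ := hV.1.exists_projection
  let p' : Coh ℚ B →ₗ[ℚ] V := p.codRestrict V hpV
  have hp' : ∀ t, complexifyMap p (tensorToCoh V t) = tensorToCoh V t := fun t => by
    induction t with
    | zero => simp
    | add s t hs ht => simp only [map_add, hs, ht]
    | tmul c v => rw [tensorToCoh_tmul, map_smul, complexifyMap_cohComplexify, hp _ v.2]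
  have hrange : ∀ x, ∃ t, complexifyMap p x = tensorToCoh V t ∧
      complexifyMap (V'.subtype ∘ₗ f.toLinearMap ∘ₗ p') x =
        tensorToCoh V' (f.toLinearMap.baseChange ℂ t) := fun x => by
    induction x using coh_induction with
    | hs c x => exact ⟨c ⊗ₜ p' x, by simp [p'], by simp⟩
    | ha x y hx hy =>
      obtain ⟨s, h1, h2⟩ := hx
      obtain ⟨t, h3, h4⟩ := hy
      exact ⟨s + t, by simp only [map_add, h1, h3], by simp only [map_add, h2, h4]⟩
  refine ⟨Y, hY, m, V'.subtype ∘ₗ f.toLinearMap ∘ₗ p', fun x => hV'.1.1 (f (p' x)).2,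
    fun x => ?_, ?_⟩
  · obtain ⟨t, h1, h2⟩ := hrange x
    obtain ⟨s, h3, h4⟩ := hrange (B.hodgeEnd x)
    obtain ⟨s', h5, h6⟩ := exists_hodgeEnd_tensorToCoh hV.1 hf t
    have h7 : complexifyMap p (B.hodgeEnd x) = B.hodgeEnd (complexifyMap p x) :=
      hpG _ (hodgeOp_mem_hodgeGroup _) x
    rw [h3, h1, h5] at h7
    -- The two descriptions of the projection of `hodgeEnd x` to V agree by injectivity, so f and
    -- the projection together commute with the circle.
    rw [h4, h2, h6, tensorToCoh_injective V h7]
  · obtain ⟨x', hx', hne'⟩ := hV'.exists_projHp0_ne_zero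
    rw [← range_tensorToCoh] at hx'
    obtain ⟨t', rfl⟩ := hx'
    obtain ⟨t, rfl⟩ : ∃ t, f.toLinearMap.baseChange ℂ t = t' :=
      ⟨(f.symm.toLinearMap.baseChange ℂ) t', by
        rw [← LinearMap.comp_apply, ← LinearMap.baseChange_comp]
        simp⟩
    refine ⟨tensorToCoh V t, complexSpan_mono hVZ ?_, ?_⟩
    · rw [← range_tensorToCoh]
      exact LinearMap.mem_range_self _ t
    · obtain ⟨s, h1, h2⟩ := hrange (tensorToCoh V t)
      rw [hp'] at h1
      rwa [h2, ← tensorToCoh_injective V h1]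

/-- If `A` is `ℂ`-dominated, a submodule of its cohomology over the Hodge group has an equivariant
map to the cohomology of a member of the class whose image has a nonzero `(m, 0)`-part. -/
theorem IsCDominated.exists_map {𝒜 : Set ComplexAbelianVariety.{u}} (hA : A.IsCDominated 𝒜) {n : ℕ}
    {Z : Submodule ℂ (Coh ℂ A)} (hZ : A.IsHodgeGroupSubmodule Z) (hn : Z ≤ ⋀[ℂ]^n (H1 ℂ A))
    (hne : Z ≠ ⊥) :
    ∃ X ∈ 𝒜, ∃ (m : ℕ) (ψ : Coh ℂ A →ₗ[ℂ] Coh ℂ X), (∀ x, ψ x ∈ ⋀[ℂ]^m (H1 ℂ X)) ∧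
      (∀ g ∈ A.hodgeGroup, ∀ h, prodGL A X (g, h) ∈ (A.prod X).hodgeGroup → ∀ x,
        ψ (A.act g x) = X.act h (ψ x)) ∧
      ∃ z ∈ Z, X.projHp0 (ψ z) ≠ 0 := by
  obtain ⟨U, hUZ, hU⟩ := hZ.exists_isIrreducible hne
  obtain ⟨X, hX, m, U', hU'm, -, ⟨f, hf⟩, ω, hωU', hω, hω0⟩ := hA U hU
  obtain ⟨q, hqU, hq, hqG⟩ := hU.1.exists_projection (hUZ.trans hn)
  refine ⟨X, hX, m, U'.subtype ∘ₗ f.toLinearMap ∘ₗ q.codRestrict U hqU,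
    fun x => hU'm (f (q.codRestrict U hqU x)).2, fun g hg h hgh x => ?_,
    f.symm ⟨ω, hωU'⟩, hUZ (f.symm ⟨ω, hωU'⟩).2, ?_⟩
  · exact hf g h hgh _ _ (hqG g hg x)
  · have : q.codRestrict U hqU (f.symm ⟨ω, hωU'⟩) = f.symm ⟨ω, hωU'⟩ :=
      Subtype.ext (hq _ (f.symm ⟨ω, hωU'⟩).2)
    simpa [this, projHp0_of_mem hω] using hω0

/-! ### Injective morphisms and Tate twists -/

theorem ratCoord_complexifyMap (F : Coh ℚ A →ₗ[ℚ] Coh ℚ X) (x : Coh ℂ A) (j) :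
    X.ratCoord (complexifyMap F x) j = F (A.ratCoord x j) := by
  induction x using coh_induction with
  | hs c x =>
    rw [map_smul, complexifyMap_cohComplexify, ratCoord_smul_cohComplexify,
      ratCoord_smul_cohComplexify, map_smul]
  | ha x y hx hy => simp only [map_add, Finsupp.add_apply, hx, hy]

/-- Rational coordinates commute with F, so both conditions can be tested coordinate by coordinate.
-/
theorem mem_complexSpan_inf_ker {W : Submodule ℚ (Coh ℚ A)} {F : Coh ℚ A →ₗ[ℚ] Coh ℚ X}
    {x : Coh ℂ A} : x ∈ complexSpan (W ⊓ LinearMap.ker F) ↔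
      x ∈ complexSpan W ∧ complexifyMap F x = 0 := by
  rw [mem_complexSpan_iff, mem_complexSpan_iff, ← X.ratCoord.map_eq_zero_iff, Finsupp.ext_iff]
  simp only [ratCoord_complexifyMap, Submodule.mem_inf, LinearMap.mem_ker, forall_and,
    Finsupp.coe_zero, Pi.zero_apply]

theorem complexifyMap_mem_exteriorPower {m : ℕ} {F : Coh ℚ A →ₗ[ℚ] Coh ℚ X}
    (hF : ∀ x, F x ∈ ⋀[ℚ]^m (H1 ℚ X)) (x : Coh ℂ A) :
    complexifyMap F x ∈ ⋀[ℂ]^m (H1 ℂ X) := by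
  rw [← complexSpan_exteriorPower]
  induction x using coh_induction with
  | hs c x =>
    rw [map_smul, complexifyMap_cohComplexify]
    exact Submodule.smul_mem _ _ (cohComplexify_mem_complexSpan (hF x))
  | ha x y hx hy => rw [map_add]; exact add_mem hx hy

theorem exists_equiv_map {W : Submodule ℚ (Coh ℚ A)} {F : Coh ℚ A →ₗ[ℚ] Coh ℚ X}
    (hinj : W ⊓ LinearMap.ker F = ⊥) : ∃ f : W ≃ₗ[ℚ] W.map F, ∀ x, (f x : Coh ℚ X) = F x := by
  refine ⟨LinearEquiv.ofBijective (F.submoduleMap W) ⟨?_, F.submoduleMap_surjective W⟩,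
    fun _ => rfl⟩
  refine (injective_iff_map_eq_zero _).2 fun x hx => ?_
  have : (x : Coh ℚ A) ∈ W ⊓ LinearMap.ker F := ⟨x.2, congrArg Subtype.val hx⟩
  rw [hinj, Submodule.mem_bot] at this
  exact Subtype.ext this

theorem eq_zero_of_complexifyMap_eq_zero {W : Submodule ℚ (Coh ℚ A)} {F : Coh ℚ A →ₗ[ℚ] Coh ℚ X}
    (hinj : W ⊓ LinearMap.ker F = ⊥) {x : Coh ℂ A} (hx : x ∈ complexSpan W)
    (h : complexifyMap F x = 0) : x = 0 := by
  have h1 := mem_complexSpan_inf_ker.2 ⟨hx, h⟩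
  rwa [complexSpan_eq_bot.2 hinj, Submodule.mem_bot] at h1

/-- The weights of Hodge structures related by an injective morphism have the same parity. -/
theorem IsHodgeSubstructure.exists_weight_eq {n m : ℕ} {W : Submodule ℚ (Coh ℚ A)}
    (hW : A.IsHodgeSubstructure n W) {F : Coh ℚ A →ₗ[ℚ] Coh ℚ X}
    (hFm : ∀ x, F x ∈ ⋀[ℚ]^m (H1 ℚ X))
    (hF : ∀ x, complexifyMap F (A.hodgeEnd x) = X.hodgeEnd (complexifyMap F x))
    (hinj : W ⊓ LinearMap.ker F = ⊥) (hne : W ≠ ⊥) : ∃ r : ℤ, (n : ℤ) = m + 2 * r := by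
  by_contra! hr
  refine hne (complexSpan_eq_bot.1 (eq_bot_iff.2 ?_))
  rw [← range_tensorToCoh]
  rintro _ ⟨t, rfl⟩
  have ht : t ∈ ⨆ p : ℤ, A.hodgeComponent W p (n - p) := hW.2 ▸ Submodule.mem_top
  induction ht using Submodule.iSup_induction' with
  | mem p t ht =>
    refine eq_zero_of_complexifyMap_eq_zero hinj
      (range_tensorToCoh W ▸ LinearMap.mem_range_self _ t) ?_
    -- If n and m had different parity, no type (a, b) with a + b = m could have the same difference
    -- as (p, n − p); an equality would give the twist r = p − a.
    refine eq_zero_of_hodgeEnd (d := p - (n - p)) (fun a b hab h => hr (p - a) (by linarith))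
      (complexifyMap_mem_exteriorPower hFm _) ?_
    have h1 : A.hodgeEnd (tensorToCoh W t) = _ := act_of_mem_Hpq _ (mem_hodgeComponent.1 ht)
    rw [← hF, h1, map_smul]
  | zero => simp
  | add s t _ _ hs ht => rw [map_add]; exact add_mem hs ht

/-- For p + q = m both types are detected by the same eigenvalue of the circle, and F is equivariant
and injective on `W`. For other p, q both sides force x = 0. -/
theorem IsHodgeSubstructure.mem_Hpq_iff {n m : ℕ} {W : Submodule ℚ (Coh ℚ A)}
    (hW : A.IsHodgeSubstructure n W) {F : Coh ℚ A →ₗ[ℚ] Coh ℚ X}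
    (hFm : ∀ x, F x ∈ ⋀[ℚ]^m (H1 ℚ X))
    (hF : ∀ x, complexifyMap F (A.hodgeEnd x) = X.hodgeEnd (complexifyMap F x))
    (hinj : W ⊓ LinearMap.ker F = ⊥) {r : ℤ} (hr : (n : ℤ) = m + 2 * r) (p q : ℤ)
    {x : Coh ℂ A} (hx : x ∈ complexSpan W) :
    x ∈ A.Hpq (p + r) (q + r) ↔ complexifyMap F x ∈ X.Hpq p q := by
  have hxn : x ∈ ⋀[ℂ]^n (H1 ℂ A) := complexSpan_exteriorPower (A := A) n ▸ complexSpan_mono hW.1 hx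
  have hFx := complexifyMap_mem_exteriorPower hFm x
  by_cases hpq : p + q = m
  · refine ⟨fun h => mem_Hpq_of_hodgeEnd hpq hFx ?_, fun h =>
      mem_Hpq_of_hodgeEnd (by linarith) hxn ?_⟩
    · have h1 : A.hodgeEnd x = _ := act_of_mem_Hpq _ h
      rw [← hF, h1, map_smul, add_sub_add_right_eq_sub]
    · have h1 : X.hodgeEnd (complexifyMap F x) = _ := act_of_mem_Hpq _ h
      rw [add_sub_add_right_eq_sub, ← sub_eq_zero]
      refine eq_zero_of_complexifyMap_eq_zero hinj
        (sub_mem (hW.act_mem _ hx) (Submodule.smul_mem _ _ hx)) ?_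
      rw [map_sub, hF, h1, map_smul, sub_self]
  · constructor
    · intro h
      rw [eq_zero_of_mem_Hpq (n := n) (fun h' => hpq (by linarith)) hxn h, map_zero]
      exact zero_mem _
    · intro h
      rw [eq_zero_of_complexifyMap_eq_zero hinj hx (eq_zero_of_mem_Hpq hpq hFx h)]
      exact zero_mem _

theorem tensorToCoh_baseChange {W : Submodule ℚ (Coh ℚ A)} {W' : Submodule ℚ (Coh ℚ X)}
    {F : Coh ℚ A →ₗ[ℚ] Coh ℚ X} {f : W →ₗ[ℚ] W'} (hf : ∀ x, (f x : Coh ℚ X) = F x)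
    (t : ℂ ⊗[ℚ] W) : tensorToCoh W' (f.baseChange ℂ t) = complexifyMap F (tensorToCoh W t) := by
  induction t with
  | zero => simp
  | add s t hs ht => simp only [map_add, hs, ht]
  | tmul c v =>
    rw [LinearMap.baseChange_tmul, tensorToCoh_tmul, tensorToCoh_tmul, map_smul,
      complexifyMap_cohComplexify, hf]

/-- A bijective morphism of Hodge structures, possibly of different weights, is an isomorphism with
a Tate twist. -/
theorem IsHodgeSubstructure.isIsoToTateTwist_map {n m : ℕ} {W : Submodule ℚ (Coh ℚ A)}
    (hW : A.IsHodgeSubstructure n W) {F : Coh ℚ A →ₗ[ℚ] Coh ℚ X}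
    (hFm : ∀ x, F x ∈ ⋀[ℚ]^m (H1 ℚ X))
    (hF : ∀ x, complexifyMap F (A.hodgeEnd x) = X.hodgeEnd (complexifyMap F x))
    (hinj : W ⊓ LinearMap.ker F = ⊥) (hne : W ≠ ⊥) : IsIsoToTateTwist W (W.map F) := by
  obtain ⟨f, hf⟩ := exists_equiv_map hinj
  obtain ⟨r, hr⟩ := hW.exists_weight_eq hFm hF hinj hne
  have key : ∀ p q t, t ∈ A.hodgeComponent W (p + r) (q + r) ↔
      f.toLinearMap.baseChange ℂ t ∈ X.hodgeComponent (W.map F) p q := fun p q t => by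
    rw [mem_hodgeComponent, mem_hodgeComponent, tensorToCoh_baseChange (F := F) hf]
    exact hW.mem_Hpq_iff hFm hF hinj hr p q (range_tensorToCoh W ▸ LinearMap.mem_range_self _ t)
  refine ⟨r, f, fun p q => le_antisymm ?_ fun t' ht' => ?_⟩
  · rintro _ ⟨t, ht, rfl⟩
    exact (key p q t).1 ht
  · obtain ⟨t, rfl⟩ := LinearMap.lTensor_surjective ℂ f.surjective t'
    exact ⟨t, (key p q t).2 ht', rfl⟩

/-- A morphism from an irreducible Hodge structure to the cohomology of `X` whose image has a
nonzero `(m, 0)`-part is an isomorphism, up to a Tate twist, to a fully twisted Hodge structure. -/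
theorem IsIrreducibleHodgeSubstructure.isFullyTwisted_map {n m : ℕ} {W : Submodule ℚ (Coh ℚ A)}
    (hW : A.IsIrreducibleHodgeSubstructure n W) {F : Coh ℚ A →ₗ[ℚ] Coh ℚ X}
    (hFm : ∀ x, F x ∈ ⋀[ℚ]^m (H1 ℚ X))
    (hF : ∀ x, complexifyMap F (A.hodgeEnd x) = X.hodgeEnd (complexifyMap F x))
    {w : Coh ℂ A} (hw : w ∈ complexSpan W) (hne : X.projHp0 (complexifyMap F w) ≠ 0) :
    X.IsFullyTwisted m (W.map F) ∧ IsIsoToTateTwist W (W.map F) := by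
  have hle : W.map F ≤ ⋀[ℚ]^m (H1 ℚ X) := Submodule.map_le_iff_le_comap.2 fun x _ => hFm x
  have hmap : X.IsHodgeSubstructure m (W.map F) := by
    refine isHodgeSubstructure_of_hodgeEnd hle ?_
    rw [complexSpan_map]
    rintro _ ⟨x, hx, rfl⟩
    rw [← hF]
    exact ⟨_, hW.1.act_mem _ hx, rfl⟩
  refine ⟨hmap.isFullyTwisted (complexSpan_map F W ▸ ⟨w, hw, rfl⟩) hne,
    hW.1.isIsoToTateTwist_map hFm hF ?_ hW.2.1⟩
  -- The kernel of F in `W` is a Hodge substructure, and it is not all of `W` because F(w) ≠ 0.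
  refine (hW.2.2 _ inf_le_left ?_).resolve_right fun h => hne ?_
  · refine isHodgeSubstructure_of_hodgeEnd (inf_le_left.trans hW.1.1) fun x hx => ?_
    rw [mem_complexSpan_inf_ker] at hx ⊢
    exact ⟨hW.1.act_mem _ hx.1, by rw [hF, hx.2, map_zero]⟩
  · rw [← h, mem_complexSpan_inf_ker] at hw
    rw [hw.2, map_zero]

/-- A rational component of an equivariant map. -/
theorem exists_ratComponent {𝒢 : Set (A.GLH1 × X.GLH1)} {P : Type*} [AddCommGroup P] [Module ℂ P]
    (L : (Coh ℂ A →ₗ[ℂ] Coh ℂ X) →ₗ[ℂ] P)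
    (h𝒢 : ∀ (σ : ℂ ≃+* ℂ), ∀ x ∈ 𝒢, (galConj σ x.1, galConj σ x.2) ∈ 𝒢) {m : ℕ}
    {ψ : Coh ℂ A →ₗ[ℂ] Coh ℂ X} (hm : ∀ x, ψ x ∈ ⋀[ℂ]^m (H1 ℂ X))
    (hψ : ∀ x ∈ 𝒢, ∀ y, ψ (A.act x.1 y) = X.act x.2 (ψ y)) (hL : L ψ ≠ 0) :
    ∃ ψ' : Coh ℚ A →ₗ[ℚ] Coh ℚ X, (∀ x, ψ' x ∈ ⋀[ℚ]^m (H1 ℚ X)) ∧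
      (∀ x ∈ 𝒢, ∀ y, complexifyMap ψ' (A.act x.1 y) = X.act x.2 (complexifyMap ψ' y)) ∧
      L (complexifyMap ψ') ≠ 0 := by
  obtain ⟨s, hs⟩ := exists_eq_sum_ratComponent ψ
  rw [hs s subset_rfl, map_sum] at hL
  obtain ⟨j, -, hj⟩ := Finset.exists_ne_zero_of_sum_ne_zero hL
  refine ⟨ratComponent ψ j, fun x => ?_, fun x hx => complexifyMap_ratComponent_act h𝒢 hψ j hx,
    fun h => hj (by rw [map_smul, h, smul_zero])⟩
  rw [ratComponent_apply]
  exact ratCoord_mem (complexSpan_exteriorPower (A := X) m ▸ hm _) j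

/-! ### The product theorem -/

theorem IsCDominated.isDominated_prod {𝒜 ℬ : Set ComplexAbelianVariety.{u}}
    (hG : (A.prod B).hodgeGroup = (A.hodgeGroup.prod B.hodgeGroup).map (prodGL A B))
    (hA : A.IsCDominated 𝒜) (hB : B.IsDominated ℬ) :
    (A.prod B).IsDominated {Z | ∃ X ∈ 𝒜, ∃ Y ∈ ℬ, Z = X.prod Y} := by
  intro n W hW
  have hmem : ∀ g ∈ A.hodgeGroup, ∀ h ∈ B.hodgeGroup, ∀ w ∈ complexSpan W,
      (A.prod B).act (prodGL A B (g, h)) w ∈ complexSpan W := fun g hg h hh w hw =>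
    hW.1.act_mem_of_mem_hodgeGroup (hG ▸ ⟨(g, h), ⟨hg, hh⟩, rfl⟩) hw
  obtain ⟨w₀, hw₀, hne₀⟩ := W.exists_mem_ne_zero_of_ne_bot hW.2.1
  obtain ⟨l, hl⟩ := exists_sliceRight_ne_zero hne₀
  obtain ⟨b, hb⟩ := exists_degreeProj_ne_zero hl
  -- The form `l` is rational, so the slice is a rational subspace; stability under 1 × G(B) makes
  -- its degree b part a Hodge structure.
  have hZB : B.IsHodgeSubstructure b (W.map (degreeProj ℚ b ∘ₗ sliceRight l)) := by
    refine isHodgeSubstructure_of_hodgeEnd ?_ ?_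
    · rintro _ ⟨x, -, rfl⟩
      exact degreeProj_mem b _
    · rw [complexSpan_map, complexifyMap_comp, complexifyMap_degreeProj, complexifyMap_sliceRight]
      rintro _ ⟨x, hx, rfl⟩
      refine ⟨_, hmem 1 (one_mem _) _ (hodgeOp_mem_hodgeGroup genericCircle) x hx, ?_⟩
      rw [LinearMap.comp_apply, LinearMap.comp_apply, sliceRight_act, ← act_degreeProj]
      rfl
  obtain ⟨Y, hY, m, β, hβm, hβ, y, hy, hy0⟩ := hB.exists_map hZB fun h =>
    hb ((Submodule.mem_bot ℚ).1 (h ▸ ⟨w₀, hw₀, rfl⟩))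
  rw [complexSpan_map, complexifyMap_comp, complexifyMap_degreeProj, complexifyMap_sliceRight] at hy
  obtain ⟨w₁, hw₁, rfl⟩ := hy
  set β' := β ∘ₗ degreeProj ℚ b with hβ'
  have hβ'C : complexifyMap β' = complexifyMap β ∘ₗ degreeProj ℂ b := by
    rw [hβ', complexifyMap_comp, complexifyMap_degreeProj]
  obtain ⟨μ, hμ⟩ : ∃ μ : Module.Dual ℂ (Coh ℂ Y),
      μ (Y.projHp0 (complexifyMap β' (sliceRight (extendForm l) w₁))) ≠ 0 := by
    by_contra! h
    rw [Module.forall_dual_apply_eq_zero_iff, hβ'C] at h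
    exact hy0 h
  -- ν involves Hodge types and is in general not rational, so slicing with it gives only a complex
  -- G(A)-submodule.
  set ν := μ ∘ₗ Y.projHp0.toLinearMap ∘ₗ complexifyMap β' with hν
  have hslice : sliceLeft ν w₁ ≠ 0 := fun h => hμ (by
    change ν (sliceRight (extendForm l) w₁) = 0
    rw [← apply_sliceLeft, h, map_zero])
  obtain ⟨a, ha⟩ := exists_degreeProj_ne_zero hslice
  obtain ⟨X, hX, d, ψ, hψd, hψ, z, hz, hz0⟩ := hA.exists_map (n := a)
    (Z := (complexSpan W).map (degreeProj ℂ a ∘ₗ sliceLeft ν))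
    (by
      rintro g hg _ ⟨x, hx, rfl⟩
      refine ⟨_, hmem g hg 1 (one_mem _) x hx, ?_⟩
      rw [LinearMap.comp_apply, LinearMap.comp_apply, sliceLeft_act, ← act_degreeProj])
    (by
      rintro _ ⟨x, -, rfl⟩
      exact degreeProj_mem a _)
    (fun h => ha ((Submodule.mem_bot ℂ).1 (h ▸ ⟨w₁, hw₁, rfl⟩)))
  obtain ⟨w, hw, rfl⟩ := hz
  -- Descent needs a set of operators stable under Aut(ℂ), which the circle operators alone need not
  -- be. This is why equivariance under all of G(A × X) is used.
  obtain ⟨ψ', hψ'd, hψ', hψ'0⟩ := exists_ratComponent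
    (𝒢 := {x | x.1 ∈ A.hodgeGroup ∧ prodGL A X x ∈ (A.prod X).hodgeGroup})
    (ψ := ψ ∘ₗ degreeProj ℂ a)
    (X.projHp0.toLinearMap ∘ₗ LinearMap.applyₗ (sliceLeft ν w))
    (fun σ x hx => ⟨galConj_mem_hodgeGroup σ hx.1, by
      rw [galConj_prodGL]
      exact galConj_mem_hodgeGroup σ hx.2⟩)
    (fun x => hψd _)
    (fun x hx y => by
      rw [LinearMap.comp_apply, LinearMap.comp_apply, ← act_degreeProj]
      exact hψ _ hx.1 _ hx.2 _)
    hz0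
  have hres := hW.isFullyTwisted_map (X := X.prod Y) (F := boxMap ψ' β') (m := d + m) (w := w)
    (boxMap_mem hψ'd fun y => hβm _)
    (by
      rw [complexifyMap_boxMap]
      refine boxMap_hodgeEnd (hψ' (A.hodgeOp genericCircle, X.hodgeOp genericCircle)
        ⟨hodgeOp_mem_hodgeGroup _, ?_⟩) fun y => ?_
      · rw [prodGL_hodgeOp]
        exact hodgeOp_mem_hodgeGroup _
      · rw [hβ'C, LinearMap.comp_apply, LinearMap.comp_apply, hodgeEnd, ← act_degreeProj]
        exact hβ _)
    hw
    (fun h => hψ'0 (by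
      rw [complexifyMap_boxMap] at h
      -- Contracting the holomorphic part of F(w) with μ gives the holomorphic part of ψ' at the
      -- ν-slice of w, which is nonzero.
      have h1 := sliceLeft_projHp0_boxMap μ (complexifyMap ψ') (complexifyMap β') w
      rw [h, map_zero] at h1
      exact h1.symm))
  exact ⟨X.prod Y, ⟨X, hX, Y, hY, rfl⟩, d + m, _, hres⟩

end ComplexAbelianVariety

end

theorem proposition3p4 (A B : ComplexAbelianVariety.{u}) (𝒜 ℬ : Set ComplexAbelianVariety.{u})
    (hG : (A.prod B).hodgeGroup =
      (A.hodgeGroup.prod B.hodgeGroup).map (ComplexAbelianVariety.prodGL A B))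
    (hA : A.IsCDominated 𝒜) (hB : B.IsDominated ℬ) :
    (A.prod B).IsDominated {Z | ∃ X ∈ 𝒜, ∃ Y ∈ ℬ, Z = X.prod Y} :=
  hA.isDominated_prod hG hB
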